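/- Let $M$ be a compact (Hausdorff, boundaryless) smooth $4$-manifold with a smooth almost Hermitian structure $(g,J,\omega)$: $g$ is a smooth Riemannian metric, $J$ is a smooth almost complex structure ($J^2=-\mathrm{Id}$) with $g(J\cdot,J\cdot)=g(\cdot,\cdot)$, and $\omega=g(J\cdot,\cdot)$. Let $\theta$ be the Lee form, i.e. the unique smooth $1$-form with $d\omega=\theta\wedge\omega$. Assume that (1) $(M,g,J,\omega)$ is of class $\mathcal{AH}_1$, i.e. the Riemann curvature tensor of $g$ satisfies $R(X,Y,Z,W)=R(X,Y,JZ,JW)$ for all tangent vectors $X,Y,Z,W$ at each point; (2) $d\theta=0$, i.e. the structure is locally conformally almost Kähler; (3) the scalar curvature of $g$ vanishes at no point of $M$. Then $(M,g,J,\omega)$ is Kähler: $J$ is integrable, in the sense that its Nijenhuis tensor $N(X,Y)=[JX,JY]-[X,Y]-J[JX,Y]-J[X,JY]$ vanishes identically, and $d\omega=0$. -/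

import Mathlib

open scoped Manifold ContDiff

noncomputable section

namespace AlmostHermitian

/-- The model space `ℝ⁴`. -/
abbrev E4 : Type := EuclideanSpace ℝ (Fin 4)

/-! ### Tensor calculus on open subsets of `ℝ⁴`

A metric is given by the matrix of its components `G y i j = g_{ij}(y)`, an endomorphism field by
`A y a i = A^a_i(y)` (that is, `A ∂_i = ∑ a, A^a_i ∂_a`). -/

/-- The partial derivative `∂_i f` at `y`. -/
def pderiv (i : Fin 4) (f : E4 → ℝ) (y : E4) : ℝ :=
  fderiv ℝ f y (EuclideanSpace.single i 1)

/-- The Christoffel symbols of the Levi-Civita connection, `∇_{∂_i} ∂_j = ∑ k, Γ^k_{ij} ∂_k`, where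
`Γ^k_{ij} = ½ ∑ l, g^{kl} (∂_i g_{jl} + ∂_j g_{il} - ∂_l g_{ij})`. -/
def christoffel (G : E4 → Matrix (Fin 4) (Fin 4) ℝ) (k i j : Fin 4) (y : E4) : ℝ :=
  (1 / 2 : ℝ) * ∑ l, (G y)⁻¹ k l *
    (pderiv i (fun z => G z j l) y + pderiv j (fun z => G z i l) y - pderiv l (fun z => G z i j) y)

/-- The components `R^l` of `R(∂_i, ∂_j) ∂_k = ∑ l, R^l ∂_l`, where
`R(X, Y) Z = ∇_X ∇_Y Z - ∇_Y ∇_X Z - ∇_{[X, Y]} Z`. -/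
def curvature (G : E4 → Matrix (Fin 4) (Fin 4) ℝ) (l i j k : Fin 4) (y : E4) : ℝ :=
  pderiv i (christoffel G l j k) y - pderiv j (christoffel G l i k) y +
    ∑ m, (christoffel G l i m y * christoffel G m j k y -
      christoffel G l j m y * christoffel G m i k y)

/-- The components `R_{ijkl} = g(R(∂_i, ∂_j) ∂_k, ∂_l)` of the Riemann curvature tensor. -/
def riemann (G : E4 → Matrix (Fin 4) (Fin 4) ℝ) (i j k l : Fin 4) (y : E4) : ℝ :=
  ∑ m, curvature G m i j k y * G y m l

/-- The components of the Ricci tensor, `Ric(Y, Z) = tr (X ↦ R(X, Y) Z)`. -/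
def ricci (G : E4 → Matrix (Fin 4) (Fin 4) ℝ) (j k : Fin 4) (y : E4) : ℝ :=
  ∑ i, curvature G i i j k y

/-- The scalar curvature `s = ∑ j k, g^{jk} Ric_{jk}`. -/
def scalarCurvature (G : E4 → Matrix (Fin 4) (Fin 4) ℝ) (y : E4) : ℝ :=
  ∑ j, ∑ k, (G y)⁻¹ j k * ricci G j k y

/-- The components `N^k` of the Nijenhuis tensor
`N(X, Y) = [AX, AY] - [X, Y] - A[AX, Y] - A[X, AY]` on `X = ∂_i`, `Y = ∂_j`
(so `[X, Y] = 0`, `[AX, Y] = -∂_j (A X)`, `[X, AY] = ∂_i (A Y)`). -/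
def nijenhuis (A : E4 → Matrix (Fin 4) (Fin 4) ℝ) (k i j : Fin 4) (y : E4) : ℝ :=
  ∑ l, (A y l i * pderiv l (fun z => A z k j) y - A y l j * pderiv l (fun z => A z k i) y)
    + ∑ l, A y k l * pderiv j (fun z => A z l i) y
    - ∑ l, A y k l * pderiv i (fun z => A z l j) y

/-- The components `(dα)_{ij} = ∂_i α_j - ∂_j α_i` of the exterior derivative of a 1-form. -/
def extDerivOne (α : E4 → Fin 4 → ℝ) (i j : Fin 4) (y : E4) : ℝ :=
  pderiv i (fun z => α z j) y - pderiv j (fun z => α z i) y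

/-- The components `(dβ)_{ijk} = ∂_i β_{jk} + ∂_j β_{ki} + ∂_k β_{ij}` of the exterior derivative
of a 2-form. -/
def extDerivTwo (β : E4 → Matrix (Fin 4) (Fin 4) ℝ) (i j k : Fin 4) (y : E4) : ℝ :=
  pderiv i (fun z => β z j k) y + pderiv j (fun z => β z k i) y + pderiv k (fun z => β z i j) y

/-- The components `(α ∧ β)_{ijk} = α_i β_{jk} + α_j β_{ki} + α_k β_{ij}` of the wedge product of
a 1-form and a 2-form. -/
def wedgeOneTwo (α : E4 → Fin 4 → ℝ) (β : E4 → Matrix (Fin 4) (Fin 4) ℝ) (i j k : Fin 4)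
    (y : E4) : ℝ :=
  α y i * β y j k + α y j * β y k i + α y k * β y i j

/-! ### Almost Hermitian structures -/

/-- A smooth almost Hermitian structure `(g, J)` on a smooth 4-manifold: a smooth Riemannian
metric `g` and a smooth `g`-orthogonal almost complex structure `J`. -/
structure AlmostHermitianStructure (M : Type*) [TopologicalSpace M] [ChartedSpace E4 M]
    [IsManifold 𝓘(ℝ, E4) ∞ M] where
  /-- the Riemannian metric -/
  g : Bundle.ContMDiffRiemannianMetric 𝓘(ℝ, E4) ∞ E4 (fun x : M => TangentSpace 𝓘(ℝ, E4) x)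
  /-- the almost complex structure -/
  J : ∀ x : M, TangentSpace 𝓘(ℝ, E4) x →L[ℝ] TangentSpace 𝓘(ℝ, E4) x
  smooth_J : ContMDiff 𝓘(ℝ, E4) (𝓘(ℝ, E4).prod 𝓘(ℝ, E4 →L[ℝ] E4)) ∞
    (fun x : M => Bundle.TotalSpace.mk' (E4 →L[ℝ] E4)
      (E := fun x : M => TangentSpace 𝓘(ℝ, E4) x →L[ℝ] TangentSpace 𝓘(ℝ, E4) x) x (J x))
  J_sq : ∀ (x : M) (v : TangentSpace 𝓘(ℝ, E4) x), J x (J x v) = -v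
  J_orthogonal : ∀ (x : M) (v w : TangentSpace 𝓘(ℝ, E4) x),
    g.inner x (J x v) (J x w) = g.inner x v w

section Charts

variable {M : Type*} [TopologicalSpace M] [ChartedSpace E4 M]

/-- The coordinate vector `∂_i` of the chart `e` at the point `e.symm y` of `M`. -/
def coordVec (e : OpenPartialHomeomorph M E4) (i : Fin 4) (y : E4) :
    TangentSpace 𝓘(ℝ, E4) (e.symm y) :=
  mfderiv 𝓘(ℝ, E4) 𝓘(ℝ, E4) e.symm y (EuclideanSpace.single i (1 : ℝ) : E4)

/-- The `a`-th component in the chart `e` of a tangent vector of `M` at `x`. -/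
def vecCoord (e : OpenPartialHomeomorph M E4) (a : Fin 4) (x : M)
    (v : TangentSpace 𝓘(ℝ, E4) x) : ℝ :=
  (show E4 from mfderiv 𝓘(ℝ, E4) 𝓘(ℝ, E4) e x v) a

/-- The components `θ_i = θ(∂_i)` of a 1-form on `M` in the chart `e`. -/
def formCoef (θ : ∀ x : M, TangentSpace 𝓘(ℝ, E4) x →L[ℝ] ℝ) (e : OpenPartialHomeomorph M E4)
    (y : E4) (i : Fin 4) : ℝ :=
  θ (e.symm y) (coordVec e i y)

/-- A 1-form on `M` is smooth: its components in every chart of the atlas are smooth. -/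
def IsSmoothForm (θ : ∀ x : M, TangentSpace 𝓘(ℝ, E4) x →L[ℝ] ℝ) : Prop :=
  ∀ e ∈ atlas E4 M, ∀ i, ContDiffOn ℝ ∞ (fun y => formCoef θ e y i) e.target

end Charts

namespace AlmostHermitianStructure

variable {M : Type*} [TopologicalSpace M] [ChartedSpace E4 M] [IsManifold 𝓘(ℝ, E4) ∞ M]

/-- The components `g_{ij} = g(∂_i, ∂_j)` of the metric in the chart `e`. -/
def metricCoef (S : AlmostHermitianStructure M) (e : OpenPartialHomeomorph M E4) (y : E4) :
    Matrix (Fin 4) (Fin 4) ℝ :=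
  Matrix.of fun i j => S.g.inner (e.symm y) (coordVec e i y) (coordVec e j y)

/-- The components `J^a_i` of `J` in the chart `e`: `J ∂_i = ∑ a, J^a_i ∂_a`. -/
def acsCoef (S : AlmostHermitianStructure M) (e : OpenPartialHomeomorph M E4) (y : E4) :
    Matrix (Fin 4) (Fin 4) ℝ :=
  Matrix.of fun a i => vecCoord e a (e.symm y) (S.J (e.symm y) (coordVec e i y))

/-- The components `ω_{ij} = g(J ∂_i, ∂_j)` of the fundamental 2-form in the chart `e`. -/
def omegaCoef (S : AlmostHermitianStructure M) (e : OpenPartialHomeomorph M E4) (y : E4) :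
    Matrix (Fin 4) (Fin 4) ℝ :=
  Matrix.of fun i j => S.g.inner (e.symm y) (S.J (e.symm y) (coordVec e i y)) (coordVec e j y)

/-- Gray's first condition `R(X, Y, Z, W) = R(X, Y, JZ, JW)`: the class `AH₁`. -/
def IsAH1 (S : AlmostHermitianStructure M) : Prop :=
  ∀ e ∈ atlas E4 M, ∀ y ∈ e.target, ∀ i j k l : Fin 4,
    riemann (S.metricCoef e) i j k l y =
      ∑ a, ∑ b, S.acsCoef e y a k * S.acsCoef e y b l * riemann (S.metricCoef e) i j a b y

/-- The scalar curvature of `g` vanishes nowhere on `M`. -/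
def ScalarCurvatureNowhereZero (S : AlmostHermitianStructure M) : Prop :=
  ∀ e ∈ atlas E4 M, ∀ y ∈ e.target, scalarCurvature (S.metricCoef e) y ≠ 0

/-- `θ` is the Lee form of the structure: the smooth 1-form with `dω = θ ∧ ω`
(there is exactly one, as wedging 1-forms with `ω` is injective and onto the 3-forms in
dimension 4). -/
def IsLeeForm (S : AlmostHermitianStructure M)
    (θ : ∀ x : M, TangentSpace 𝓘(ℝ, E4) x →L[ℝ] ℝ) : Prop :=
  IsSmoothForm θ ∧ ∀ e ∈ atlas E4 M, ∀ y ∈ e.target, ∀ i j k : Fin 4,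
    extDerivTwo (S.omegaCoef e) i j k y = wedgeOneTwo (formCoef θ e) (S.omegaCoef e) i j k y

/-- The structure is locally conformally almost Kähler: its Lee form `θ` satisfies `dθ = 0`. -/
def IsLocallyConformallyAlmostKahler (S : AlmostHermitianStructure M) : Prop :=
  ∃ θ : ∀ x : M, TangentSpace 𝓘(ℝ, E4) x →L[ℝ] ℝ, S.IsLeeForm θ ∧
    ∀ e ∈ atlas E4 M, ∀ y ∈ e.target, ∀ i j : Fin 4, extDerivOne (formCoef θ e) i j y = 0

/-- The structure is Hermitian (`J` is integrable): the Nijenhuis tensor vanishes. -/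
def IsHermitian (S : AlmostHermitianStructure M) : Prop :=
  ∀ e ∈ atlas E4 M, ∀ y ∈ e.target, ∀ k i j : Fin 4, nijenhuis (S.acsCoef e) k i j y = 0

/-- The structure is almost Kähler: `dω = 0`. -/
def IsAlmostKahler (S : AlmostHermitianStructure M) : Prop :=
  ∀ e ∈ atlas E4 M, ∀ y ∈ e.target, ∀ i j k : Fin 4, extDerivTwo (S.omegaCoef e) i j k y = 0

/-- The structure is Kähler: `J` is integrable and `ω` is symplectic. -/
def IsKahler (S : AlmostHermitianStructure M) : Prop :=
  S.IsHermitian ∧ S.IsAlmostKahler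

end AlmostHermitianStructure

end AlmostHermitian

end

/-!
Write `T_{ij} = tr (J ∇_iJ ∇_jJ)` and `ρ_{ij} = tr (J R_{ij})`, where `R_{ij}` is the curvature
endomorphism, and let `ψ` be the alternation of `g(J (∇_iJ) ·, ·)`. In class `AH₁` every `R_{ij}`
commutes with `J`, so the Ricci identity makes `∇_i∇_jJ` symmetric and the Bianchi identity gives
`dρ = dT = 0`. Alternating the derivatives of `∇J` once more gives `ρ ∧ ∇J = 0`, whence `T` and `ρ`
are proportional. The density `ρ ∧ ω` is nonzero wherever the scalar curvature is, so `M` is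
oriented by `ρ ∧ ω` and `T = q ρ` for a function `q`. Now `dq ∧ ρ = 0`, which forces `dq ∧ ψ = 0`,
and `dψ = -½ T ∧ ω = -½ q ρ ∧ ω`. By Stokes' theorem for `q ψ` the integral of `q² ρ ∧ ω` over `M`
is zero, hence `T = 0`.

Near a point where `∇J ≠ 0`, the vanishing of `T` means `∇J = β ⊗ N` with `N² = -1` and `NJ = -JN`.
There `dβ = 0` by the symmetry of `∇∇J`, and the closed Lee form forces `∇N = -β ⊗ J`. So the
curvature commutes with `N` as well as with `J`, and `ρ = 0`, which is impossible. Hence `J` is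
parallel.
-/

noncomputable section

namespace AlmostHermitian

open scoped Matrix

section PartialDerivatives

variable {f g : E4 → ℝ} {y : E4}

theorem contDiffAt_pderiv (hf : ContDiffAt ℝ ∞ f y) (i : Fin 4) :
    ContDiffAt ℝ ∞ (pderiv i f) y :=
  (hf.fderiv_right (m := ∞) (by simp)).clm_apply contDiffAt_const

theorem pderiv_congr (h : f =ᶠ[nhds y] g) (i : Fin 4) : pderiv i f y = pderiv i g y := by
  rw [pderiv, pderiv, h.fderiv_eq]

theorem pderiv_congr_of_isOpen {U : Set E4} (hU : IsOpen U) (h : ∀ z ∈ U, f z = g z)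
    (hy : y ∈ U) (i : Fin 4) : pderiv i f y = pderiv i g y :=
  pderiv_congr (Filter.eventuallyEq_of_mem (hU.mem_nhds hy) h) i

@[simp] theorem pderiv_const (c : ℝ) (i : Fin 4) (y : E4) : pderiv i (fun _ => c) y = 0 := by
  simp [pderiv]

theorem pderiv_add (hf : DifferentiableAt ℝ f y) (hg : DifferentiableAt ℝ g y) (i : Fin 4) :
    pderiv i (fun z => f z + g z) y = pderiv i f y + pderiv i g y := by
  simp [pderiv, fderiv_fun_add hf hg]

theorem pderiv_sub (hf : DifferentiableAt ℝ f y) (hg : DifferentiableAt ℝ g y) (i : Fin 4) :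
    pderiv i (fun z => f z - g z) y = pderiv i f y - pderiv i g y := by
  simp [pderiv, fderiv_fun_sub hf hg]

theorem pderiv_neg (f : E4 → ℝ) (y : E4) (i : Fin 4) :
    pderiv i (fun z => -f z) y = -pderiv i f y := by
  simp [pderiv, fderiv_fun_neg]

theorem pderiv_mul (hf : DifferentiableAt ℝ f y) (hg : DifferentiableAt ℝ g y) (i : Fin 4) :
    pderiv i (fun z => f z * g z) y = pderiv i f y * g y + f y * pderiv i g y := by
  simp [pderiv, fderiv_fun_mul hf hg, mul_comm, add_comm]

theorem pderiv_sum {ι : Type*} {s : Finset ι} {F : ι → E4 → ℝ}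
    (hF : ∀ a ∈ s, DifferentiableAt ℝ (F a) y) (i : Fin 4) :
    pderiv i (fun z => ∑ a ∈ s, F a z) y = ∑ a ∈ s, pderiv i (F a) y := by
  simp [pderiv, fderiv_fun_sum hF]

theorem pderiv_comm (hf : ContDiffAt ℝ ∞ f y) (i j : Fin 4) :
    pderiv i (pderiv j f) y = pderiv j (pderiv i f) y := by
  have hf' : DifferentiableAt ℝ (fderiv ℝ f) y :=
    (hf.fderiv_right (m := ∞) (by simp)).differentiableAt (by simp)
  have hsymm : IsSymmSndFDerivAt ℝ f y := by
    refine hf.isSymmSndFDerivAt ?_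
    rw [minSmoothness_of_isRCLikeNormedField]
    exact WithTop.coe_le_coe.2 le_top
  have second (i j : Fin 4) : pderiv i (pderiv j f) y =
      fderiv ℝ (fderiv ℝ f) y (EuclideanSpace.single i 1) (EuclideanSpace.single j 1) := by
    unfold pderiv
    simp [fderiv_clm_apply hf' (differentiableAt_const _)]
  rw [second, second, hsymm]

theorem fderiv_eq_sum_pderiv (f : E4 → ℝ) (y v : E4) :
    fderiv ℝ f y v = ∑ a, v a * pderiv a f y := by
  have hv : v = ∑ a, v a • (EuclideanSpace.single a (1 : ℝ) : E4) := by
    simpa using ((EuclideanSpace.basisFun (Fin 4) ℝ).sum_repr v).symm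
  conv_lhs => rw [hv]
  simp only [map_sum, map_smul, smul_eq_mul, pderiv]

theorem pderiv_apply {φ : E4 → E4} (hφ : DifferentiableAt ℝ φ y) (i a : Fin 4) :
    pderiv i (fun z => φ z a) y = fderiv ℝ φ y (EuclideanSpace.single i 1) a := by
  have hproj : (fun z => φ z a) = fun z => (EuclideanSpace.proj a : E4 →L[ℝ] ℝ) (φ z) := rfl
  rw [pderiv, hproj, fderiv_fun_comp y (ContinuousLinearMap.differentiableAt _) hφ,
    ContinuousLinearMap.fderiv]
  rfl

theorem pderiv_comp {φ : E4 → E4} (hf : DifferentiableAt ℝ f (φ y))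
    (hφ : DifferentiableAt ℝ φ y) (i : Fin 4) :
    pderiv i (fun z => f (φ z)) y = ∑ a, pderiv i (fun z => φ z a) y * pderiv a f (φ y) := by
  simp only [pderiv_apply hφ]
  rw [← fderiv_eq_sum_pderiv, pderiv, fderiv_fun_comp y hf hφ]
  rfl

end PartialDerivatives

/-- A matrix-valued function is smooth at the points of `U`. Smoothness is imposed on the entries,
as no norm on matrices is distinguished. -/
def SmoothMat {E m n : Type*} [NormedAddCommGroup E] [NormedSpace ℝ E] (U : Set E)
    (M : E → Matrix m n ℝ) : Prop :=
  ∀ a b, ∀ y ∈ U, ContDiffAt ℝ ∞ (fun z => M z a b) y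

namespace SmoothMat

variable {E l m n : Type*} [NormedAddCommGroup E] [NormedSpace ℝ E] {U : Set E} {y : E}

theorem differentiableAt {M : E → Matrix m n ℝ} (hM : SmoothMat U M) (hy : y ∈ U) (a : m) (b : n) :
    DifferentiableAt ℝ (fun z => M z a b) y :=
  (hM a b y hy).differentiableAt (by simp)

theorem mono {M : E → Matrix m n ℝ} (hM : SmoothMat U M) {V : Set E} (h : V ⊆ U) : SmoothMat V M :=
  fun a b y hy => hM a b y (h hy)

theorem congr {M N : E → Matrix m n ℝ} (hU : IsOpen U) (hM : SmoothMat U M)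
    (h : ∀ z ∈ U, N z = M z) : SmoothMat U N := fun a b y hy =>
  (hM a b y hy).congr_of_eventuallyEq <|
    Filter.eventuallyEq_of_mem (hU.mem_nhds hy) fun z hz => by rw [h z hz]

theorem add {M N : E → Matrix m n ℝ} (hM : SmoothMat U M) (hN : SmoothMat U N) :
    SmoothMat U (fun z => M z + N z) :=
  fun a b y hy => (hM a b y hy).add (hN a b y hy)

theorem sub {M N : E → Matrix m n ℝ} (hM : SmoothMat U M) (hN : SmoothMat U N) :
    SmoothMat U (fun z => M z - N z) :=
  fun a b y hy => (hM a b y hy).sub (hN a b y hy)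

theorem mul [Fintype m] {M : E → Matrix l m ℝ} {N : E → Matrix m n ℝ} (hM : SmoothMat U M)
    (hN : SmoothMat U N) : SmoothMat U (fun z => M z * N z) := by
  intro a b y hy
  simp only [Matrix.mul_apply]
  exact ContDiffAt.sum fun c _ => (hM a c y hy).mul (hN c b y hy)

theorem transpose {M : E → Matrix m n ℝ} (hM : SmoothMat U M) : SmoothMat U (fun z => (M z)ᵀ) :=
  fun a b y hy => hM b a y hy

theorem smul {f : E → ℝ} {M : E → Matrix m n ℝ} (hf : ∀ y ∈ U, ContDiffAt ℝ ∞ f y)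
    (hM : SmoothMat U M) : SmoothMat U (fun z => f z • M z) :=
  fun a b y hy => (hf y hy).mul (hM a b y hy)

theorem sum {ι : Type*} {s : Finset ι} {M : ι → E → Matrix m n ℝ}
    (hM : ∀ a ∈ s, SmoothMat U (M a)) : SmoothMat U (fun z => ∑ a ∈ s, M a z) := by
  intro a b y hy
  simp only [Matrix.sum_apply]
  exact ContDiffAt.sum fun c hc => hM c hc a b y hy

theorem trace [Fintype n] {M : E → Matrix n n ℝ} (hM : SmoothMat U M) (hy : y ∈ U) :
    ContDiffAt ℝ ∞ (fun z => (M z).trace) y :=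
  ContDiffAt.sum fun c _ => hM c c y hy

theorem det [Fintype n] [DecidableEq n] {M : E → Matrix n n ℝ} (hM : SmoothMat U M) (hy : y ∈ U) :
    ContDiffAt ℝ ∞ (fun z => (M z).det) y := by
  simp only [Matrix.det_apply']
  exact ContDiffAt.sum fun σ _ => contDiffAt_const.mul (contDiffAt_prod fun c _ => hM _ _ y hy)

theorem adjugate [Fintype n] [DecidableEq n] {M : E → Matrix n n ℝ} (hM : SmoothMat U M) :
    SmoothMat U (fun z => (M z).adjugate) := by
  intro a b y hy
  simp only [Matrix.adjugate_apply]
  refine SmoothMat.det (fun c d z hz => ?_) hy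
  by_cases hc : c = b
  · simp only [hc, Matrix.updateRow_self]
    exact contDiffAt_const
  · simp only [Matrix.updateRow_ne hc]
    exact hM c d z hz

theorem inv [Fintype n] [DecidableEq n] {M : E → Matrix n n ℝ} (hM : SmoothMat U M)
    (h : ∀ y ∈ U, (M y).det ≠ 0) : SmoothMat U (fun z => (M z)⁻¹) := by
  simp only [Matrix.inv_def, Ring.inverse_eq_inv]
  exact .smul (fun y hy => (hM.det hy).inv (h y hy)) hM.adjugate

end SmoothMat

/-- The entrywise partial derivative `∂_i M` of a matrix-valued function. -/
def pderivMat {m n : Type*} (i : Fin 4) (M : E4 → Matrix m n ℝ) (y : E4) : Matrix m n ℝ :=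
  Matrix.of fun a b => pderiv i (fun z => M z a b) y

section PderivMat

variable {l m n : Type*} {U : Set E4} {y : E4}

theorem SmoothMat.pderivMat {M : E4 → Matrix m n ℝ} (hM : SmoothMat U M) (i : Fin 4) :
    SmoothMat U (pderivMat i M) :=
  fun a b y hy => contDiffAt_pderiv (hM a b y hy) i

theorem pderivMat_congr_of_isOpen {M N : E4 → Matrix m n ℝ} (hU : IsOpen U)
    (h : ∀ z ∈ U, M z = N z) (hy : y ∈ U) (i : Fin 4) : pderivMat i M y = pderivMat i N y := by
  ext a b
  exact pderiv_congr_of_isOpen hU (fun z hz => by rw [h z hz]) hy i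

@[simp] theorem pderivMat_const (c : Matrix m n ℝ) (i : Fin 4) (y : E4) :
    pderivMat i (fun _ => c) y = 0 := by
  ext a b
  simp [pderivMat]

theorem pderivMat_add {M N : E4 → Matrix m n ℝ} (hM : SmoothMat U M) (hN : SmoothMat U N)
    (hy : y ∈ U) (i : Fin 4) :
    pderivMat i (fun z => M z + N z) y = pderivMat i M y + pderivMat i N y := by
  ext a b
  exact pderiv_add (hM.differentiableAt hy a b) (hN.differentiableAt hy a b) i

theorem pderivMat_sub {M N : E4 → Matrix m n ℝ} (hM : SmoothMat U M) (hN : SmoothMat U N)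
    (hy : y ∈ U) (i : Fin 4) :
    pderivMat i (fun z => M z - N z) y = pderivMat i M y - pderivMat i N y := by
  ext a b
  exact pderiv_sub (hM.differentiableAt hy a b) (hN.differentiableAt hy a b) i

theorem pderivMat_neg (M : E4 → Matrix m n ℝ) (y : E4) (i : Fin 4) :
    pderivMat i (fun z => -M z) y = -pderivMat i M y := by
  ext a b
  exact pderiv_neg _ y i

theorem pderivMat_mul [Fintype m] {M : E4 → Matrix l m ℝ} {N : E4 → Matrix m n ℝ}
    (hM : SmoothMat U M) (hN : SmoothMat U N) (hy : y ∈ U) (i : Fin 4) :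
    pderivMat i (fun z => M z * N z) y = pderivMat i M y * N y + M y * pderivMat i N y := by
  ext a b
  have hMN (c) := pderiv_mul (hM.differentiableAt hy a c) (hN.differentiableAt hy c b) i
  simp only [pderivMat, Matrix.of_apply, Matrix.add_apply, Matrix.mul_apply,
    ← Finset.sum_add_distrib, ← hMN]
  exact pderiv_sum
    (fun c _ => (hM.differentiableAt hy a c).mul (hN.differentiableAt hy c b)) i

theorem pderivMat_smul {f : E4 → ℝ} {N : E4 → Matrix m n ℝ} (hf : DifferentiableAt ℝ f y)
    (hN : SmoothMat U N) (hy : y ∈ U) (i : Fin 4) :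
    pderivMat i (fun z => f z • N z) y = pderiv i f y • N y + f y • pderivMat i N y := by
  ext a b
  exact pderiv_mul hf (hN.differentiableAt hy a b) i

theorem pderivMat_sum {ι : Type*} {s : Finset ι} {M : ι → E4 → Matrix m n ℝ}
    (hM : ∀ a ∈ s, SmoothMat U (M a)) (hy : y ∈ U) (i : Fin 4) :
    pderivMat i (fun z => ∑ a ∈ s, M a z) y = ∑ a ∈ s, pderivMat i (M a) y := by
  ext a b
  simp only [pderivMat, Matrix.of_apply, Matrix.sum_apply]
  exact pderiv_sum (fun c hc => (hM c hc).differentiableAt hy a b) i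

theorem pderivMat_transpose (M : E4 → Matrix m n ℝ) (y : E4) (i : Fin 4) :
    pderivMat i (fun z => (M z)ᵀ) y = (pderivMat i M y)ᵀ := rfl

theorem pderiv_trace [Fintype n] {M : E4 → Matrix n n ℝ} (hM : SmoothMat U M) (hy : y ∈ U)
    (i : Fin 4) : pderiv i (fun z => (M z).trace) y = (pderivMat i M y).trace :=
  pderiv_sum (fun c _ => hM.differentiableAt hy c c) i

theorem pderivMat_comm {M : E4 → Matrix m n ℝ} (hM : SmoothMat U M) (hy : y ∈ U)
    (i j : Fin 4) : pderivMat i (pderivMat j M) y = pderivMat j (pderivMat i M) y := by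
  ext a b
  exact pderiv_comm (hM a b y hy) i j

end PderivMat

section Connection

variable {n : Type*} [Fintype n] {U : Set E4} {y : E4} {Γ : Fin 4 → E4 → Matrix n n ℝ}
  {M N : E4 → Matrix n n ℝ}

/-- The covariant derivative `∇_i M` of an endomorphism field, for the connection `∂_i + Γ_i` on a
trivial bundle. -/
def covD (Γ : Fin 4 → E4 → Matrix n n ℝ) (i : Fin 4) (M : E4 → Matrix n n ℝ) (y : E4) :
    Matrix n n ℝ :=
  pderivMat i M y + Γ i y * M y - M y * Γ i y

/-- The curvature endomorphism `R(∂_i, ∂_j)` of the connection `∂_i + Γ_i` on a trivial bundle. -/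
def curvMat (Γ : Fin 4 → E4 → Matrix n n ℝ) (i j : Fin 4) (y : E4) : Matrix n n ℝ :=
  pderivMat i (Γ j) y - pderivMat j (Γ i) y + (Γ i y * Γ j y - Γ j y * Γ i y)

theorem SmoothMat.covD (hΓ : ∀ i, SmoothMat U (Γ i)) (hM : SmoothMat U M) (i : Fin 4) :
    SmoothMat U (covD Γ i M) :=
  ((hM.pderivMat i).add ((hΓ i).mul hM)).sub (hM.mul (hΓ i))

theorem SmoothMat.curvMat (hΓ : ∀ i, SmoothMat U (Γ i)) (i j : Fin 4) :
    SmoothMat U (curvMat Γ i j) :=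
  (((hΓ j).pderivMat i).sub ((hΓ i).pderivMat j)).add
    (((hΓ i).mul (hΓ j)).sub ((hΓ j).mul (hΓ i)))

theorem covD_congr (hU : IsOpen U) (h : ∀ z ∈ U, M z = N z) (hy : y ∈ U) (i : Fin 4) :
    covD Γ i M y = covD Γ i N y := by
  rw [covD, covD, pderivMat_congr_of_isOpen hU h hy, h y hy]

theorem covD_neg (M : E4 → Matrix n n ℝ) (y : E4) (i : Fin 4) :
    covD Γ i (fun z => -M z) y = -covD Γ i M y := by
  rw [covD, covD, pderivMat_neg, mul_neg, neg_mul]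
  abel

theorem covD_mul (hM : SmoothMat U M) (hN : SmoothMat U N) (hy : y ∈ U) (i : Fin 4) :
    covD Γ i (fun z => M z * N z) y = covD Γ i M y * N y + M y * covD Γ i N y := by
  rw [covD, covD, covD, pderivMat_mul hM hN hy]
  noncomm_ring

theorem covD_smul {f : E4 → ℝ} (hf : DifferentiableAt ℝ f y) (hN : SmoothMat U N) (hy : y ∈ U)
    (i : Fin 4) :
    covD Γ i (fun z => f z • N z) y = pderiv i f y • N y + f y • covD Γ i N y := by
  rw [covD, covD, pderivMat_smul hf hN hy]
  simp only [Matrix.mul_smul, Matrix.smul_mul, smul_add, smul_sub]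
  abel

theorem pderiv_trace_eq_trace_covD (hM : SmoothMat U M) (hy : y ∈ U) (i : Fin 4) :
    pderiv i (fun z => (M z).trace) y = (covD Γ i M y).trace := by
  rw [pderiv_trace hM hy, covD, Matrix.trace_sub, Matrix.trace_add, Matrix.trace_mul_comm (M y)]
  ring

theorem curvMat_antisymm (i j : Fin 4) (y : E4) : curvMat Γ i j y = -curvMat Γ j i y := by
  rw [curvMat, curvMat]
  abel

theorem ricci_identity (hΓ : ∀ i, SmoothMat U (Γ i)) (hM : SmoothMat U M) (hy : y ∈ U)
    (i j : Fin 4) :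
    covD Γ i (covD Γ j M) y - covD Γ j (covD Γ i M) y =
      curvMat Γ i j y * M y - M y * curvMat Γ i j y := by
  have covD_covD (i j) : covD Γ i (covD Γ j M) y =
      pderivMat i (pderivMat j M) y + (pderivMat i (Γ j) y * M y + Γ j y * pderivMat i M y)
        - (pderivMat i M y * Γ j y + M y * pderivMat i (Γ j) y)
        + Γ i y * covD Γ j M y - covD Γ j M y * Γ i y := by
    rw [← pderivMat_mul hM (hΓ j) hy, ← pderivMat_mul (hΓ j) hM hy,
      ← pderivMat_add (hM.pderivMat j) ((hΓ j).mul hM) hy,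
      ← pderivMat_sub ((hM.pderivMat j).add ((hΓ j).mul hM)) (hM.mul (hΓ j)) hy]
    rfl
  rw [covD_covD, covD_covD, pderivMat_comm hM hy i j]
  simp only [covD, curvMat]
  noncomm_ring

theorem second_bianchi (hΓ : ∀ i, SmoothMat U (Γ i)) (hy : y ∈ U) (i j k : Fin 4) :
    covD Γ i (curvMat Γ j k) y + covD Γ j (curvMat Γ k i) y + covD Γ k (curvMat Γ i j) y = 0 := by
  have pderivMat_curvMat (i j k) : pderivMat i (curvMat Γ j k) y =
      pderivMat i (pderivMat j (Γ k)) y - pderivMat i (pderivMat k (Γ j)) y +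
      (pderivMat i (Γ j) y * Γ k y + Γ j y * pderivMat i (Γ k) y -
        (pderivMat i (Γ k) y * Γ j y + Γ k y * pderivMat i (Γ j) y)) := by
    have hj := hΓ j
    have hk := hΓ k
    rw [← pderivMat_mul hj hk hy, ← pderivMat_mul hk hj hy,
      ← pderivMat_sub (hj.mul hk) (hk.mul hj) hy,
      ← pderivMat_sub (hk.pderivMat j) (hj.pderivMat k) hy,
      ← pderivMat_add ((hk.pderivMat j).sub (hj.pderivMat k))
        ((hj.mul hk).sub (hk.mul hj)) hy]
    rfl
  simp only [covD, pderivMat_curvMat]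
  rw [pderivMat_comm (hΓ k) hy j i, pderivMat_comm (hΓ j) hy k i, pderivMat_comm (hΓ i) hy k j]
  simp only [curvMat]
  noncomm_ring

theorem first_bianchi {Γ : Fin 4 → E4 → Matrix (Fin 4) (Fin 4) ℝ} (hU : IsOpen U)
    (hsymm : ∀ z ∈ U, ∀ i j k, Γ i z k j = Γ j z k i) (hy : y ∈ U) (i j k l : Fin 4) :
    curvMat Γ i j y l k + curvMat Γ j k y l i + curvMat Γ k i y l j = 0 := by
  have pderiv_symm (a i j k) : pderiv a (fun z => Γ i z k j) y = pderiv a (fun z => Γ j z k i) y :=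
    pderiv_congr_of_isOpen hU (fun z hz => hsymm z hz i j k) hy a
  have mul_symm (i j k) : (Γ i y * Γ j y) l k = (Γ i y * Γ k y) l j := by
    simp only [Matrix.mul_apply]
    exact Finset.sum_congr rfl fun m _ => by rw [hsymm y hy j k m]
  simp only [curvMat, Matrix.add_apply, Matrix.sub_apply, pderivMat, Matrix.of_apply]
  rw [mul_symm i j k, mul_symm j i k, mul_symm k i j, pderiv_symm i j k l, pderiv_symm j i k l,
    pderiv_symm k i j l]
  ring

theorem curvMat_skew {G : E4 → Matrix n n ℝ} (hU : IsOpen U) (hΓ : ∀ i, SmoothMat U (Γ i))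
    (hG : SmoothMat U G)
    (hmetric : ∀ z ∈ U, ∀ i, pderivMat i G z = (Γ i z)ᵀ * G z + G z * Γ i z) (hy : y ∈ U)
    (i j : Fin 4) : (curvMat Γ i j y)ᵀ * G y + G y * curvMat Γ i j y = 0 := by
  have second (i j) : pderivMat i (pderivMat j G) y =
      ((pderivMat i (Γ j) y)ᵀ * G y + (Γ j y)ᵀ * pderivMat i G y) +
      (pderivMat i G y * Γ j y + G y * pderivMat i (Γ j) y) := by
    rw [pderivMat_congr_of_isOpen hU (fun z hz => hmetric z hz j) hy i,
      pderivMat_add ((hΓ j).transpose.mul hG) (hG.mul (hΓ j)) hy,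
      pderivMat_mul (hΓ j).transpose hG hy, pderivMat_mul hG (hΓ j) hy, pderivMat_transpose]
  have hcomm := pderivMat_comm hG hy i j
  rw [second, second, hmetric y hy, hmetric y hy, ← sub_eq_zero] at hcomm
  rw [← hcomm, curvMat]
  simp only [Matrix.transpose_add, Matrix.transpose_sub, Matrix.transpose_mul]
  noncomm_ring

end Connection

section Gauge

variable {m n : Type*} [Fintype m] [Fintype n] {V : Set E4} {z : E4} {P : E4 → Matrix m n ℝ}
  {Γ : Fin 4 → E4 → Matrix m m ℝ} {Γ' : Fin 4 → E4 → Matrix n n ℝ}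

theorem covD_gauge (hV : IsOpen V) (hP : SmoothMat V P)
    (hgauge : ∀ z ∈ V, ∀ i, P z * Γ' i z = pderivMat i P z + Γ i z * P z)
    {M : E4 → Matrix m m ℝ} {M' : E4 → Matrix n n ℝ} (hM : SmoothMat V M) (hM' : SmoothMat V M')
    (hPM : ∀ z ∈ V, P z * M' z = M z * P z) (hz : z ∈ V) (i : Fin 4) :
    P z * covD Γ' i M' z = covD Γ i M z * P z := by
  have hderiv := pderivMat_congr_of_isOpen hV hPM hz i
  rw [pderivMat_mul hP hM' hz, pderivMat_mul hM hP hz, ← eq_sub_iff_add_eq'] at hderiv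
  calc P z * covD Γ' i M' z
      = P z * pderivMat i M' z + P z * Γ' i z * M' z - P z * M' z * Γ' i z := by
        simp only [covD, Matrix.mul_add, Matrix.mul_sub, Matrix.mul_assoc]
    _ = pderivMat i M z * P z + M z * pderivMat i P z - pderivMat i P z * M' z
        + (pderivMat i P z * M' z + Γ i z * (M z * P z))
        - M z * (pderivMat i P z + Γ i z * P z) := by
        rw [hderiv, hgauge z hz, hPM z hz, Matrix.add_mul, Matrix.mul_assoc (Γ i z), hPM z hz,
          Matrix.mul_assoc (M z), hgauge z hz]
    _ = covD Γ i M z * P z := by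
        simp only [covD, Matrix.mul_add, Matrix.add_mul, Matrix.sub_mul, Matrix.mul_assoc]
        abel

theorem curvMat_gauge (hV : IsOpen V) (hP : SmoothMat V P) (hΓ : ∀ i, SmoothMat V (Γ i))
    (hΓ' : ∀ i, SmoothMat V (Γ' i))
    (hgauge : ∀ z ∈ V, ∀ i, P z * Γ' i z = pderivMat i P z + Γ i z * P z) (hz : z ∈ V)
    (i j : Fin 4) : P z * curvMat Γ' i j z = curvMat Γ i j z * P z := by
  have mul_pderivMat (i j) : P z * pderivMat i (Γ' j) z = pderivMat i (pderivMat j P) z +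
      (pderivMat i (Γ j) z * P z + Γ j z * pderivMat i P z) - pderivMat i P z * Γ' j z := by
    have hderiv := pderivMat_congr_of_isOpen hV (fun w hw => hgauge w hw j) hz i
    rwa [pderivMat_mul hP (hΓ' j) hz, pderivMat_add (hP.pderivMat j) ((hΓ j).mul hP) hz,
      pderivMat_mul (hΓ j) hP hz, ← eq_sub_iff_add_eq'] at hderiv
  have mul_mul (i j) : P z * (Γ' i z * Γ' j z) =
      pderivMat i P z * Γ' j z + (Γ i z * pderivMat j P z + Γ i z * (Γ j z * P z)) := by
    rw [← Matrix.mul_assoc, hgauge z hz, Matrix.add_mul, Matrix.mul_assoc (Γ i z), hgauge z hz,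
      Matrix.mul_add]
  rw [curvMat, Matrix.mul_add, Matrix.mul_sub, Matrix.mul_sub, mul_pderivMat, mul_pderivMat,
    mul_mul, mul_mul, pderivMat_comm hP hz j i, curvMat]
  simp only [Matrix.add_mul, Matrix.sub_mul, Matrix.mul_assoc]
  abel

end Gauge

/-- The Jacobian matrix `∂_i φ^a`. -/
def jacMat (φ : E4 → E4) (z : E4) : Matrix (Fin 4) (Fin 4) ℝ :=
  Matrix.of fun a i => pderiv i (fun w => φ w a) z

/-- The connection matrices of the pullback of the connection `∂_a + Γ_a` under `φ`. -/
def pullbackConnection {n : Type*} (φ : E4 → E4) (Γ : Fin 4 → E4 → Matrix n n ℝ) (i : Fin 4)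
    (z : E4) : Matrix n n ℝ :=
  ∑ a, jacMat φ z a i • Γ a (φ z)

section Pullback

variable {U V : Set E4} {φ : E4 → E4} {z : E4}

theorem contDiffAt_coord (h : ContDiffAt ℝ ∞ φ z) (a : Fin 4) :
    ContDiffAt ℝ ∞ (fun w => φ w a) z :=
  (EuclideanSpace.proj a : E4 →L[ℝ] ℝ).contDiff.contDiffAt.comp z h

theorem smoothMat_jacMat (hφ : ∀ z ∈ V, ContDiffAt ℝ ∞ φ z) : SmoothMat V (jacMat φ) :=
  fun a i z hz => contDiffAt_pderiv (contDiffAt_coord (hφ z hz) a) i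

theorem pderivMat_jacMat_symm (hφ : ContDiffAt ℝ ∞ φ z) (i j k : Fin 4) :
    pderivMat i (jacMat φ) z k j = pderivMat j (jacMat φ) z k i :=
  pderiv_comm (contDiffAt_coord hφ k) i j

theorem SmoothMat.comp {m n : Type*} {M : E4 → Matrix m n ℝ} (hM : SmoothMat U M)
    (hφ : ∀ z ∈ V, ContDiffAt ℝ ∞ φ z) (hVU : Set.MapsTo φ V U) :
    SmoothMat V fun z => M (φ z) :=
  fun a b z hz => (hM a b (φ z) (hVU hz)).comp z (hφ z hz)

theorem pderivMat_comp {m n : Type*} {M : E4 → Matrix m n ℝ} (hM : SmoothMat U M)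
    (hφ : DifferentiableAt ℝ φ z) (hz : φ z ∈ U) (i : Fin 4) :
    pderivMat i (fun w => M (φ w)) z = ∑ a, jacMat φ z a i • pderivMat a M (φ z) := by
  ext b c
  rw [Matrix.sum_apply]
  exact pderiv_comp (hM.differentiableAt hz b c) hφ i

variable {n : Type*} {Γ : Fin 4 → E4 → Matrix n n ℝ}

theorem SmoothMat.pullbackConnection (hΓ : ∀ i, SmoothMat U (Γ i))
    (hφ : ∀ z ∈ V, ContDiffAt ℝ ∞ φ z) (hVU : Set.MapsTo φ V U) (i : Fin 4) :
    SmoothMat V (pullbackConnection φ Γ i) :=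
  .sum fun a _ => .smul (fun z hz => smoothMat_jacMat hφ a i z hz) ((hΓ a).comp hφ hVU)

theorem covD_pullbackConnection [Fintype n] {M : E4 → Matrix n n ℝ} (hM : SmoothMat U M)
    (hφ : DifferentiableAt ℝ φ z) (hz : φ z ∈ U) (i : Fin 4) :
    covD (pullbackConnection φ Γ) i (fun w => M (φ w)) z =
      ∑ a, jacMat φ z a i • covD Γ a M (φ z) := by
  simp only [covD, pderivMat_comp hM hφ hz, pullbackConnection, Finset.sum_mul, Finset.mul_sum,
    Matrix.smul_mul, Matrix.mul_smul, ← Finset.sum_add_distrib, ← Finset.sum_sub_distrib,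
    ← smul_add, ← smul_sub]

theorem pderivMat_pullbackConnection (hΓ : ∀ i, SmoothMat U (Γ i))
    (hφ : ∀ z ∈ V, ContDiffAt ℝ ∞ φ z) (hVU : Set.MapsTo φ V U) (hz : z ∈ V) (i j : Fin 4) :
    pderivMat i (pullbackConnection φ Γ j) z = ∑ b, pderivMat i (jacMat φ) z b j • Γ b (φ z) +
      ∑ a, ∑ b, (jacMat φ z a i * jacMat φ z b j) • pderivMat a (Γ b) (φ z) := by
  have hφz := (hφ z hz).differentiableAt (by simp)
  have hjac := smoothMat_jacMat hφ
  have hsum := pderivMat_sum (s := Finset.univ) (fun b _ => SmoothMat.smul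
    (fun z hz => hjac b j z hz) ((hΓ b).comp hφ hVU)) hz i
  rw [Finset.sum_comm, ← Finset.sum_add_distrib]
  refine hsum.trans (Finset.sum_congr rfl fun b _ => ?_)
  rw [pderivMat_smul (hjac.differentiableAt hz b j) ((hΓ b).comp hφ hVU) hz,
    pderivMat_comp (hΓ b) hφz (hVU hz), Finset.smul_sum]
  congr 1
  exact Finset.sum_congr rfl fun a _ => by rw [smul_smul, mul_comm]

theorem curvMat_pullbackConnection [Fintype n] (hΓ : ∀ i, SmoothMat U (Γ i))
    (hφ : ∀ z ∈ V, ContDiffAt ℝ ∞ φ z) (hVU : Set.MapsTo φ V U) (hz : z ∈ V) (i j : Fin 4) :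
    curvMat (pullbackConnection φ Γ) i j z =
      ∑ a, ∑ b, (jacMat φ z a i * jacMat φ z b j) • curvMat Γ a b (φ z) := by
  have swap (F : Fin 4 → Fin 4 → Matrix n n ℝ) (i j : Fin 4) :
      ∑ a, ∑ b, (jacMat φ z a i * jacMat φ z b j) • F b a =
        ∑ a, ∑ b, (jacMat φ z a j * jacMat φ z b i) • F a b := by
    rw [Finset.sum_comm]
    exact Finset.sum_congr rfl fun _ _ => Finset.sum_congr rfl fun _ _ => by rw [mul_comm]
  have mul (i j) : pullbackConnection φ Γ i z * pullbackConnection φ Γ j z =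
      ∑ a, ∑ b, (jacMat φ z a i * jacMat φ z b j) • (Γ a (φ z) * Γ b (φ z)) := by
    simp only [pullbackConnection, Finset.sum_mul, Finset.mul_sum, Matrix.smul_mul,
      Matrix.mul_smul, smul_smul]
    rw [Finset.sum_comm]
    exact Finset.sum_congr rfl fun _ _ => Finset.sum_congr rfl fun _ _ => by rw [mul_comm]
  have hessian : ∑ b, pderivMat i (jacMat φ) z b j • Γ b (φ z) =
      ∑ b, pderivMat j (jacMat φ) z b i • Γ b (φ z) :=
    Finset.sum_congr rfl fun b _ => by rw [pderivMat_jacMat_symm (hφ z hz) i j b]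
  simp only [curvMat, smul_add, smul_sub, Finset.sum_add_distrib, Finset.sum_sub_distrib]
  rw [pderivMat_pullbackConnection hΓ hφ hVU hz, pderivMat_pullbackConnection hΓ hφ hVU hz, hessian,
    mul, mul, swap (fun a b => pderivMat a (Γ b) (φ z)),
    swap (fun a b => Γ a (φ z) * Γ b (φ z))]
  abel

end Pullback

/-- The matrices `(Γ_i)^k_j` of the Levi-Civita connection of the metric `G` in the coordinate
frame. -/
def leviCivita (G : E4 → Matrix (Fin 4) (Fin 4) ℝ) (i : Fin 4) (y : E4) :
    Matrix (Fin 4) (Fin 4) ℝ :=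
  Matrix.of fun k j => christoffel G k i j y

theorem curvature_eq_curvMat (G : E4 → Matrix (Fin 4) (Fin 4) ℝ) (l i j k : Fin 4) (y : E4) :
    curvature G l i j k y = curvMat (leviCivita G) i j y l k := by
  simp [curvMat, curvature, pderivMat, leviCivita, Matrix.mul_apply, Finset.sum_sub_distrib]

/-- `G` is a matrix of components of a smooth, possibly indefinite, metric on the open set `U`. -/
structure IsMetricOn (U : Set E4) (G : E4 → Matrix (Fin 4) (Fin 4) ℝ) : Prop where
  isOpen : IsOpen U
  smooth : SmoothMat U G
  symm : ∀ y ∈ U, (G y).IsSymm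
  det_ne : ∀ y ∈ U, (G y).det ≠ 0

namespace IsMetricOn

variable {U : Set E4} {G : E4 → Matrix (Fin 4) (Fin 4) ℝ} {y : E4}

theorem smooth_leviCivita (h : IsMetricOn U G) (i : Fin 4) : SmoothMat U (leviCivita G i) := by
  intro k j y hy
  have hG (a b c) := contDiffAt_pderiv (h.smooth a b y hy) c
  exact contDiffAt_const.mul (ContDiffAt.sum fun l _ =>
    (h.smooth.inv h.det_ne k l y hy).mul (((hG j l i).add (hG i l j)).sub (hG i j l)))

theorem pderiv_symm (h : IsMetricOn U G) (hy : y ∈ U) (i a b : Fin 4) :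
    pderiv i (fun z => G z a b) y = pderiv i (fun z => G z b a) y :=
  pderiv_congr_of_isOpen h.isOpen (fun z hz => (h.symm z hz).apply b a) hy i

theorem leviCivita_symm (h : IsMetricOn U G) (hy : y ∈ U) (i j k : Fin 4) :
    leviCivita G i y k j = leviCivita G j y k i := by
  simp only [leviCivita, Matrix.of_apply, christoffel]
  congr 1
  refine Finset.sum_congr rfl fun l _ => ?_
  rw [h.pderiv_symm hy l i j]
  ring

theorem mul_leviCivita_apply (h : IsMetricOn U G) (hy : y ∈ U) (i j k : Fin 4) :
    (G y * leviCivita G i y) k j = (1 / 2 : ℝ) * (pderiv i (fun z => G z j k) y +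
      pderiv j (fun z => G z i k) y - pderiv k (fun z => G z i j) y) := by
  set v : Fin 4 → ℝ := fun l => (1 / 2 : ℝ) * (pderiv i (fun z => G z j l) y +
      pderiv j (fun z => G z i l) y - pderiv l (fun z => G z i j) y) with hv
  have hcol : (leviCivita G i y).col j = (G y)⁻¹ *ᵥ v := by
    ext m
    simp only [Matrix.col_apply, leviCivita, Matrix.of_apply, christoffel, Matrix.mulVec,
      dotProduct, hv, Finset.mul_sum]
    exact Finset.sum_congr rfl fun l _ => by ring
  change (G y *ᵥ (leviCivita G i y).col j) k = v k
  rw [hcol, Matrix.mulVec_mulVec, Matrix.mul_nonsing_inv _ (h.det_ne y hy).isUnit,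
    Matrix.one_mulVec]

theorem transpose_mul_apply (h : IsMetricOn U G) (hy : y ∈ U) (C : Matrix (Fin 4) (Fin 4) ℝ)
    (j k : Fin 4) : (Cᵀ * G y) j k = (G y * C) k j := by
  rw [← Matrix.transpose_apply (G y * C), Matrix.transpose_mul, (h.symm y hy).eq]

theorem pderivMat_eq (h : IsMetricOn U G) (hy : y ∈ U) (i : Fin 4) :
    pderivMat i G y = (leviCivita G i y)ᵀ * G y + G y * leviCivita G i y := by
  ext j k
  rw [Matrix.add_apply, h.transpose_mul_apply hy, h.mul_leviCivita_apply hy,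
    h.mul_leviCivita_apply hy, h.pderiv_symm hy i k j]
  simp only [pderivMat, Matrix.of_apply]
  ring

theorem leviCivita_unique (h : IsMetricOn U G) (hy : y ∈ U)
    {C : Fin 4 → Matrix (Fin 4) (Fin 4) ℝ} (hsymm : ∀ i j k, C i k j = C j k i)
    (hmetric : ∀ i, pderivMat i G y = (C i)ᵀ * G y + G y * C i) (i : Fin 4) :
    leviCivita G i y = C i := by
  have lower_symm (i j k) : (G y * C i) k j = (G y * C j) k i := by
    simp only [Matrix.mul_apply, hsymm i j]
  have pderiv_eq (i j k) : pderiv i (fun z => G z j k) y = (G y * C i) k j + (G y * C i) j k := by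
    have := congrFun (congrFun (hmetric i) j) k
    rwa [Matrix.add_apply, h.transpose_mul_apply hy] at this
  have lower_eq : G y * leviCivita G i y = G y * C i := by
    ext k j
    rw [h.mul_leviCivita_apply hy, pderiv_eq, pderiv_eq, pderiv_eq, lower_symm j i k,
      lower_symm k i j, lower_symm k j i]
    ring
  exact ((G y).isUnit_iff_isUnit_det.2 (h.det_ne y hy).isUnit).mul_left_cancel lower_eq

theorem curvMat_skew (h : IsMetricOn U G) (hy : y ∈ U) (i j : Fin 4) :
    (curvMat (leviCivita G) i j y)ᵀ * G y + G y * curvMat (leviCivita G) i j y = 0 :=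
  AlmostHermitian.curvMat_skew h.isOpen h.smooth_leviCivita h.smooth
    (fun _ hz i => h.pderivMat_eq hz i) hy i j

theorem pderivMat_comp_eq {φ : E4 → E4} {z : E4} (h : IsMetricOn U G)
    (hφ : DifferentiableAt ℝ φ z) (hz : φ z ∈ U) (i : Fin 4) :
    pderivMat i (fun w => G (φ w)) z = (pullbackConnection φ (leviCivita G) i z)ᵀ * G (φ z) +
      G (φ z) * pullbackConnection φ (leviCivita G) i z := by
  simp only [pderivMat_comp h.smooth hφ hz, h.pderivMat_eq hz, pullbackConnection,
    Matrix.transpose_sum, Finset.sum_mul, Finset.mul_sum, Matrix.transpose_smul, Matrix.smul_mul,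
    Matrix.mul_smul, ← Finset.sum_add_distrib, ← smul_add]

theorem hessian_add_pullbackConnection_symm {φ : E4 → E4} {z : E4} (h : IsMetricOn U G)
    (hφ : ContDiffAt ℝ ∞ φ z) (hz : φ z ∈ U) (i j k : Fin 4) :
    (pderivMat i (jacMat φ) z + pullbackConnection φ (leviCivita G) i z * jacMat φ z) k j =
      (pderivMat j (jacMat φ) z + pullbackConnection φ (leviCivita G) j z * jacMat φ z) k i := by
  simp only [Matrix.add_apply, pderivMat_jacMat_symm hφ i j, pullbackConnection, Finset.sum_mul,
    Matrix.sum_apply, Matrix.smul_mul, Matrix.smul_apply, Matrix.mul_apply, smul_eq_mul,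
    Finset.mul_sum]
  congr 1
  rw [Finset.sum_comm]
  refine Finset.sum_congr rfl fun a _ => Finset.sum_congr rfl fun b _ => ?_
  rw [h.leviCivita_symm hz b a]
  ring

theorem leviCivita_gauge {V : Set E4} {φ : E4 → E4} {G' : E4 → Matrix (Fin 4) (Fin 4) ℝ}
    (h : IsMetricOn U G) (h' : IsMetricOn V G') (hφ : ∀ z ∈ V, ContDiffAt ℝ ∞ φ z)
    (hVU : Set.MapsTo φ V U) (hG' : ∀ z ∈ V, G' z = (jacMat φ z)ᵀ * G (φ z) * jacMat φ z)
    {z : E4} (hz : z ∈ V) (i : Fin 4) :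
    jacMat φ z * leviCivita G' i z =
      pderivMat i (jacMat φ) z + pullbackConnection φ (leviCivita G) i z * jacMat φ z := by
  set Q : Fin 4 → Matrix (Fin 4) (Fin 4) ℝ := fun i =>
    pderivMat i (jacMat φ) z + pullbackConnection φ (leviCivita G) i z * jacMat φ z with hQ
  have hdet : IsUnit (jacMat φ z).det := by
    refine isUnit_iff_ne_zero.2 fun h0 => h'.det_ne z hz ?_
    rw [hG' z hz, Matrix.det_mul, h0, mul_zero]
  have cancel (i) : jacMat φ z * ((jacMat φ z)⁻¹ * Q i) = Q i :=
    Matrix.mul_nonsing_inv_cancel_left _ _ hdet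
  have hsymm (i j k) : ((jacMat φ z)⁻¹ * Q i) k j = ((jacMat φ z)⁻¹ * Q j) k i := by
    simp only [Matrix.mul_apply, hQ, h.hessian_add_pullbackConnection_symm (hφ z hz) (hVU hz) i j]
  have hmetric (i) : pderivMat i G' z =
      ((jacMat φ z)⁻¹ * Q i)ᵀ * G' z + G' z * ((jacMat φ z)⁻¹ * Q i) := by
    have hG := h.smooth.comp hφ hVU
    have hP := smoothMat_jacMat hφ
    have hleft : ((jacMat φ z)⁻¹ * Q i)ᵀ * ((jacMat φ z)ᵀ * G (φ z) * jacMat φ z) =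
        (Q i)ᵀ * G (φ z) * jacMat φ z := by
      conv_rhs => rw [← cancel i, Matrix.transpose_mul (jacMat φ z)]
      simp only [mul_assoc]
    rw [pderivMat_congr_of_isOpen h'.isOpen hG' hz, pderivMat_mul (hP.transpose.mul hG) hP hz,
      pderivMat_mul hP.transpose hG hz, pderivMat_transpose,
      h.pderivMat_comp_eq ((hφ z hz).differentiableAt (by simp)) (hVU hz), hG' z hz, hleft,
      mul_assoc _ (jacMat φ z) (_ * _), cancel]
    simp only [hQ, Matrix.transpose_add, Matrix.transpose_mul]
    noncomm_ring
  rw [h'.leviCivita_unique hz hsymm hmetric, cancel]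

end IsMetricOn

/-- Components of metrics, of endomorphisms and of 2-forms in a frame of a 4-dimensional space. -/
abbrev Mat : Type := Matrix (Fin 4) (Fin 4) ℝ

section Forms

/-- The wedge product of two 2-forms, as the coefficient of the coordinate volume form. -/
def wedgeTwoTwo (η ζ : Mat) : ℝ :=
  η 0 1 * ζ 2 3 - η 0 2 * ζ 1 3 + η 0 3 * ζ 1 2 + η 1 2 * ζ 0 3 - η 1 3 * ζ 0 2 + η 2 3 * ζ 0 1

/-- The components of the wedge product of a 1-form and a 2-form, at a point. -/
def wedgeOneTwoAt (x : Fin 4 → ℝ) (η : Mat) (i j k : Fin 4) : ℝ :=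
  x i * η j k + x j * η k i + x k * η i j

/-- The wedge product of a 1-form and a 3-form, as the coefficient of the coordinate volume
form. -/
def wedgeOneThree (x : Fin 4 → ℝ) (ψ : Fin 4 → Fin 4 → Fin 4 → ℝ) : ℝ :=
  x 0 * ψ 1 2 3 - x 1 * ψ 0 2 3 + x 2 * ψ 0 1 3 - x 3 * ψ 0 1 2

/-- The components of a 3-form: `ψ` is alternating. -/
structure IsAltThree (ψ : Fin 4 → Fin 4 → Fin 4 → ℝ) : Prop where
  swap : ∀ i j k, ψ j i k = -ψ i j k
  rot : ∀ i j k, ψ j k i = ψ i j k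

/-- The components of the pullback of a 3-form by the linear map with matrix `E`. -/
def pullThree (E : Mat) (ψ : Fin 4 → Fin 4 → Fin 4 → ℝ) (a b c : Fin 4) : ℝ :=
  ∑ i, ∑ j, ∑ k, E i a * E j b * E k c * ψ i j k

theorem det_fin_four (E : Mat) : E.det =
    E 0 0 * (E 1 1 * (E 2 2 * E 3 3 - E 2 3 * E 3 2) - E 1 2 * (E 2 1 * E 3 3 - E 2 3 * E 3 1)
      + E 1 3 * (E 2 1 * E 3 2 - E 2 2 * E 3 1))
    - E 0 1 * (E 1 0 * (E 2 2 * E 3 3 - E 2 3 * E 3 2) - E 1 2 * (E 2 0 * E 3 3 - E 2 3 * E 3 0)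
      + E 1 3 * (E 2 0 * E 3 2 - E 2 2 * E 3 0))
    + E 0 2 * (E 1 0 * (E 2 1 * E 3 3 - E 2 3 * E 3 1) - E 1 1 * (E 2 0 * E 3 3 - E 2 3 * E 3 0)
      + E 1 3 * (E 2 0 * E 3 1 - E 2 1 * E 3 0))
    - E 0 3 * (E 1 0 * (E 2 1 * E 3 2 - E 2 2 * E 3 1) - E 1 1 * (E 2 0 * E 3 2 - E 2 2 * E 3 0)
      + E 1 2 * (E 2 0 * E 3 1 - E 2 1 * E 3 0)) := by
  rw [Matrix.det_succ_row_zero]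
  simp [Fin.sum_univ_four, Matrix.det_fin_three, Fin.succAbove, Matrix.submatrix]
  ring

variable {η ζ : Mat} {ψ : Fin 4 → Fin 4 → Fin 4 → ℝ}

theorem apply_eq_neg_of_skew (h : ηᵀ = -η) (i j : Fin 4) : η i j = -η j i :=
  congrFun (congrFun h j) i

theorem apply_self_of_skew (h : ηᵀ = -η) (i : Fin 4) : η i i = 0 := by
  linarith [apply_eq_neg_of_skew h i i]

theorem mul_apply_of_skew (h : ηᵀ = -η) (A : Mat) (i j : Fin 4) :
    (η * A) i j = -(Aᵀ * η) j i := by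
  rw [← Matrix.transpose_apply (η * A), Matrix.transpose_mul, h, Matrix.mul_neg, Matrix.neg_apply]

theorem transpose_mul_mul_apply_of_skew (E : Mat) (h : ηᵀ = -η) (a b : Fin 4) :
    (Eᵀ * η * E) a b =
      η 0 1 * (E 0 a * E 1 b - E 1 a * E 0 b) + η 0 2 * (E 0 a * E 2 b - E 2 a * E 0 b) +
      η 0 3 * (E 0 a * E 3 b - E 3 a * E 0 b) + η 1 2 * (E 1 a * E 2 b - E 2 a * E 1 b) +
      η 1 3 * (E 1 a * E 3 b - E 3 a * E 1 b) + η 2 3 * (E 2 a * E 3 b - E 3 a * E 2 b) := by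
  have hswap := apply_eq_neg_of_skew h
  simp only [Matrix.mul_apply, Matrix.transpose_apply, Fin.sum_univ_four, apply_self_of_skew h,
    hswap 1 0, hswap 2 0, hswap 3 0, hswap 2 1, hswap 3 1, hswap 3 2]
  ring

theorem wedgeTwoTwo_pullback (E : Mat) (hη : ηᵀ = -η) (hζ : ζᵀ = -ζ) :
    wedgeTwoTwo (Eᵀ * η * E) (Eᵀ * ζ * E) = E.det * wedgeTwoTwo η ζ := by
  rw [det_fin_four]
  simp only [wedgeTwoTwo, transpose_mul_mul_apply_of_skew E hη,
    transpose_mul_mul_apply_of_skew E hζ]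
  generalize η 0 1 = a₁, η 0 2 = a₂, η 0 3 = a₃, η 1 2 = a₄, η 1 3 = a₅, η 2 3 = a₆
  ring

namespace IsAltThree

theorem apply_left_eq (h : IsAltThree ψ) (i j : Fin 4) : ψ i i j = 0 := by
  linarith [h.swap i i j]

theorem apply_right_eq (h : IsAltThree ψ) (i j : Fin 4) : ψ i j j = 0 := by
  rw [← h.rot, h.apply_left_eq]

theorem apply_outer_eq (h : IsAltThree ψ) (i j : Fin 4) : ψ i j i = 0 := by
  rw [← h.rot, h.apply_right_eq]

theorem swap_right (h : IsAltThree ψ) (i j k : Fin 4) : ψ i k j = -ψ i j k := by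
  rw [← h.rot, h.swap, h.rot, h.rot]

end IsAltThree

theorem pullThree_apply (E : Mat) (h : IsAltThree ψ) (a b c : Fin 4) : pullThree E ψ a b c =
    ψ 0 1 2 * (E 0 a * (E 1 b * E 2 c - E 2 b * E 1 c) - E 1 a * (E 0 b * E 2 c - E 2 b * E 0 c)
      + E 2 a * (E 0 b * E 1 c - E 1 b * E 0 c)) +
    ψ 0 1 3 * (E 0 a * (E 1 b * E 3 c - E 3 b * E 1 c) - E 1 a * (E 0 b * E 3 c - E 3 b * E 0 c)
      + E 3 a * (E 0 b * E 1 c - E 1 b * E 0 c)) +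
    ψ 0 2 3 * (E 0 a * (E 2 b * E 3 c - E 3 b * E 2 c) - E 2 a * (E 0 b * E 3 c - E 3 b * E 0 c)
      + E 3 a * (E 0 b * E 2 c - E 2 b * E 0 c)) +
    ψ 1 2 3 * (E 1 a * (E 2 b * E 3 c - E 3 b * E 2 c) - E 2 a * (E 1 b * E 3 c - E 3 b * E 1 c)
      + E 3 a * (E 1 b * E 2 c - E 2 b * E 1 c)) := by
  simp only [pullThree, Fin.sum_univ_four, h.apply_left_eq, h.apply_right_eq, h.apply_outer_eq,
    h.swap 0 1, h.swap 0 2, h.swap 0 3, h.swap 1 2, h.swap 1 3, h.swap 2 3,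
    h.swap_right 0 1 2, h.swap_right 0 1 3, h.swap_right 0 2 3, h.swap_right 1 2 3,
    h.rot 0 1 2, h.rot 0 1 3, h.rot 0 2 3, h.rot 1 2 3]
  ring

theorem wedgeOneThree_pullback (E : Mat) (x : Fin 4 → ℝ) (h : IsAltThree ψ) :
    wedgeOneThree (Eᵀ *ᵥ x) (pullThree E ψ) = E.det * wedgeOneThree x ψ := by
  rw [det_fin_four]
  simp only [wedgeOneThree, pullThree_apply E h, Matrix.mulVec, dotProduct,
    Matrix.transpose_apply, Fin.sum_univ_four]
  generalize ψ 0 1 2 = a₁, ψ 0 1 3 = a₂, ψ 0 2 3 = a₃, ψ 1 2 3 = a₄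
  ring

theorem wedgeOneTwoAt_pullback (E : Mat) (x : Fin 4 → ℝ) (η : Mat) :
    wedgeOneTwoAt (Eᵀ *ᵥ x) (Eᵀ * η * E) = pullThree E (wedgeOneTwoAt x η) := by
  funext a b c
  simp only [wedgeOneTwoAt, pullThree, Matrix.mul_apply, Matrix.mulVec, dotProduct,
    Matrix.transpose_apply, Fin.sum_univ_four]
  ring

theorem isAltThree_wedgeOneTwoAt (x : Fin 4 → ℝ) (h : ηᵀ = -η) :
    IsAltThree (wedgeOneTwoAt x η) where
  swap i j k := by
    simp only [wedgeOneTwoAt]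
    rw [apply_eq_neg_of_skew h i k, apply_eq_neg_of_skew h k j, apply_eq_neg_of_skew h j i]
    ring
  rot i j k := by
    simp only [wedgeOneTwoAt]
    ring

theorem wedgeOneTwoAt_pullback_inj {E F : Mat} (hEF : E * F = 1) {x b : Fin 4 → ℝ} :
    wedgeOneTwoAt (Eᵀ *ᵥ x) (Eᵀ * η * E) = wedgeOneTwoAt (Eᵀ *ᵥ b) (Eᵀ * ζ * E) ↔
      wedgeOneTwoAt x η = wedgeOneTwoAt b ζ := by
  have hvec (v : Fin 4 → ℝ) : Fᵀ *ᵥ Eᵀ *ᵥ v = v := by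
    rw [Matrix.mulVec_mulVec, ← Matrix.transpose_mul, hEF, Matrix.transpose_one,
      Matrix.one_mulVec]
  have hmat (ν : Mat) : Fᵀ * (Eᵀ * ν * E) * F = ν := by
    calc Fᵀ * (Eᵀ * ν * E) * F = (E * F)ᵀ * ν * (E * F) := by
          rw [Matrix.transpose_mul]; noncomm_ring
      _ = ν := by rw [hEF, Matrix.transpose_one, Matrix.one_mul, Matrix.mul_one]
  refine ⟨fun h => ?_, fun h => ?_⟩
  · have hF := congrArg (pullThree F) h
    rwa [← wedgeOneTwoAt_pullback, ← wedgeOneTwoAt_pullback, hvec, hvec, hmat, hmat] at hF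
  · rw [wedgeOneTwoAt_pullback, wedgeOneTwoAt_pullback, h]

theorem wedgeOneThree_wedgeOneTwoAt_swap (h : ηᵀ = -η) (x b : Fin 4 → ℝ) :
    wedgeOneThree x (wedgeOneTwoAt b η) = -wedgeOneThree b (wedgeOneTwoAt x η) := by
  have hskew := apply_eq_neg_of_skew h
  simp only [wedgeOneThree, wedgeOneTwoAt]
  rw [hskew 2 0, hskew 3 0, hskew 3 1]
  ring

theorem wedgeOneThree_wedgeOneTwoAt_self (h : ηᵀ = -η) (x : Fin 4 → ℝ) :
    wedgeOneThree x (wedgeOneTwoAt x η) = 0 :=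
  self_eq_neg.1 (wedgeOneThree_wedgeOneTwoAt_swap h x x)

theorem cross_mul_comm_of_wedgeOneTwoAt_eq_zero {x b : Fin 4 → ℝ} (h : ηᵀ = -η)
    (hx : wedgeOneTwoAt x η = 0) (hb : wedgeOneTwoAt b η = 0) (i j k l : Fin 4) :
    (x i * b j - x j * b i) * η k l = (x k * b l - x l * b k) * η i j := by
  have hbj : wedgeOneTwoAt b η j k l = 0 := by rw [hb]; rfl
  have hbi : wedgeOneTwoAt b η i k l = 0 := by rw [hb]; rfl
  have hxl : wedgeOneTwoAt x η i j l = 0 := by rw [hx]; rfl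
  have hxk : wedgeOneTwoAt x η i j k = 0 := by rw [hx]; rfl
  simp only [wedgeOneTwoAt] at hbj hbi hxl hxk
  rw [apply_eq_neg_of_skew h l i] at hbi hxl
  rw [apply_eq_neg_of_skew h l j] at hbj
  rw [apply_eq_neg_of_skew h k i] at hxk
  linear_combination x i * hbj - x j * hbi + b k * hxl - b l * hxk

theorem mul_wedgeTwoTwo_of_proportional (h : ∀ i j k l, η i j * ζ k l = η k l * ζ i j) (ν : Mat)
    (i j : Fin 4) : η i j * wedgeTwoTwo ζ ν = wedgeTwoTwo η ν * ζ i j := by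
  simp only [wedgeTwoTwo]
  linear_combination ν 2 3 * h i j 0 1 - ν 1 3 * h i j 0 2 + ν 1 2 * h i j 0 3 +
    ν 0 3 * h i j 1 2 - ν 0 2 * h i j 1 3 + ν 0 1 * h i j 2 3

theorem SmoothMat.wedgeTwoTwo {U : Set E4} {η ζ : E4 → Mat} (hη : SmoothMat U η)
    (hζ : SmoothMat U ζ) {y : E4} (hy : y ∈ U) :
    ContDiffAt ℝ ∞ (fun z => wedgeTwoTwo (η z) (ζ z)) y := by
  have a (i j) := hη i j y hy
  have b (i j) := hζ i j y hy
  exact ((((((a 0 1).mul (b 2 3)).sub ((a 0 2).mul (b 1 3))).add ((a 0 3).mul (b 1 2))).add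
    ((a 1 2).mul (b 0 3))).sub ((a 1 3).mul (b 0 2))).add ((a 2 3).mul (b 0 1))

end Forms

section SkewAdjoint

variable {n : Type*} [Fintype n] {g j k : Matrix n n ℝ}

theorem isSkewAdjoint_iff : g.IsSkewAdjoint k ↔ kᵀ * g = -(g * k) := by
  rw [Matrix.IsSkewAdjoint, Matrix.IsAdjointPair, Matrix.mul_neg]

theorem dotProduct_mulVec_of_isSkewAdjoint (hk : g.IsSkewAdjoint k) (v w : n → ℝ) :
    (k *ᵥ v) ⬝ᵥ g *ᵥ w = -(v ⬝ᵥ g *ᵥ (k *ᵥ w)) := by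
  rw [Matrix.mulVec_mulVec, ← Matrix.vecMul_transpose, ← Matrix.dotProduct_mulVec,
    Matrix.mulVec_mulVec, isSkewAdjoint_iff.1 hk, Matrix.neg_mulVec, dotProduct_neg]

theorem dotProduct_mulVec_comm_of_isSymm (hg : g.IsSymm) (v w : n → ℝ) :
    v ⬝ᵥ g *ᵥ w = w ⬝ᵥ g *ᵥ v := by
  conv_lhs => rw [Matrix.dotProduct_mulVec, ← Matrix.mulVec_transpose, hg.eq, dotProduct_comm]

theorem dotProduct_mulVec_self_of_isSkewAdjoint (hg : g.IsSymm) (hk : g.IsSkewAdjoint k)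
    (v : n → ℝ) : v ⬝ᵥ g *ᵥ (k *ᵥ v) = 0 := by
  have h := dotProduct_mulVec_of_isSkewAdjoint hk v v
  rw [dotProduct_mulVec_comm_of_isSymm hg] at h
  linarith

theorem transpose_mul_skew_of_isSkewAdjoint (hg : g.IsSymm) (hk : g.IsSkewAdjoint k) :
    (kᵀ * g)ᵀ = -(kᵀ * g) := by
  rw [Matrix.transpose_mul, Matrix.transpose_transpose, hg.eq, isSkewAdjoint_iff.1 hk, neg_neg]

theorem isSkewAdjoint_mul_of_anticommute (hj : g.IsSkewAdjoint j) (hk : g.IsSkewAdjoint k)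
    (hkj : k * j = -(j * k)) : g.IsSkewAdjoint (j * k) := by
  rw [isSkewAdjoint_iff] at hj hk ⊢
  rw [Matrix.transpose_mul, Matrix.mul_assoc, hj, Matrix.mul_neg, ← Matrix.mul_assoc, hk,
    Matrix.neg_mul, Matrix.mul_assoc, hkj]
  simp

theorem isSkewAdjoint_commutator (hj : g.IsSkewAdjoint j) (hk : g.IsSkewAdjoint k) :
    g.IsSkewAdjoint (j * k - k * j) := by
  classical
  exact (mem_skewAdjointMatricesSubmodule _ _).1 <| Matrix.isSkewAdjoint_bracket g
    ((mem_skewAdjointMatricesSubmodule _ _).2 hj) ((mem_skewAdjointMatricesSubmodule _ _).2 hk)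

theorem trace_eq_zero_of_isSkewAdjoint [DecidableEq n] (hg : g.det ≠ 0)
    (hk : g.IsSkewAdjoint k) : k.trace = 0 := by
  have hg' := hg.isUnit
  have htrace : k.trace = -k.trace :=
    calc k.trace = (kᵀ * g * g⁻¹).trace := by
          rw [Matrix.mul_nonsing_inv_cancel_right _ _ hg', Matrix.trace_transpose]
      _ = -k.trace := by
          rw [isSkewAdjoint_iff.1 hk, Matrix.neg_mul, Matrix.trace_neg, Matrix.trace_mul_comm,
            Matrix.nonsing_inv_mul_cancel_left _ _ hg']
  linarith

end SkewAdjoint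

/-- The standard complex structure of `ℝ⁴`. -/
def stdI : Mat := !![0, -1, 0, 0; 1, 0, 0, 0; 0, 0, 0, -1; 0, 0, 1, 0]

/-- A second complex structure of `ℝ⁴`, which together with `stdI` generates the quaternions. -/
def stdJ : Mat := !![0, 0, -1, 0; 0, 0, 0, 1; 1, 0, 0, 0; 0, -1, 0, 0]

/-- The matrices of a Hermitian inner product: `g` is an inner product and `j` a `g`-orthogonal
complex structure. -/
structure IsHermitianPair (g j : Mat) : Prop where
  posDef : g.PosDef
  sq : j * j = -1
  orth : jᵀ * g * j = g

/-- `k` is `g`-skew-adjoint and antilinear for the complex structure `j`. -/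
structure IsSkewAntilinear (g j k : Mat) : Prop where
  skew : g.IsSkewAdjoint k
  anti : k * j = -(j * k)

/-- `n` is a second `g`-orthogonal complex structure, so that `j` and `n` generate a quaternionic
structure. -/
structure IsQuaternionic (g j n : Mat) : Prop extends IsSkewAntilinear g j n where
  sq : n * n = -1

section Frames

/-- The matrix with columns `v 0, …, v 3`. -/
def colMat (v : Fin 4 → Fin 4 → ℝ) : Mat := (Matrix.of v)ᵀ

theorem colMat_gram (g : Mat) (v : Fin 4 → Fin 4 → ℝ) (a b : Fin 4) :
    ((colMat v)ᵀ * g * colMat v) a b = v a ⬝ᵥ g *ᵥ v b := by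
  rw [Matrix.mul_assoc]
  simp only [Matrix.mul_apply, colMat, Matrix.transpose_apply, Matrix.of_apply, dotProduct,
    Matrix.mulVec]

theorem mul_colMat (k : Mat) (v : Fin 4 → Fin 4 → ℝ) :
    k * colMat v = colMat fun a => k *ᵥ v a := by
  ext i a
  simp [colMat, Matrix.mul_apply, Matrix.mulVec, dotProduct]

variable {g j n E F k k₀ : Mat}

theorem exists_smul_unit (hg : g.PosDef) {v : Fin 4 → ℝ} (hv : v ≠ 0) :
    ∃ c : ℝ, (c • v) ⬝ᵥ g *ᵥ (c • v) = 1 := by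
  have hpos : 0 < v ⬝ᵥ g *ᵥ v := hg.dotProduct_mulVec_pos hv
  refine ⟨(√(v ⬝ᵥ g *ᵥ v))⁻¹, ?_⟩
  rw [Matrix.mulVec_smul, smul_dotProduct, dotProduct_smul, smul_eq_mul, smul_eq_mul, ← mul_assoc,
    ← mul_inv, Real.mul_self_sqrt hpos.le, inv_mul_cancel₀ hpos.ne']

theorem frame_mul_intertwine (hFE : F * E = 1) (hEF : E * F = 1) (hk : k * E = E * k₀) :
    F * k = k₀ * F := by
  calc F * k = F * (k * E) * F := by rw [Matrix.mul_assoc, Matrix.mul_assoc, hEF, Matrix.mul_one]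
    _ = F * E * k₀ * F := by rw [hk, ← Matrix.mul_assoc]
    _ = k₀ * F := by rw [hFE, Matrix.one_mul]

theorem frame_pullback_form (hE : Eᵀ * g * E = 1) (hk : k * E = E * k₀) :
    Eᵀ * (kᵀ * g) * E = k₀ᵀ := by
  calc Eᵀ * (kᵀ * g) * E = (k * E)ᵀ * g * E := by rw [Matrix.transpose_mul]; noncomm_ring
    _ = k₀ᵀ * (Eᵀ * g * E) := by rw [hk, Matrix.transpose_mul]; noncomm_ring
    _ = k₀ᵀ := by rw [hE, Matrix.mul_one]

namespace IsHermitianPair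

theorem symm (h : IsHermitianPair g j) : g.IsSymm := h.posDef.isHermitian

theorem det_ne (h : IsHermitianPair g j) : g.det ≠ 0 := h.posDef.det_pos.ne'

theorem skew (h : IsHermitianPair g j) : g.IsSkewAdjoint j := by
  rw [isSkewAdjoint_iff]
  conv_rhs => rw [← h.orth, Matrix.mul_assoc, h.sq, Matrix.mul_neg, neg_neg, Matrix.mul_one]

theorem trace_eq_zero (h : IsHermitianPair g j) : j.trace = 0 :=
  trace_eq_zero_of_isSkewAdjoint h.det_ne h.skew

theorem trace_eq_zero_of_anticommute (h : IsHermitianPair g j) (hkj : k * j = -(j * k)) :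
    k.trace = 0 := by
  have htrace : k.trace = -k.trace :=
    calc k.trace = (j * k * j).trace := by
          rw [Matrix.mul_assoc, hkj, Matrix.mul_neg, ← Matrix.mul_assoc, h.sq, neg_one_mul,
            neg_neg]
      _ = -k.trace := by
          rw [Matrix.trace_mul_comm, ← Matrix.mul_assoc, h.sq, neg_one_mul, Matrix.trace_neg]
  linarith

theorem colMat_adapted (h : IsHermitianPair g j) {v w : Fin 4 → ℝ} (hv : v ⬝ᵥ g *ᵥ v = 1)
    (hw : w ⬝ᵥ g *ᵥ w = 1) (hvw : v ⬝ᵥ g *ᵥ w = 0) (hjvw : (j *ᵥ v) ⬝ᵥ g *ᵥ w = 0) :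
    (colMat ![v, j *ᵥ v, w, j *ᵥ w])ᵀ * g * colMat ![v, j *ᵥ v, w, j *ᵥ w] = 1 ∧
    j * colMat ![v, j *ᵥ v, w, j *ᵥ w] = colMat ![v, j *ᵥ v, w, j *ᵥ w] * stdI := by
  have hjj (u) : j *ᵥ (j *ᵥ u) = -u := by
    rw [Matrix.mulVec_mulVec, h.sq, Matrix.neg_mulVec, Matrix.one_mulVec]
  have hjskew := dotProduct_mulVec_of_isSkewAdjoint h.skew
  have hj_orth (u u') : (j *ᵥ u) ⬝ᵥ g *ᵥ (j *ᵥ u') = u ⬝ᵥ g *ᵥ u' := by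
    rw [hjskew, hjj, Matrix.mulVec_neg, dotProduct_neg, neg_neg]
  have hvjw : v ⬝ᵥ g *ᵥ (j *ᵥ w) = 0 := by linarith [hjskew v w]
  have hsymm := dotProduct_mulVec_comm_of_isSymm h.symm
  constructor
  · ext a b
    rw [colMat_gram]
    fin_cases a <;> fin_cases b <;>
      simp [-Matrix.mulVec_mulVec, hv, hw, hvw, hjvw, hj_orth, hvjw,
        dotProduct_mulVec_self_of_isSkewAdjoint h.symm h.skew, hsymm (j *ᵥ v) v,
        hsymm (j *ᵥ w) v, hsymm (j *ᵥ w) w, hsymm w v, hsymm w (j *ᵥ v)]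
  · rw [mul_colMat]
    ext i a
    fin_cases a <;>
      simp [colMat, Matrix.mul_apply, Fin.sum_univ_four, stdI, hjj, -Matrix.mulVec_mulVec]

theorem exists_frame (h : IsHermitianPair g j) : ∃ E : Mat, Eᵀ * g * E = 1 ∧ j * E = E * stdI := by
  obtain ⟨c, hc⟩ := exists_smul_unit h.posDef (v := Pi.single 0 1) (by simp)
  set v : Fin 4 → ℝ := c • Pi.single 0 1
  obtain ⟨w, hw, hw0⟩ :
      ∃ w ∈ LinearMap.ker (Matrix.mulVecLin (Matrix.of ![v ᵥ* g, (j *ᵥ v) ᵥ* g])), w ≠ 0 :=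
    Submodule.exists_mem_ne_zero_of_ne_bot (LinearMap.ker_ne_bot_of_finrank_lt (by simp))
  have hvw : v ⬝ᵥ g *ᵥ w = 0 := by
    rw [Matrix.dotProduct_mulVec]
    exact congrFun (LinearMap.mem_ker.1 hw) 0
  have hjvw : (j *ᵥ v) ⬝ᵥ g *ᵥ w = 0 := by
    rw [Matrix.dotProduct_mulVec]
    exact congrFun (LinearMap.mem_ker.1 hw) 1
  obtain ⟨d, hd⟩ := exists_smul_unit h.posDef hw0
  refine ⟨_, h.colMat_adapted hc hd ?_ ?_⟩ <;>
    simp only [Matrix.mulVec_smul g d w, dotProduct_smul, hvw, hjvw, smul_zero]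

end IsHermitianPair

namespace IsQuaternionic

theorem exists_frame (hn : IsQuaternionic g j n) (h : IsHermitianPair g j) :
    ∃ E : Mat, Eᵀ * g * E = 1 ∧ j * E = E * stdI ∧ n * E = E * stdJ := by
  obtain ⟨c, hc⟩ := exists_smul_unit h.posDef (v := Pi.single 0 1) (by simp)
  set v : Fin 4 → ℝ := c • Pi.single 0 1
  have hnn (u) : n *ᵥ (n *ᵥ u) = -u := by
    rw [Matrix.mulVec_mulVec, hn.sq, Matrix.neg_mulVec, Matrix.one_mulVec]
  have hnj (u) : n *ᵥ (j *ᵥ u) = -(j *ᵥ (n *ᵥ u)) := by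
    rw [Matrix.mulVec_mulVec, hn.anti, Matrix.neg_mulVec, Matrix.mulVec_mulVec]
  have hnv : (n *ᵥ v) ⬝ᵥ g *ᵥ (n *ᵥ v) = 1 := by
    rw [dotProduct_mulVec_of_isSkewAdjoint hn.skew, hnn, Matrix.mulVec_neg, dotProduct_neg,
      neg_neg, hc]
  have hjn := isSkewAdjoint_mul_of_anticommute h.skew hn.skew hn.anti
  have hjvnv : (j *ᵥ v) ⬝ᵥ g *ᵥ (n *ᵥ v) = 0 := by
    rw [dotProduct_mulVec_of_isSkewAdjoint h.skew, Matrix.mulVec_mulVec v j n,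
      dotProduct_mulVec_self_of_isSkewAdjoint h.symm hjn, neg_zero]
  obtain ⟨hE, hjE⟩ := h.colMat_adapted hc hnv
    (dotProduct_mulVec_self_of_isSkewAdjoint h.symm hn.skew v) hjvnv
  refine ⟨_, hE, hjE, ?_⟩
  rw [mul_colMat]
  ext i a
  fin_cases a <;>
    simp [colMat, Matrix.mul_apply, Fin.sum_univ_four, stdJ, hnn, hnj, -Matrix.mulVec_mulVec,
      Matrix.mulVec_neg]

end IsQuaternionic

end Frames

section Quaternions

variable {g j k l m n r : Mat}

theorem stdJ_mul_stdJ : stdJ * stdJ = -1 := by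
  ext a b
  fin_cases a <;> fin_cases b <;> simp [stdJ, Matrix.mul_apply, Fin.sum_univ_four]

theorem stdJ_mul_stdI : stdJ * stdI = -(stdI * stdJ) := by
  ext a b
  fin_cases a <;> fin_cases b <;> simp [stdI, stdJ, Matrix.mul_apply, Fin.sum_univ_four]

theorem transpose_stdJ : stdJᵀ = -stdJ := by
  ext a b
  fin_cases a <;> fin_cases b <;> simp [stdJ]

theorem eq_of_skew_of_anticommute_stdI (hk : kᵀ = -k) (hkI : k * stdI = -(stdI * k)) :
    k = k 2 0 • stdJ + k 3 0 • (stdI * stdJ) := by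
  have hswap := apply_eq_neg_of_skew hk
  have hdiag := apply_self_of_skew hk
  have hentry (a b) := congrFun (congrFun hkI a) b
  have h11 := hentry 1 1
  have h20 := hentry 2 0
  have h30 := hentry 3 0
  have h33 := hentry 3 3
  have h21 := hentry 2 1
  simp only [Matrix.mul_apply, Matrix.neg_apply, Fin.sum_univ_four] at h11 h20 h30 h33 h21
  simp only [stdI, Matrix.of_apply, Matrix.cons_val', Matrix.cons_val_one, Matrix.cons_val_zero,
    Matrix.cons_val_fin_one, mul_neg, mul_one, hdiag, mul_zero, add_zero, Matrix.cons_val, one_mul,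
    zero_mul, neg_inj, zero_add, neg_mul, neg_neg] at h11 h20 h30 h33 h21
  have := hswap 0 1
  have := hswap 0 2
  have := hswap 0 3
  have := hswap 1 2
  have := hswap 1 3
  have := hswap 2 3
  ext a b
  fin_cases a <;> fin_cases b <;>
    simp only [Matrix.mul_apply, Matrix.add_apply, Matrix.smul_apply, Fin.sum_univ_four] <;>
    simp [stdI, stdJ, hdiag] <;> linarith

theorem IsHermitianPair.exists_companion (h : IsHermitianPair g j) :
    ∃ n, IsQuaternionic g j n := by
  obtain ⟨E, hE, hj⟩ := h.exists_frame
  have hE' : E * (Eᵀ * g) = 1 := mul_eq_one_comm.1 hE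
  have hj' := frame_mul_intertwine hE hE' hj
  obtain ⟨F, hF⟩ : ∃ F, F = Eᵀ * g := ⟨_, rfl⟩
  rw [← hF] at hE hE' hj'
  refine ⟨E * stdJ * F, ⟨?_, ?_⟩, ?_⟩
  · have hFt : Fᵀ = g * E := by
      rw [hF, Matrix.transpose_mul, Matrix.transpose_transpose, h.symm.eq]
    rw [isSkewAdjoint_iff, Matrix.transpose_mul, Matrix.transpose_mul, hFt, transpose_stdJ]
    simp only [hF, Matrix.mul_assoc, Matrix.neg_mul, Matrix.mul_neg]
  · calc E * stdJ * F * j = E * (stdJ * stdI) * F := by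
          rw [Matrix.mul_assoc, hj']
          noncomm_ring
      _ = -(E * stdI * (stdJ * F)) := by
          rw [stdJ_mul_stdI]
          noncomm_ring
      _ = -(j * (E * stdJ * F)) := by
          rw [← hj]
          noncomm_ring
  · calc E * stdJ * F * (E * stdJ * F) = E * (stdJ * (F * E) * stdJ) * F := by noncomm_ring
      _ = -(E * F) := by
          rw [hE, Matrix.mul_one, stdJ_mul_stdJ]
          noncomm_ring
      _ = -1 := by rw [hE']

namespace IsSkewAntilinear

theorem smul (hk : IsSkewAntilinear g j k) (a : ℝ) : IsSkewAntilinear g j (a • k) where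
  skew := by
    have h := isSkewAdjoint_iff.1 hk.skew
    rw [isSkewAdjoint_iff, Matrix.transpose_smul, Matrix.smul_mul, h, Matrix.mul_smul, smul_neg]
  anti := by rw [Matrix.smul_mul, hk.anti, Matrix.mul_smul, smul_neg]

theorem sub (hk : IsSkewAntilinear g j k) (hl : IsSkewAntilinear g j l) :
    IsSkewAntilinear g j (k - l) where
  skew := by
    have hk' := isSkewAdjoint_iff.1 hk.skew
    have hl' := isSkewAdjoint_iff.1 hl.skew
    rw [isSkewAdjoint_iff, Matrix.transpose_sub, Matrix.sub_mul, hk', hl']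
    noncomm_ring
  anti := by
    rw [Matrix.sub_mul, hk.anti, hl.anti]
    noncomm_ring

theorem mul_left (hk : IsSkewAntilinear g j k) (h : IsHermitianPair g j) :
    IsSkewAntilinear g j (j * k) :=
  ⟨isSkewAdjoint_mul_of_anticommute h.skew hk.skew hk.anti, by
    rw [Matrix.mul_assoc, hk.anti, Matrix.mul_neg]⟩

theorem commutator (hk : IsSkewAntilinear g j k) (hr : g.IsSkewAdjoint r)
    (hrj : r * j = j * r) : IsSkewAntilinear g j (r * k - k * r) := by
  refine ⟨isSkewAdjoint_commutator hr hk.skew, ?_⟩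
  calc (r * k - k * r) * j = r * (k * j) - k * (r * j) := by noncomm_ring
    _ = r * -(j * k) - k * (j * r) := by rw [hk.anti, hrj]
    _ = -(r * j) * k - k * j * r := by noncomm_ring
    _ = -(j * (r * k - k * r)) := by
      rw [hk.anti, hrj]
      noncomm_ring

theorem exists_frame_coeff (hk : IsSkewAntilinear g j k) (hg : g.IsSymm) {E : Mat}
    (hE : Eᵀ * g * E = 1) (hj : j * E = E * stdI) :
    ∃ x y : ℝ, k * E = E * (x • stdJ + y • (stdI * stdJ)) := by
  have hE' : E * (Eᵀ * g) = 1 := mul_eq_one_comm.1 hE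
  have hj' := frame_mul_intertwine hE hE' hj
  obtain ⟨F, hF⟩ : ∃ F, F = Eᵀ * g := ⟨_, rfl⟩
  rw [← hF] at hE' hj'
  have hkE : k * E = E * (F * k * E) := by
    rw [Matrix.mul_assoc F, ← Matrix.mul_assoc, hE', Matrix.one_mul]
  have hskew : (F * k * E)ᵀ = -(F * k * E) := by
    have hform := frame_pullback_form hE hkE
    calc (F * k * E)ᵀ = -(Eᵀ * (kᵀ * g)ᵀ * E) := by
          rw [← hform, transpose_mul_skew_of_isSkewAdjoint hg hk.skew]
          noncomm_ring
      _ = -(Eᵀ * (kᵀ * g) * E)ᵀ := by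
          rw [Matrix.transpose_mul (Eᵀ * _), Matrix.transpose_mul Eᵀ, Matrix.transpose_transpose,
            Matrix.mul_assoc]
      _ = -(F * k * E) := by rw [hform, Matrix.transpose_transpose]
  have hanti : F * k * E * stdI = -(stdI * (F * k * E)) := by
    calc F * k * E * stdI = F * (k * j) * E := by
          rw [Matrix.mul_assoc, ← hj]
          noncomm_ring
      _ = -(F * j * k * E) := by
          rw [hk.anti]
          noncomm_ring
      _ = -(stdI * (F * k * E)) := by
          rw [hj']
          noncomm_ring
  refine ⟨(F * k * E) 2 0, (F * k * E) 3 0, ?_⟩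
  rw [← eq_of_skew_of_anticommute_stdI hskew hanti, hkE]

end IsSkewAntilinear

namespace IsQuaternionic

theorem mul_left (hn : IsQuaternionic g j n) (h : IsHermitianPair g j) :
    IsQuaternionic g j (j * n) := by
  refine ⟨hn.toIsSkewAntilinear.mul_left h, ?_⟩
  calc j * n * (j * n) = j * (n * j) * n := by noncomm_ring
    _ = -(j * j * (n * n)) := by
      rw [hn.anti]
      noncomm_ring
    _ = -1 := by
      rw [h.sq, hn.sq]
      noncomm_ring

theorem exists_coeff (hn : IsQuaternionic g j n) (h : IsHermitianPair g j)
    (hk : IsSkewAntilinear g j k) : ∃ x y : ℝ, k = x • n + y • (j * n) := by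
  obtain ⟨E, hE, hj, hnE⟩ := hn.exists_frame h
  have hE' : E * (Eᵀ * g) = 1 := mul_eq_one_comm.1 hE
  obtain ⟨x, y, hkE⟩ := hk.exists_frame_coeff h.symm hE hj
  refine ⟨x, y, ?_⟩
  have hcancel : k * E = (x • n + y • (j * n)) * E := by
    rw [hkE, Matrix.add_mul, Matrix.smul_mul, Matrix.smul_mul, Matrix.mul_assoc j, hnE,
      ← Matrix.mul_assoc j, hj, Matrix.mul_add, Matrix.mul_smul, Matrix.mul_smul,
      Matrix.mul_assoc E stdI]
  rw [← Matrix.mul_one k, ← hE', ← Matrix.mul_assoc, hcancel, Matrix.mul_assoc, hE',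
    Matrix.mul_one]

theorem add_smul_mul_add_smul (hn : IsQuaternionic g j n) (h : IsHermitianPair g j)
    (x y a b : ℝ) : (x • n + y • (j * n)) * (a • n + b • (j * n)) =
      (-(x * a + y * b)) • (1 : Mat) + (x * b - y * a) • j := by
  have hnjn : n * (j * n) = j := by
    rw [← Matrix.mul_assoc, hn.anti, Matrix.neg_mul, Matrix.mul_assoc, hn.sq, mul_neg_one, neg_neg]
  have hjnn : j * n * n = -j := by rw [Matrix.mul_assoc, hn.sq, mul_neg_one]
  simp only [Matrix.mul_add, Matrix.add_mul, Matrix.mul_smul, Matrix.smul_mul, hn.sq, hnjn, hjnn,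
    (hn.mul_left h).sq]
  module

end IsQuaternionic

theorem IsHermitianPair.trace_smul_one_add_smul (h : IsHermitianPair g j) (a b : ℝ) :
    (a • (1 : Mat) + b • j).trace = 4 * a := by
  rw [Matrix.trace_add, Matrix.trace_smul, Matrix.trace_smul, h.trace_eq_zero, Matrix.trace_one]
  simp [mul_comm]

theorem IsQuaternionic.eq_trace_smul (hn : IsQuaternionic g j n) (h : IsHermitianPair g j)
    (hk : IsSkewAntilinear g j k) :
    k = (-(1 / 4 : ℝ) * (k * n).trace) • n + (-(1 / 4 : ℝ) * (k * (j * n)).trace) • (j * n) := by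
  obtain ⟨x, y, rfl⟩ := hn.exists_coeff h hk
  have hx := hn.add_smul_mul_add_smul h x y 1 0
  have hy := hn.add_smul_mul_add_smul h x y 0 1
  simp only [one_smul, zero_smul, add_zero, zero_add] at hx hy
  rw [hx, hy, h.trace_smul_one_add_smul, h.trace_smul_one_add_smul]
  module

namespace IsSkewAntilinear

theorem commutator_eq (hk : IsSkewAntilinear g j k) (hl : IsSkewAntilinear g j l)
    (h : IsHermitianPair g j) : k * l - l * k = (-(1 / 2 : ℝ) * (j * k * l).trace) • j := by
  obtain ⟨n, hn⟩ := h.exists_companion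
  obtain ⟨a, b, rfl⟩ := hn.exists_coeff h hl
  obtain ⟨x, y, rfl⟩ := hn.exists_coeff h hk
  have htrace (c d : ℝ) : (j * (c • (1 : Mat) + d • j)).trace = -4 * d := by
    rw [Matrix.mul_add, Matrix.mul_smul, Matrix.mul_smul, h.sq, Matrix.mul_one, add_comm,
      smul_neg, ← neg_smul, h.trace_smul_one_add_smul]
    ring
  rw [Matrix.mul_assoc, hn.add_smul_mul_add_smul h, hn.add_smul_mul_add_smul h, htrace]
  module

theorem exists_mul_self_eq (hk : IsSkewAntilinear g j k) (h : IsHermitianPair g j) :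
    ∃ n : Mat, ∃ x y : ℝ, k = x • n + y • (j * n) ∧ k * k = -(x ^ 2 + y ^ 2) • (1 : Mat) := by
  obtain ⟨n, hn⟩ := h.exists_companion
  obtain ⟨x, y, rfl⟩ := hn.exists_coeff h hk
  refine ⟨n, x, y, rfl, ?_⟩
  rw [hn.add_smul_mul_add_smul h]
  module

theorem mul_self_eq (hk : IsSkewAntilinear g j k) (h : IsHermitianPair g j) :
    k * k = ((1 / 4 : ℝ) * (k * k).trace) • (1 : Mat) := by
  obtain ⟨n, x, y, -, hsq⟩ := hk.exists_mul_self_eq h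
  rw [hsq, Matrix.trace_smul, Matrix.trace_one, Fintype.card_fin, smul_eq_mul]
  module

theorem trace_mul_self_nonpos (hk : IsSkewAntilinear g j k) (h : IsHermitianPair g j) :
    (k * k).trace ≤ 0 := by
  obtain ⟨n, x, y, -, hsq⟩ := hk.exists_mul_self_eq h
  rw [hsq, Matrix.trace_smul, Matrix.trace_one, Fintype.card_fin, smul_eq_mul]
  push_cast
  nlinarith

theorem eq_zero_of_trace_mul_self_eq_zero (hk : IsSkewAntilinear g j k)
    (h : IsHermitianPair g j) (h0 : (k * k).trace = 0) : k = 0 := by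
  obtain ⟨n, x, y, rfl, hsq⟩ := hk.exists_mul_self_eq h
  rw [hsq, Matrix.trace_smul, Matrix.trace_one, Fintype.card_fin, smul_eq_mul] at h0
  push_cast at h0
  have hx : x = 0 := by nlinarith
  have hy : y = 0 := by nlinarith
  rw [hx, hy, zero_smul, zero_smul, add_zero]

end IsSkewAntilinear

theorem IsQuaternionic.commutator_eq (hn : IsQuaternionic g j n) (h : IsHermitianPair g j)
    (hr : g.IsSkewAdjoint r) (hrj : r * j = j * r) :
    r * n - n * r = (-(1 / 2 : ℝ) * (j * r).trace) • (j * n) := by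
  have hdecomp := hn.eq_trace_smul h (hn.commutator hr hrj)
  have htrace_n : ((r * n - n * r) * n).trace = 0 := by
    rw [Matrix.sub_mul, Matrix.trace_sub, Matrix.mul_assoc n, Matrix.trace_mul_comm n, sub_self]
  have htrace_jn : ((r * n - n * r) * (j * n)).trace = 2 * (j * r).trace := by
    have hleft : r * n * (j * n) = r * j := by
      rw [Matrix.mul_assoc, ← Matrix.mul_assoc n, hn.anti, Matrix.neg_mul, Matrix.mul_assoc j,
        hn.sq, mul_neg_one, neg_neg]
    have hright : (n * r * (j * n)).trace = -(r * j).trace := by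
      rw [Matrix.mul_assoc, Matrix.trace_mul_comm n, ← Matrix.mul_assoc, Matrix.mul_assoc _ n n,
        hn.sq, mul_neg_one, Matrix.trace_neg]
    rw [Matrix.sub_mul, Matrix.trace_sub, hleft, hright, Matrix.trace_mul_comm r]
    ring
  rw [htrace_n, htrace_jn] at hdecomp
  rw [hdecomp]
  module

theorem IsSkewAntilinear.commutator_eq_of_commute (hk : IsSkewAntilinear g j k)
    (h : IsHermitianPair g j) (hr : g.IsSkewAdjoint r) (hrj : r * j = j * r) :
    r * k - k * r = (-(1 / 2 : ℝ) * (j * r).trace) • (j * k) := by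
  obtain ⟨n, hn⟩ := h.exists_companion
  obtain ⟨x, y, rfl⟩ := hn.exists_coeff h hk
  have hcomm : r * (x • n + y • (j * n)) - (x • n + y • (j * n)) * r =
      x • (r * n - n * r) + y • (r * (j * n) - j * n * r) := by
    simp only [Matrix.mul_add, Matrix.add_mul, Matrix.mul_smul, Matrix.smul_mul, smul_sub]
    abel
  rw [hcomm, hn.commutator_eq h hr hrj, (hn.mul_left h).commutator_eq h hr hrj, Matrix.mul_add,
    Matrix.mul_smul, Matrix.mul_smul]
  module

end Quaternions

/-! ### Algebraic curvature tensors of Kähler type -/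

section KahlerCurvature

/-- An algebraic curvature tensor for the symmetric form `g` whose curvature endomorphisms commute
with `j`. It is given by its endomorphisms `R a b`, so that `R a b d c` is the coefficient of `∂_d`
in `R(∂_a, ∂_b) ∂_c`. -/
structure IsKahlerCurvature {n : Type*} [Fintype n] (g j : Matrix n n ℝ)
    (R : n → n → Matrix n n ℝ) : Prop where
  antisymm : ∀ a b, R a b = -R b a
  skew : ∀ a b, g.IsSkewAdjoint (R a b)
  bianchi : ∀ a b c d, R a b d c + R b c d a + R c a d b = 0
  comm : ∀ a b, R a b * j = j * R a b

variable {n : Type*} [Fintype n]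

/-- The 2-form `tr (j R(X, Y))`, a multiple of the Ricci form. -/
def ricciTwoForm (j : Matrix n n ℝ) (R : n → n → Matrix n n ℝ) : Matrix n n ℝ :=
  Matrix.of fun a b => (j * R a b).trace

/-- The scalar curvature of an algebraic curvature tensor. -/
def scalarOf [DecidableEq n] (g : Matrix n n ℝ) (R : n → n → Matrix n n ℝ) : ℝ :=
  ∑ j, ∑ k, g⁻¹ j k * ∑ i, R i j i k

/-- The endomorphism-valued 2-form `R` evaluated on the columns of `E`. -/
def pullArgs (E : Matrix n n ℝ) (R : n → n → Matrix n n ℝ) (a b : n) : Matrix n n ℝ :=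
  ∑ i, ∑ l, (E i a * E l b) • R i l

/-- The components of a curvature tensor in the frame given by the columns of `E`, where `F` is the
inverse of `E`. -/
def pullCurv (F E : Matrix n n ℝ) (R : n → n → Matrix n n ℝ) (a b : n) : Matrix n n ℝ :=
  F * pullArgs E R a b * E

variable {g j g' j' F E : Matrix n n ℝ} {R : n → n → Matrix n n ℝ}

theorem ricciTwoForm_pullArgs :
    ricciTwoForm j (pullArgs E R) = Eᵀ * ricciTwoForm j R * E := by
  ext a b
  simp only [ricciTwoForm, pullArgs, Matrix.of_apply, Matrix.mul_apply, Matrix.transpose_apply,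
    Matrix.mul_sum, Matrix.mul_smul, Matrix.trace_sum, Matrix.trace_smul, smul_eq_mul,
    Finset.sum_mul]
  rw [Finset.sum_comm]
  exact Finset.sum_congr rfl fun _ _ => Finset.sum_congr rfl fun _ _ => by ring

theorem ricciTwoForm_pullCurv [DecidableEq n] (hj : j' * F = F * j) (hEF : E * F = 1) :
    ricciTwoForm j' (pullCurv F E R) = Eᵀ * ricciTwoForm j R * E := by
  rw [← ricciTwoForm_pullArgs]
  ext a b
  calc (j' * (F * pullArgs E R a b * E)).trace = (j' * F * pullArgs E R a b * E).trace := by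
        noncomm_ring
    _ = (E * F * (j * pullArgs E R a b)).trace := by
        rw [hj, Matrix.trace_mul_comm]
        noncomm_ring
    _ = (j * pullArgs E R a b).trace := by rw [hEF, Matrix.one_mul]

theorem trace_pullCurv [DecidableEq n] (hEF : E * F = 1) (c : n) :
    ∑ a, pullCurv F E R a c a c = ∑ l, ∑ i, ∑ m, E l c * (R i l i m * E m c) := by
  have hentry (a) : pullCurv F E R a c a c =
      ∑ l, ∑ i, E l c * (E i a * (F * (R i l * E)) a c) := by
    simp only [pullCurv, pullArgs, Finset.mul_sum, Finset.sum_mul, Matrix.sum_apply,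
      Matrix.mul_smul, Matrix.smul_mul, Matrix.smul_apply, smul_eq_mul, ← Matrix.mul_assoc]
    rw [Finset.sum_comm]
    exact Finset.sum_congr rfl fun _ _ => Finset.sum_congr rfl fun _ _ => by ring
  simp only [hentry]
  rw [Finset.sum_comm]
  refine Finset.sum_congr rfl fun l _ => ?_
  rw [Finset.sum_comm]
  refine Finset.sum_congr rfl fun i _ => ?_
  rw [← Finset.mul_sum, ← Finset.mul_sum, ← Matrix.mul_apply (M := R i l),
    ← Matrix.mul_apply (M := E), ← Matrix.mul_assoc, hEF, Matrix.one_mul]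

theorem scalarOf_eq_sum_pullCurv [DecidableEq n] (hE : Eᵀ * g * E = 1) :
    scalarOf g R = ∑ a, ∑ c, pullCurv (Eᵀ * g) E R a c a c := by
  have hEF : E * (Eᵀ * g) = 1 := mul_eq_one_comm.1 hE
  have hg : g⁻¹ = E * Eᵀ := Matrix.inv_eq_left_inv (by rw [Matrix.mul_assoc, hEF])
  rw [Finset.sum_comm]
  simp only [trace_pullCurv hEF]
  calc scalarOf g R = ∑ l, ∑ m, ∑ c, ∑ i, E l c * (R i l i m * E m c) := by
        simp only [scalarOf, hg, Matrix.mul_apply, Matrix.transpose_apply, Finset.sum_mul,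
          Finset.mul_sum]
        refine Finset.sum_congr rfl fun _ _ => Finset.sum_congr rfl fun _ _ => ?_
        rw [Finset.sum_comm]
        exact Finset.sum_congr rfl fun _ _ => Finset.sum_congr rfl fun _ _ => by ring
    _ = ∑ c, ∑ l, ∑ i, ∑ m, E l c * (R i l i m * E m c) := by
        rw [Finset.sum_comm_cycle]
        refine Finset.sum_congr rfl fun c _ => Finset.sum_congr rfl fun l _ => ?_
        rw [Finset.sum_comm]

theorem pullArgs_mul_apply (a b c m : n) : (pullArgs E R a b * E) m c =
    ∑ i, ∑ l, ∑ p, E i a * E l b * E p c * R i l m p := by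
  simp only [pullArgs, Matrix.mul_apply, Matrix.sum_apply, Matrix.smul_apply, smul_eq_mul,
    Finset.sum_mul]
  rw [Finset.sum_comm]
  refine Finset.sum_congr rfl fun _ _ => ?_
  rw [Finset.sum_comm]
  exact Finset.sum_congr rfl fun _ _ => Finset.sum_congr rfl fun _ _ => by ring

namespace IsKahlerCurvature

theorem pullArgs_antisymm (h : IsKahlerCurvature g j R) (a b : n) :
    pullArgs E R a b = -pullArgs E R b a := by
  simp only [pullArgs, ← Finset.sum_neg_distrib]
  rw [Finset.sum_comm]
  refine Finset.sum_congr rfl fun _ _ => Finset.sum_congr rfl fun _ _ => ?_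
  rw [h.antisymm, smul_neg, mul_comm]

theorem pullArgs_skew (h : IsKahlerCurvature g j R) (a b : n) :
    g.IsSkewAdjoint (pullArgs E R a b) := by
  classical
  exact (mem_skewAdjointMatricesSubmodule _ _).1 <| Submodule.sum_mem _ fun i _ =>
    Submodule.sum_mem _ fun l _ => Submodule.smul_mem _ _
      ((mem_skewAdjointMatricesSubmodule _ _).2 (h.skew i l))

theorem pullArgs_bianchi (h : IsKahlerCurvature g j R) (a b c m : n) :
    (pullArgs E R a b * E) m c + (pullArgs E R b c * E) m a + (pullArgs E R c a * E) m b = 0 := by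
  have hbca : (pullArgs E R b c * E) m a =
      ∑ i, ∑ l, ∑ p, E i a * E l b * E p c * R l p m i := by
    rw [pullArgs_mul_apply, Finset.sum_comm_cycle]
    exact Finset.sum_congr rfl fun _ _ => Finset.sum_congr rfl fun _ _ =>
      Finset.sum_congr rfl fun _ _ => by ring
  have hcab : (pullArgs E R c a * E) m b =
      ∑ i, ∑ l, ∑ p, E i a * E l b * E p c * R p i m l := by
    rw [pullArgs_mul_apply, ← Finset.sum_comm_cycle]
    exact Finset.sum_congr rfl fun _ _ => Finset.sum_congr rfl fun _ _ =>
      Finset.sum_congr rfl fun _ _ => by ring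
  rw [pullArgs_mul_apply, hbca, hcab]
  simp only [← Finset.sum_add_distrib, ← mul_add, h.bianchi, mul_zero, Finset.sum_const_zero]

theorem pullArgs_comm (h : IsKahlerCurvature g j R) (a b : n) :
    pullArgs E R a b * j = j * pullArgs E R a b := by
  simp only [pullArgs, Finset.sum_mul, Finset.mul_sum, Matrix.smul_mul, Matrix.mul_smul, h.comm]

theorem pullCurv_comm [DecidableEq n] (h : IsKahlerCurvature g j R) (hE : E * F = 1)
    (hj : j' * F = F * j) (a b : n) : pullCurv F E R a b * j' = j' * pullCurv F E R a b := by
  have hjE : E * j' = j * E := by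
    calc E * j' = E * (j' * F) * E := by
          rw [Matrix.mul_assoc, Matrix.mul_assoc, mul_eq_one_comm.1 hE, Matrix.mul_one]
      _ = E * F * j * E := by rw [hj, ← Matrix.mul_assoc]
      _ = j * E := by rw [hE, Matrix.one_mul]
  calc F * pullArgs E R a b * E * j' = F * (pullArgs E R a b * j) * E := by
        rw [Matrix.mul_assoc _ E, hjE]
        noncomm_ring
    _ = F * j * pullArgs E R a b * E := by
        rw [h.pullArgs_comm]
        noncomm_ring
    _ = j' * (F * pullArgs E R a b * E) := by
        rw [← hj]
        noncomm_ring

theorem pullCurv [DecidableEq n] (h : IsKahlerCurvature g j R) (hE : E * F = 1)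
    (hj : j' * F = F * j) (hg : Eᵀ * g * E = g') : IsKahlerCurvature g' j' (pullCurv F E R) where
  antisymm a b := by
    unfold AlmostHermitian.pullCurv
    rw [h.pullArgs_antisymm]
    noncomm_ring
  skew a b := by
    have hFg : Fᵀ * g' = g * E := by
      rw [← hg, ← Matrix.mul_assoc, ← Matrix.mul_assoc, ← Matrix.transpose_mul, hE,
        Matrix.transpose_one, Matrix.one_mul]
    have hgF : g' * F = Eᵀ * g := by rw [← hg, Matrix.mul_assoc, hE, Matrix.mul_one]
    rw [isSkewAdjoint_iff]
    calc (AlmostHermitian.pullCurv F E R a b)ᵀ * g' = Eᵀ * (pullArgs E R a b)ᵀ * (Fᵀ * g') := by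
          rw [AlmostHermitian.pullCurv, Matrix.transpose_mul, Matrix.transpose_mul]
          noncomm_ring
      _ = Eᵀ * ((pullArgs E R a b)ᵀ * g) * E := by
          rw [hFg]
          noncomm_ring
      _ = -(g' * F * pullArgs E R a b * E) := by
          rw [isSkewAdjoint_iff.1 (h.pullArgs_skew a b), hgF]
          noncomm_ring
      _ = -(g' * AlmostHermitian.pullCurv F E R a b) := by
          rw [AlmostHermitian.pullCurv]
          noncomm_ring
  bianchi a b c d := by
    simp only [AlmostHermitian.pullCurv, Matrix.mul_assoc]
    rw [Matrix.mul_apply, Matrix.mul_apply (M := F) (N := pullArgs E R b c * E),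
      Matrix.mul_apply (M := F) (N := pullArgs E R c a * E), ← Finset.sum_add_distrib,
      ← Finset.sum_add_distrib]
    exact Finset.sum_eq_zero fun m _ => by
      rw [← mul_add, ← mul_add, h.pullArgs_bianchi, mul_zero]
  comm := h.pullCurv_comm hE hj

theorem ricciTwoForm_skew (h : IsKahlerCurvature g j R) :
    (ricciTwoForm j R)ᵀ = -ricciTwoForm j R := by
  ext a b
  rw [Matrix.transpose_apply, Matrix.neg_apply, ricciTwoForm, Matrix.of_apply, Matrix.of_apply,
    h.antisymm b a, Matrix.mul_neg, Matrix.trace_neg]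

end IsKahlerCurvature

theorem pair_symm_of_bianchi {ι : Type*} {T : ι → ι → ι → ι → ℝ}
    (hantisymm : ∀ a b c d, T a b c d = -T b a c d) (hskew : ∀ a b c d, T a b c d = -T a b d c)
    (hbianchi : ∀ a b c d, T a b d c + T b c d a + T c a d b = 0) (a b c d : ι) :
    T a b c d = T c d a b := by
  have := hbianchi a b c d
  have := hbianchi b c d a
  have := hbianchi c d a b
  have := hbianchi d a b c
  grind

end KahlerCurvature

section StandardFrame

variable {g j k : Mat} {R : Fin 4 → Fin 4 → Mat}

namespace IsKahlerCurvature

theorem apply_skew (h : IsKahlerCurvature 1 j R) (a b c d : Fin 4) :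
    R a b c d = -R a b d c := by
  have hskew := isSkewAdjoint_iff.1 (h.skew a b)
  rw [Matrix.mul_one, Matrix.one_mul] at hskew
  exact apply_eq_neg_of_skew hskew c d

theorem apply_antisymm (h : IsKahlerCurvature g j R) (a b c d : Fin 4) :
    R a b c d = -R b a c d := by
  rw [h.antisymm a b, Matrix.neg_apply]

theorem pair_symm (h : IsKahlerCurvature 1 j R) (a b c d : Fin 4) : R a b c d = R c d a b :=
  pair_symm_of_bianchi h.apply_antisymm h.apply_skew h.bianchi a b c d

theorem apply_zero_two (h : IsKahlerCurvature g stdI R) (a b : Fin 4) :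
    R a b 0 2 = R a b 1 3 := by
  have hentry := congrFun (congrFun (h.comm a b) 0) 3
  simp only [Matrix.mul_apply, Fin.sum_univ_four] at hentry
  simpa [stdI] using hentry

theorem apply_zero_three (h : IsKahlerCurvature g stdI R) (a b : Fin 4) :
    R a b 0 3 = -R a b 1 2 := by
  have hentry := congrFun (congrFun (h.comm a b) 0) 2
  simp only [Matrix.mul_apply, Fin.sum_univ_four] at hentry
  simpa [stdI] using hentry

theorem ricciTwoForm_stdI_apply (h : IsKahlerCurvature 1 stdI R) (a b : Fin 4) :
    ricciTwoForm stdI R a b = 2 * (R a b 0 1 + R a b 2 3) := by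
  have h10 := h.apply_skew a b 1 0
  have h32 := h.apply_skew a b 3 2
  simp only [ricciTwoForm, Matrix.of_apply, Matrix.trace, Matrix.diag, Matrix.mul_apply,
    Fin.sum_univ_four]
  simp only [stdI, Matrix.of_apply, Matrix.cons_val', Matrix.cons_val_zero, Matrix.cons_val_one,
    Matrix.cons_val, h10, h32]
  ring

theorem ricciTwoForm_stdI_zero_two (h : IsKahlerCurvature 1 stdI R) :
    ricciTwoForm stdI R 0 2 = ricciTwoForm stdI R 1 3 := by
  rw [h.ricciTwoForm_stdI_apply, h.ricciTwoForm_stdI_apply, h.pair_symm 0 2, h.pair_symm 0 2,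
    h.pair_symm 1 3, h.pair_symm 1 3, h.apply_zero_two, h.apply_zero_two]

theorem ricciTwoForm_stdI_zero_three (h : IsKahlerCurvature 1 stdI R) :
    ricciTwoForm stdI R 0 3 = -ricciTwoForm stdI R 1 2 := by
  rw [h.ricciTwoForm_stdI_apply, h.ricciTwoForm_stdI_apply, h.pair_symm 0 3, h.pair_symm 0 3,
    h.pair_symm 1 2, h.pair_symm 1 2, h.apply_zero_three, h.apply_zero_three]
  ring

theorem scalar_stdI (h : IsKahlerCurvature 1 stdI R) :
    ∑ a, ∑ c, R a c a c = ricciTwoForm stdI R 0 1 + ricciTwoForm stdI R 2 3 := by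
  have hdiag (a c) : R a a a c = 0 := by linarith [h.apply_antisymm a a a c]
  have hswap (a c) : R a c a c = R c a c a := by rw [h.apply_antisymm, h.apply_skew, neg_neg]
  have hbianchi := h.bianchi 0 1 2 3
  rw [h.ricciTwoForm_stdI_apply, h.ricciTwoForm_stdI_apply]
  simp only [Fin.sum_univ_four, hdiag]
  have := h.apply_skew 0 1 3 2
  have := h.pair_symm 2 3 0 1
  have := h.pair_symm 0 2 1 3
  have := h.pair_symm 0 3 1 2
  have := h.apply_zero_two 0 2
  have := h.apply_zero_two 1 3
  have := h.apply_zero_three 0 3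
  have := h.apply_zero_three 1 2
  have := h.apply_skew 1 2 3 0
  have := h.pair_symm 1 2 0 3
  have := h.apply_antisymm 2 0 3 1
  have := h.apply_skew 0 2 3 1
  linarith [hswap 1 0, hswap 2 0, hswap 3 0, hswap 2 1, hswap 3 1, hswap 3 2]

theorem frame_ricciTwoForm (h : IsKahlerCurvature g j R) {E : Mat} (hE : Eᵀ * g * E = 1)
    (hj : j * E = E * stdI) :
    (Eᵀ * ricciTwoForm j R * E) 0 2 = (Eᵀ * ricciTwoForm j R * E) 1 3 ∧
    (Eᵀ * ricciTwoForm j R * E) 0 3 = -(Eᵀ * ricciTwoForm j R * E) 1 2 ∧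
    scalarOf g R = (Eᵀ * ricciTwoForm j R * E) 0 1 + (Eᵀ * ricciTwoForm j R * E) 2 3 := by
  have hEF : E * (Eᵀ * g) = 1 := mul_eq_one_comm.1 hE
  have hj' := (frame_mul_intertwine hE hEF hj).symm
  have hpull := h.pullCurv hEF hj' hE
  rw [scalarOf_eq_sum_pullCurv hE, hpull.scalar_stdI, ← ricciTwoForm_pullCurv hj' hEF]
  exact ⟨hpull.ricciTwoForm_stdI_zero_two, hpull.ricciTwoForm_stdI_zero_three, rfl⟩

theorem wedge_ricciTwoForm_of_antilinear (h : IsKahlerCurvature g j R)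
    (hg : IsHermitianPair g j) (hk : IsSkewAntilinear g j k) :
    wedgeTwoTwo (ricciTwoForm j R) (kᵀ * g) = 0 := by
  obtain ⟨E, hE, hj⟩ := hg.exists_frame
  have hdet : E.det ≠ 0 := Matrix.det_ne_zero_of_left_inverse hE
  obtain ⟨h02, h03, -⟩ := h.frame_ricciTwoForm hE hj
  obtain ⟨x, y, hkE⟩ := hk.exists_frame_coeff hg.symm hE hj
  have hpull := wedgeTwoTwo_pullback E h.ricciTwoForm_skew
    (transpose_mul_skew_of_isSkewAdjoint hg.symm hk.skew)
  rw [frame_pullback_form hE hkE] at hpull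
  refine (mul_eq_zero.1 (hpull.symm.trans ?_)).resolve_left hdet
  simp [wedgeTwoTwo, h02, h03, stdI, stdJ, Matrix.mul_apply, Fin.sum_univ_four]
  ring

theorem wedge_ricciTwoForm_self_ne_zero (h : IsKahlerCurvature g j R)
    (hg : IsHermitianPair g j) (hscalar : scalarOf g R ≠ 0) :
    wedgeTwoTwo (ricciTwoForm j R) (jᵀ * g) ≠ 0 := by
  intro hwedge
  obtain ⟨E, hE, hj⟩ := hg.exists_frame
  obtain ⟨-, -, htrace⟩ := h.frame_ricciTwoForm hE hj
  have hpull := wedgeTwoTwo_pullback E h.ricciTwoForm_skew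
    (transpose_mul_skew_of_isSkewAdjoint hg.symm hg.skew)
  rw [hwedge, mul_zero, frame_pullback_form hE hj] at hpull
  simp only [wedgeTwoTwo, stdI, Matrix.transpose_apply] at hpull
  simp at hpull
  exact hscalar (by linarith)

end IsKahlerCurvature

end StandardFrame

/-! ### Almost Hermitian structures of class `AH₁` on open subsets of `ℝ⁴` -/

/-- A smooth almost Hermitian structure on an open subset of `ℝ⁴` whose curvature endomorphisms
commute with the almost complex structure. -/
structure IsAHOneOn (U : Set E4) (G J : E4 → Mat) : Prop where
  isOpen : IsOpen U
  smooth_metric : SmoothMat U G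
  smooth_acs : SmoothMat U J
  herm : ∀ y ∈ U, IsHermitianPair (G y) (J y)
  comm : ∀ y ∈ U, ∀ i j,
    curvMat (leviCivita G) i j y * J y = J y * curvMat (leviCivita G) i j y

/-- The 2-form `tr (J ∇_i J ∇_j J)`. -/
def torForm (G J : E4 → Mat) (y : E4) : Mat :=
  Matrix.of fun i j => (J y * covD (leviCivita G) i J y * covD (leviCivita G) j J y).trace

/-- The 2-form `tr (J R_{ij})` of the Levi-Civita curvature, a multiple of the Ricci form. -/
def ricciForm (G J : E4 → Mat) (y : E4) : Mat :=
  ricciTwoForm (J y) fun a b => curvMat (leviCivita G) a b y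

/-- The fundamental 2-form `g(J ·, ·)`. -/
def fundForm (G J : E4 → Mat) (y : E4) : Mat := (J y)ᵀ * G y

/-- The 2-form `g(J (∇_i J) ·, ·)`. -/
def twistForm (G J : E4 → Mat) (i : Fin 4) (y : E4) : Mat :=
  (J y * covD (leviCivita G) i J y)ᵀ * G y

/-- The 3-form obtained by alternating `g(J (∇_i J) ·, ·)`. -/
def torThreeForm (G J : E4 → Mat) (y : E4) (i j k : Fin 4) : ℝ :=
  twistForm G J i y j k + twistForm G J j y k i + twistForm G J k y i j

/-- The exterior derivative of a 3-form, as the coefficient of the coordinate volume form. -/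
def extDerivThree (ψ : E4 → Fin 4 → Fin 4 → Fin 4 → ℝ) (y : E4) : ℝ :=
  pderiv 0 (fun z => ψ z 1 2 3) y - pderiv 1 (fun z => ψ z 0 2 3) y
    + pderiv 2 (fun z => ψ z 0 1 3) y - pderiv 3 (fun z => ψ z 0 1 2) y

/-- The density `ρ ∧ ω` of the Ricci form. -/
def ricciDensity (G J : E4 → Mat) (y : E4) : ℝ :=
  wedgeTwoTwo (ricciForm G J y) (fundForm G J y)

/-- The ratio of `torForm` and `ricciForm`, which are proportional in class `AH₁`. It is meaningful
only where `ricciDensity` does not vanish. -/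
def torRatio (G J : E4 → Mat) (y : E4) : ℝ :=
  wedgeTwoTwo (torForm G J y) (fundForm G J y) / ricciDensity G J y

theorem IsMetricOn.isSkewAdjoint_covD {U : Set E4} {G M : E4 → Mat} {y : E4}
    (h : IsMetricOn U G) (hM : SmoothMat U M) (hskew : ∀ z ∈ U, (G z).IsSkewAdjoint (M z))
    (hy : y ∈ U) (i : Fin 4) : (G y).IsSkewAdjoint (covD (leviCivita G) i M y) := by
  have hderiv : pderivMat i (fun z => (M z)ᵀ * G z) y = pderivMat i (fun z => -(G z * M z)) y :=
    pderivMat_congr_of_isOpen h.isOpen (fun z hz => isSkewAdjoint_iff.1 (hskew z hz)) hy i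
  rw [pderivMat_mul hM.transpose h.smooth hy, pderivMat_neg, pderivMat_mul h.smooth hM hy,
    pderivMat_transpose, h.pderivMat_eq hy i] at hderiv
  have hy_skew := isSkewAdjoint_iff.1 (hskew y hy)
  rw [isSkewAdjoint_iff, covD, Matrix.transpose_sub, Matrix.transpose_add, Matrix.transpose_mul,
    Matrix.transpose_mul]
  linear_combination (norm := noncomm_ring)
    hderiv - (leviCivita G i y)ᵀ * hy_skew - hy_skew * leviCivita G i y

theorem IsMetricOn.pderivMat_transpose_mul {U : Set E4} {G M : E4 → Mat} {y : E4}
    (h : IsMetricOn U G) (hM : SmoothMat U M) (hy : y ∈ U) (i : Fin 4) :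
    pderivMat i (fun z => (M z)ᵀ * G z) y = (covD (leviCivita G) i M y)ᵀ * G y +
      (leviCivita G i y)ᵀ * ((M y)ᵀ * G y) + (M y)ᵀ * G y * leviCivita G i y := by
  rw [pderivMat_mul hM.transpose h.smooth hy, pderivMat_transpose, h.pderivMat_eq hy, covD]
  simp only [Matrix.transpose_add, Matrix.transpose_sub, Matrix.transpose_mul]
  noncomm_ring

theorem IsMetricOn.transpose_leviCivita_mul_symm {U : Set E4} {G : E4 → Mat} {y : E4}
    (h : IsMetricOn U G) (hy : y ∈ U) (η : Mat) (i j k : Fin 4) :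
    ((leviCivita G i y)ᵀ * η) j k = ((leviCivita G j y)ᵀ * η) i k := by
  simp only [Matrix.mul_apply, Matrix.transpose_apply]
  exact Finset.sum_congr rfl fun m _ => by rw [h.leviCivita_symm hy]

theorem IsMetricOn.extDerivTwo_transpose_mul {U : Set E4} {G M : E4 → Mat} {y : E4}
    (h : IsMetricOn U G) (hM : SmoothMat U M) (hy : y ∈ U) (hskew : (G y).IsSkewAdjoint (M y))
    (i j k : Fin 4) : extDerivTwo (fun z => (M z)ᵀ * G z) i j k y =
      ((covD (leviCivita G) i M y)ᵀ * G y) j k + ((covD (leviCivita G) j M y)ᵀ * G y) k i +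
        ((covD (leviCivita G) k M y)ᵀ * G y) i j := by
  have hform := transpose_mul_skew_of_isSkewAdjoint (h.symm y hy) hskew
  have hd (i j k : Fin 4) : pderiv i (fun z => ((M z)ᵀ * G z) j k) y =
      ((covD (leviCivita G) i M y)ᵀ * G y) j k +
        ((leviCivita G i y)ᵀ * ((M y)ᵀ * G y)) j k -
        ((leviCivita G i y)ᵀ * ((M y)ᵀ * G y)) k j := by
    refine (congrFun (congrFun (h.pderivMat_transpose_mul hM hy i) j) k).trans ?_
    rw [Matrix.add_apply, Matrix.add_apply, mul_apply_of_skew hform]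
    ring
  have hsymm := h.transpose_leviCivita_mul_symm hy ((M y)ᵀ * G y)
  rw [extDerivTwo, hd, hd, hd, hsymm j i k, hsymm k i j, hsymm k j i]
  ring

theorem ricciForm_skew (G J : E4 → Mat) (y : E4) : (ricciForm G J y)ᵀ = -ricciForm G J y := by
  ext a b
  simp [ricciForm, ricciTwoForm, curvMat_antisymm b a]

namespace IsAHOneOn

variable {U : Set E4} {G J : E4 → Mat} {y : E4}

theorem isMetricOn (h : IsAHOneOn U G J) : IsMetricOn U G where
  isOpen := h.isOpen
  smooth := h.smooth_metric
  symm y hy := (h.herm y hy).symm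
  det_ne y hy := (h.herm y hy).det_ne

theorem smooth_curvMat (h : IsAHOneOn U G J) (i j : Fin 4) :
    SmoothMat U (curvMat (leviCivita G) i j) :=
  SmoothMat.curvMat h.isMetricOn.smooth_leviCivita i j

theorem smooth_covD (h : IsAHOneOn U G J) (i : Fin 4) : SmoothMat U (covD (leviCivita G) i J) :=
  SmoothMat.covD h.isMetricOn.smooth_leviCivita h.smooth_acs i

theorem isSkewAntilinear_covD (h : IsAHOneOn U G J) (hy : y ∈ U) (i : Fin 4) :
    IsSkewAntilinear (G y) (J y) (covD (leviCivita G) i J y) where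
  skew := h.isMetricOn.isSkewAdjoint_covD h.smooth_acs (fun z hz => (h.herm z hz).skew) hy i
  anti := by
    have hsq : covD (leviCivita G) i (fun z => J z * J z) y =
        covD (leviCivita G) i (fun _ => -1) y :=
      covD_congr h.isOpen (fun z hz => (h.herm z hz).sq) hy i
    rw [covD_mul h.smooth_acs h.smooth_acs hy] at hsq
    have hconst : covD (leviCivita G) i (fun _ => (-1 : Mat)) y = 0 := by
      simp [covD, pderivMat_const]
    exact eq_neg_of_add_eq_zero_left (hsq.trans hconst)

theorem covD_covD_symm (h : IsAHOneOn U G J) (hy : y ∈ U) (i j : Fin 4) :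
    covD (leviCivita G) i (covD (leviCivita G) j J) y =
      covD (leviCivita G) j (covD (leviCivita G) i J) y := by
  rw [← sub_eq_zero, ricci_identity h.isMetricOn.smooth_leviCivita h.smooth_acs hy, h.comm y hy,
    sub_self]

theorem isKahlerCurvature (h : IsAHOneOn U G J) (hy : y ∈ U) :
    IsKahlerCurvature (G y) (J y) fun a b => curvMat (leviCivita G) a b y where
  antisymm a b := curvMat_antisymm a b y
  skew a b := isSkewAdjoint_iff.2 (eq_neg_of_add_eq_zero_left (h.isMetricOn.curvMat_skew hy a b))
  bianchi := first_bianchi h.isOpen (fun _ hz => h.isMetricOn.leviCivita_symm hz) hy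
  comm := h.comm y hy

theorem covD_covD_covD_sub (h : IsAHOneOn U G J) (hy : y ∈ U) (i j k : Fin 4) :
    covD (leviCivita G) i (covD (leviCivita G) j (covD (leviCivita G) k J)) y -
      covD (leviCivita G) j (covD (leviCivita G) i (covD (leviCivita G) k J)) y =
      (-(1 / 2 : ℝ) * ricciForm G J y i j) • (J y * covD (leviCivita G) k J y) := by
  rw [ricci_identity h.isMetricOn.smooth_leviCivita (h.smooth_covD k) hy,
    (h.isSkewAntilinear_covD hy k).commutator_eq_of_commute (h.herm y hy)
      ((h.isKahlerCurvature hy).skew i j) (h.comm y hy i j)]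
  rfl

/-- This expresses `ρ ∧ ∇J = 0`: alternating the commutators of `∇` on `∇J` gives zero because
`∇∇J` is symmetric. -/
theorem ricciForm_smul_covD_cyclic (h : IsAHOneOn U G J) (hy : y ∈ U) (i j k : Fin 4) :
    ricciForm G J y i j • covD (leviCivita G) k J y +
      ricciForm G J y j k • covD (leviCivita G) i J y +
      ricciForm G J y k i • covD (leviCivita G) j J y = 0 := by
  have hsymm (i j k : Fin 4) :
      covD (leviCivita G) i (covD (leviCivita G) j (covD (leviCivita G) k J)) y =
        covD (leviCivita G) i (covD (leviCivita G) k (covD (leviCivita G) j J)) y :=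
    covD_congr h.isOpen (fun z hz => h.covD_covD_symm hz j k) hy i
  have hsum : (-(1 / 2 : ℝ) * ricciForm G J y i j) • (J y * covD (leviCivita G) k J y) +
      (-(1 / 2 : ℝ) * ricciForm G J y j k) • (J y * covD (leviCivita G) i J y) +
      (-(1 / 2 : ℝ) * ricciForm G J y k i) • (J y * covD (leviCivita G) j J y) = 0 := by
    rw [← h.covD_covD_covD_sub hy, ← h.covD_covD_covD_sub hy, ← h.covD_covD_covD_sub hy,
      hsymm i j k, hsymm j k i, hsymm k i j]
    abel
  have hJ (M : Mat) : J y * (J y * M) = -M := by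
    rw [← Matrix.mul_assoc, (h.herm y hy).sq, neg_one_mul]
  have := congrArg (fun M => (2 : ℝ) • (J y * M)) hsum
  simp only [Matrix.mul_add, Matrix.mul_smul, hJ, Matrix.mul_zero, smul_zero] at this
  rw [← this]
  module

theorem wedgeOneTwoAt_covD_ricciForm (h : IsAHOneOn U G J) (hy : y ∈ U) (a b : Fin 4) :
    wedgeOneTwoAt (fun m => covD (leviCivita G) m J y a b) (ricciForm G J y) = 0 := by
  funext i j k
  have := congrFun (congrFun (h.ricciForm_smul_covD_cyclic hy i j k) a) b
  simp only [Matrix.add_apply, Matrix.smul_apply, smul_eq_mul, Matrix.zero_apply] at this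
  simp only [wedgeOneTwoAt, Pi.zero_apply]
  linarith

theorem torForm_skew (h : IsAHOneOn U G J) (hy : y ∈ U) :
    (torForm G J y)ᵀ = -torForm G J y := by
  ext a b
  simp only [torForm, Matrix.transpose_apply, Matrix.of_apply, Matrix.neg_apply]
  rw [Matrix.trace_mul_comm, ← Matrix.mul_assoc, (h.isSkewAntilinear_covD hy a).anti,
    Matrix.neg_mul, Matrix.trace_neg]

theorem two_mul_torForm_apply (h : IsAHOneOn U G J) (hy : y ∈ U) (i j : Fin 4) :
    2 * torForm G J y i j = ∑ a, ∑ b, ∑ c, J y a b *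
      (covD (leviCivita G) i J y b c * covD (leviCivita G) j J y c a -
        covD (leviCivita G) j J y b c * covD (leviCivita G) i J y c a) := by
  have htrace (i j : Fin 4) : torForm G J y i j = ∑ a, ∑ b, ∑ c, J y a b *
      (covD (leviCivita G) i J y b c * covD (leviCivita G) j J y c a) := by
    simp only [torForm, Matrix.of_apply, Matrix.trace, Matrix.diag, Matrix.mul_assoc,
      Matrix.mul_apply (M := J y), Matrix.mul_apply (M := covD (leviCivita G) i J y),
      Finset.mul_sum]
  simp only [mul_sub, Finset.sum_sub_distrib, ← htrace]
  linarith [apply_eq_neg_of_skew (h.torForm_skew hy) i j]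

theorem torForm_mul_ricciForm (h : IsAHOneOn U G J) (hy : y ∈ U) (i j k l : Fin 4) :
    torForm G J y i j * ricciForm G J y k l = torForm G J y k l * ricciForm G J y i j := by
  suffices 2 * torForm G J y i j * ricciForm G J y k l =
      2 * torForm G J y k l * ricciForm G J y i j by linarith
  rw [h.two_mul_torForm_apply hy, h.two_mul_torForm_apply hy]
  simp only [Finset.sum_mul]
  refine Finset.sum_congr rfl fun a _ => Finset.sum_congr rfl fun b _ =>
    Finset.sum_congr rfl fun c _ => ?_
  rw [mul_assoc, mul_assoc]
  congr 1
  exact cross_mul_comm_of_wedgeOneTwoAt_eq_zero (ricciForm_skew G J y)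
    (h.wedgeOneTwoAt_covD_ricciForm hy b c) (h.wedgeOneTwoAt_covD_ricciForm hy c a) i j k l

theorem trace_covD_mul_of_commute (h : IsAHOneOn U G J) (hy : y ∈ U) {r : Mat}
    (hr : r * J y = J y * r) (i : Fin 4) : (covD (leviCivita G) i J y * r).trace = 0 := by
  refine (h.herm y hy).trace_eq_zero_of_anticommute ?_
  rw [Matrix.mul_assoc, hr, ← Matrix.mul_assoc, (h.isSkewAntilinear_covD hy i).anti,
    Matrix.neg_mul, Matrix.mul_assoc]

theorem pderiv_ricciForm (h : IsAHOneOn U G J) (hy : y ∈ U) (i j k : Fin 4) :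
    pderiv i (fun z => ricciForm G J z j k) y =
      (J y * covD (leviCivita G) i (curvMat (leviCivita G) j k) y).trace := by
  have htrace := pderiv_trace_eq_trace_covD (Γ := leviCivita G)
    (h.smooth_acs.mul (h.smooth_curvMat j k)) hy i
  rwa [covD_mul h.smooth_acs (h.smooth_curvMat j k) hy, Matrix.trace_add,
    h.trace_covD_mul_of_commute hy (h.comm y hy j k), zero_add] at htrace

theorem extDerivTwo_ricciForm (h : IsAHOneOn U G J) (hy : y ∈ U) (i j k : Fin 4) :
    extDerivTwo (ricciForm G J) i j k y = 0 := by
  rw [extDerivTwo, h.pderiv_ricciForm hy, h.pderiv_ricciForm hy, h.pderiv_ricciForm hy,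
    ← Matrix.trace_add, ← Matrix.trace_add, ← Matrix.mul_add, ← Matrix.mul_add,
    second_bianchi h.isMetricOn.smooth_leviCivita hy, Matrix.mul_zero, Matrix.trace_zero]

theorem pderiv_torForm (h : IsAHOneOn U G J) (hy : y ∈ U) (i j k : Fin 4) :
    pderiv i (fun z => torForm G J z j k) y =
      (J y * covD (leviCivita G) i (covD (leviCivita G) j J) y *
        covD (leviCivita G) k J y).trace +
      (J y * covD (leviCivita G) j J y *
        covD (leviCivita G) i (covD (leviCivita G) k J) y).trace := by
  have hj := h.smooth_covD j
  have hk := h.smooth_covD k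
  have hcubic : (covD (leviCivita G) i J y * covD (leviCivita G) j J y *
      covD (leviCivita G) k J y).trace = 0 := by
    rw [Matrix.mul_assoc]
    refine h.trace_covD_mul_of_commute hy ?_ i
    rw [Matrix.mul_assoc, (h.isSkewAntilinear_covD hy k).anti, Matrix.mul_neg, ← Matrix.mul_assoc,
      (h.isSkewAntilinear_covD hy j).anti, Matrix.neg_mul, neg_neg, Matrix.mul_assoc]
  have htrace := pderiv_trace_eq_trace_covD (Γ := leviCivita G)
    ((h.smooth_acs.mul hj).mul hk) hy i
  rwa [covD_mul (h.smooth_acs.mul hj) hk hy, covD_mul h.smooth_acs hj hy, Matrix.add_mul,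
    Matrix.trace_add, Matrix.trace_add, hcubic, zero_add] at htrace

theorem extDerivTwo_torForm (h : IsAHOneOn U G J) (hy : y ∈ U) (i j k : Fin 4) :
    extDerivTwo (torForm G J) i j k y = 0 := by
  have hswap (S : Mat) (k : Fin 4) : (J y * S * covD (leviCivita G) k J y).trace =
      -(J y * covD (leviCivita G) k J y * S).trace := by
    rw [Matrix.trace_mul_comm, ← Matrix.mul_assoc, (h.isSkewAntilinear_covD hy k).anti,
      Matrix.neg_mul, Matrix.trace_neg]
  rw [extDerivTwo, h.pderiv_torForm hy, h.pderiv_torForm hy, h.pderiv_torForm hy, hswap, hswap,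
    hswap, h.covD_covD_symm hy i k, h.covD_covD_symm hy j i, h.covD_covD_symm hy k j]
  ring

theorem smooth_torForm (h : IsAHOneOn U G J) : SmoothMat U (torForm G J) := fun i j _ hy =>
  ((h.smooth_acs.mul (h.smooth_covD i)).mul (h.smooth_covD j)).trace hy

theorem smooth_ricciForm (h : IsAHOneOn U G J) : SmoothMat U (ricciForm G J) := fun i j _ hy =>
  (h.smooth_acs.mul (h.smooth_curvMat i j)).trace hy

theorem smooth_fundForm (h : IsAHOneOn U G J) : SmoothMat U (fundForm G J) :=
  h.smooth_acs.transpose.mul h.smooth_metric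

theorem smooth_twistForm (h : IsAHOneOn U G J) (i : Fin 4) : SmoothMat U (twistForm G J i) :=
  (h.smooth_acs.mul (h.smooth_covD i)).transpose.mul h.smooth_metric

theorem fundForm_skew (h : IsAHOneOn U G J) (hy : y ∈ U) :
    (fundForm G J y)ᵀ = -fundForm G J y :=
  transpose_mul_skew_of_isSkewAdjoint (h.herm y hy).symm (h.herm y hy).skew

theorem twistForm_skew (h : IsAHOneOn U G J) (hy : y ∈ U) (i : Fin 4) :
    (twistForm G J i y)ᵀ = -twistForm G J i y :=
  transpose_mul_skew_of_isSkewAdjoint (h.herm y hy).symm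
    ((h.isSkewAntilinear_covD hy i).mul_left (h.herm y hy)).skew

theorem isAltThree_torThreeForm (h : IsAHOneOn U G J) (hy : y ∈ U) :
    IsAltThree (torThreeForm G J y) where
  swap i j k := by
    simp only [torThreeForm]
    rw [apply_eq_neg_of_skew (h.twistForm_skew hy j) i k,
      apply_eq_neg_of_skew (h.twistForm_skew hy i) k j,
      apply_eq_neg_of_skew (h.twistForm_skew hy k) j i]
    ring
  rot i j k := by
    simp only [torThreeForm]
    ring

theorem smooth_torThreeForm (h : IsAHOneOn U G J) (hy : y ∈ U) (i j k : Fin 4) :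
    ContDiffAt ℝ ∞ (fun z => torThreeForm G J z i j k) y :=
  ((h.smooth_twistForm i j k y hy).add (h.smooth_twistForm j k i y hy)).add
    (h.smooth_twistForm k i j y hy)

theorem pderiv_torThreeForm (h : IsAHOneOn U G J) (hy : y ∈ U) (l i j k : Fin 4) :
    pderiv l (fun z => torThreeForm G J z i j k) y = pderivMat l (twistForm G J i) y j k +
      pderivMat l (twistForm G J j) y k i + pderivMat l (twistForm G J k) y i j := by
  have hi := (h.smooth_twistForm i).differentiableAt hy j k
  have hj := (h.smooth_twistForm j).differentiableAt hy k i
  have hk := (h.smooth_twistForm k).differentiableAt hy i j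
  simp only [torThreeForm]
  rw [pderiv_add (hi.fun_add hj) hk, pderiv_add hi hj]
  rfl

theorem pderivMat_twistForm (h : IsAHOneOn U G J) (hy : y ∈ U) (l i : Fin 4) :
    pderivMat l (twistForm G J i) y =
      (covD (leviCivita G) l J y * covD (leviCivita G) i J y)ᵀ * G y +
      (J y * covD (leviCivita G) l (covD (leviCivita G) i J) y)ᵀ * G y +
      (leviCivita G l y)ᵀ * twistForm G J i y + twistForm G J i y * leviCivita G l y := by
  refine (h.isMetricOn.pderivMat_transpose_mul (h.smooth_acs.mul (h.smooth_covD i)) hy l).trans ?_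
  rw [covD_mul h.smooth_acs (h.smooth_covD i) hy, Matrix.transpose_add, Matrix.add_mul]
  rfl

theorem pderivMat_twistForm_skew (h : IsAHOneOn U G J) (hy : y ∈ U) (l i j k : Fin 4) :
    pderivMat l (twistForm G J i) y j k = -pderivMat l (twistForm G J i) y k j := by
  have hderiv : pderivMat l (fun z => (twistForm G J i z)ᵀ) y =
      pderivMat l (fun z => -twistForm G J i z) y :=
    pderivMat_congr_of_isOpen h.isOpen (fun z hz => h.twistForm_skew hz i) hy l
  rw [pderivMat_neg, pderivMat_transpose] at hderiv
  exact apply_eq_neg_of_skew hderiv j k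

theorem covD_mul_covD_form_sub (h : IsAHOneOn U G J) (hy : y ∈ U) (l i j k : Fin 4) :
    ((covD (leviCivita G) l J y * covD (leviCivita G) i J y)ᵀ * G y) j k -
      ((covD (leviCivita G) i J y * covD (leviCivita G) l J y)ᵀ * G y) j k =
      -(1 / 2 : ℝ) * (torForm G J y l i * fundForm G J y j k) := by
  rw [← Matrix.sub_apply, ← Matrix.sub_mul, ← Matrix.transpose_sub,
    (h.isSkewAntilinear_covD hy l).commutator_eq (h.isSkewAntilinear_covD hy i) (h.herm y hy),
    Matrix.transpose_smul, Matrix.smul_mul, Matrix.smul_apply, smul_eq_mul, mul_assoc]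
  rfl

end IsAHOneOn

/-- The alternation over four indices of a family `T` of 2-forms kills the parts `Y` and `V`, which
are symmetric in two of the alternated indices. -/
theorem alternate_four (T W Y V : Fin 4 → Fin 4 → Fin 4 → Fin 4 → ℝ)
    (hskew : ∀ l i j k, T l i j k = -T l i k j)
    (hT : ∀ l i j k, T l i j k = W l i j k + Y l i j k + V l j i k - V l k i j)
    (hY : ∀ l i j k, Y l i j k = Y i l j k) (hV : ∀ l j i k, V l j i k = V j l i k) :
    (T 0 1 2 3 + T 0 2 3 1 + T 0 3 1 2) - (T 1 0 2 3 + T 1 2 3 0 + T 1 3 0 2) +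
      (T 2 0 1 3 + T 2 1 3 0 + T 2 3 0 1) - (T 3 0 1 2 + T 3 1 2 0 + T 3 2 0 1) =
    (W 0 1 2 3 - W 1 0 2 3) - (W 0 2 1 3 - W 2 0 1 3) + (W 0 3 1 2 - W 3 0 1 2) +
      (W 1 2 0 3 - W 2 1 0 3) - (W 1 3 0 2 - W 3 1 0 2) + (W 2 3 0 1 - W 3 2 0 1) := by
  rw [hskew 0 2 3 1, hskew 1 2 3 0, hskew 1 3 0 2, hskew 2 1 3 0, hskew 3 1 2 0,
    ← neg_eq_iff_eq_neg.2 (hskew 1 3 0 2), neg_neg]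
  simp only [hT]
  rw [hY 1 0, hY 2 0, hY 3 0, hY 2 1, hY 3 1, hY 3 2]
  simp only [hV 1 0, hV 2 0, hV 3 0, hV 2 1, hV 3 1, hV 3 2]
  ring

namespace IsAHOneOn

variable {U : Set E4} {G J : E4 → Mat} {y : E4}

theorem extDerivThree_torThreeForm (h : IsAHOneOn U G J) (hy : y ∈ U) :
    extDerivThree (torThreeForm G J) y =
      -(1 / 2 : ℝ) * wedgeTwoTwo (torForm G J y) (fundForm G J y) := by
  have halt := alternate_four (fun l i j k => pderivMat l (twistForm G J i) y j k)
    (fun l i j k => ((covD (leviCivita G) l J y * covD (leviCivita G) i J y)ᵀ * G y) j k)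
    (fun l i j k => ((J y * covD (leviCivita G) l (covD (leviCivita G) i J) y)ᵀ * G y) j k)
    (fun l j i k => ((leviCivita G l y)ᵀ * twistForm G J i y) j k)
    (h.pderivMat_twistForm_skew hy)
    (fun l i j k => by
      simp only [h.pderivMat_twistForm hy, Matrix.add_apply,
        mul_apply_of_skew (h.twistForm_skew hy i)]
      ring)
    (fun l i j k => by simp only [h.covD_covD_symm hy l i])
    (fun l j i k => h.isMetricOn.transpose_leviCivita_mul_symm hy _ l j k)
  simp only [h.covD_mul_covD_form_sub hy] at halt
  rw [extDerivThree, h.pderiv_torThreeForm hy, h.pderiv_torThreeForm hy,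
    h.pderiv_torThreeForm hy, h.pderiv_torThreeForm hy, halt, wedgeTwoTwo]
  ring

theorem exists_cross_covD_eq_smul (h : IsAHOneOn U G J) (hy : y ∈ U)
    (hρ : ricciForm G J y ≠ 0) {x : Fin 4 → ℝ} (hx : wedgeOneTwoAt x (ricciForm G J y) = 0) :
    ∃ M, IsSkewAntilinear (G y) (J y) M ∧ ∀ i j, x i • covD (leviCivita G) j J y -
      x j • covD (leviCivita G) i J y = ricciForm G J y i j • M := by
  obtain ⟨p, q, hpq⟩ : ∃ p q, ricciForm G J y p q ≠ 0 := by
    by_contra! hzero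
    exact hρ (Matrix.ext hzero)
  have hK := h.isSkewAntilinear_covD hy
  refine ⟨(ricciForm G J y p q)⁻¹ • (x p • covD (leviCivita G) q J y -
    x q • covD (leviCivita G) p J y), (((hK q).smul _).sub ((hK p).smul _)).smul _,
    fun i j => ?_⟩
  ext a b
  have hcross := cross_mul_comm_of_wedgeOneTwoAt_eq_zero (ricciForm_skew G J y) hx
    (h.wedgeOneTwoAt_covD_ricciForm hy a b) i j p q
  simp only [Matrix.sub_apply, Matrix.smul_apply, smul_eq_mul]
  field_simp
  linear_combination hcross

theorem wedgeOneThree_torThreeForm (h : IsAHOneOn U G J) (hy : y ∈ U)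
    (hρ : ricciForm G J y ≠ 0) {x : Fin 4 → ℝ} (hx : wedgeOneTwoAt x (ricciForm G J y) = 0) :
    wedgeOneThree x (torThreeForm G J y) = 0 := by
  obtain ⟨M, hM, hcross⟩ := h.exists_cross_covD_eq_smul hy hρ hx
  have htwist (l i j k : Fin 4) : x l * twistForm G J i y j k - x i * twistForm G J l y j k =
      ricciForm G J y l i * ((J y * M)ᵀ * G y) j k := by
    have := congrFun (congrFun (congrArg (fun A : Mat => (J y * A)ᵀ * G y) (hcross l i)) j) k
    simpa only [twistForm, Matrix.mul_sub, Matrix.mul_smul, Matrix.transpose_sub,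
      Matrix.transpose_smul, Matrix.sub_mul, Matrix.smul_mul, Matrix.sub_apply, Matrix.smul_apply,
      smul_eq_mul] using this
  have hskew (i) := apply_eq_neg_of_skew (h.twistForm_skew hy i)
  calc wedgeOneThree x (torThreeForm G J y)
      = wedgeTwoTwo (ricciForm G J y) ((J y * M)ᵀ * G y) := by
        simp only [wedgeOneThree, torThreeForm, wedgeTwoTwo, ← htwist]
        rw [hskew 2 3 1, hskew 2 3 0, hskew 1 3 0, hskew 1 2 0]
        ring
    _ = 0 := (h.isKahlerCurvature hy).wedge_ricciTwoForm_of_antilinear (h.herm y hy)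
        (hM.mul_left (h.herm y hy))

theorem ricciDensity_ne_zero (h : IsAHOneOn U G J) (hy : y ∈ U)
    (hscalar : scalarCurvature G y ≠ 0) : ricciDensity G J y ≠ 0 := by
  refine (h.isKahlerCurvature hy).wedge_ricciTwoForm_self_ne_zero (h.herm y hy) ?_
  simpa only [scalarOf, scalarCurvature, ricci, curvature_eq_curvMat] using hscalar

theorem smooth_ricciDensity (h : IsAHOneOn U G J) (hy : y ∈ U) :
    ContDiffAt ℝ ∞ (ricciDensity G J) y :=
  h.smooth_ricciForm.wedgeTwoTwo h.smooth_fundForm hy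

theorem smooth_torRatio (h : IsAHOneOn U G J) (hy : y ∈ U) (hρ : ricciDensity G J y ≠ 0) :
    ContDiffAt ℝ ∞ (torRatio G J) y :=
  (h.smooth_torForm.wedgeTwoTwo h.smooth_fundForm hy).div (h.smooth_ricciDensity hy) hρ

theorem torForm_eq_torRatio_mul (h : IsAHOneOn U G J) (hy : y ∈ U)
    (hρ : ricciDensity G J y ≠ 0) (i j : Fin 4) :
    torForm G J y i j = torRatio G J y * ricciForm G J y i j := by
  rw [torRatio, div_mul_eq_mul_div, eq_div_iff hρ]
  exact mul_wedgeTwoTwo_of_proportional (h.torForm_mul_ricciForm hy) _ i j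

theorem wedgeOneTwoAt_pderiv_torRatio (h : IsAHOneOn U G J)
    (hρ : ∀ z ∈ U, ricciDensity G J z ≠ 0) (hy : y ∈ U) :
    wedgeOneTwoAt (fun i => pderiv i (torRatio G J) y) (ricciForm G J y) = 0 := by
  have hratio := (h.smooth_torRatio hy (hρ y hy)).differentiableAt (by simp)
  have hprod (i j k : Fin 4) : pderiv i (fun z => torForm G J z j k) y =
      pderiv i (torRatio G J) y * ricciForm G J y j k +
      torRatio G J y * pderiv i (fun z => ricciForm G J z j k) y := by
    rw [pderiv_congr_of_isOpen h.isOpen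
      (fun z hz => h.torForm_eq_torRatio_mul hz (hρ z hz) j k) hy i]
    exact pderiv_mul hratio (h.smooth_ricciForm.differentiableAt hy j k) i
  funext i j k
  have hdT := h.extDerivTwo_torForm hy i j k
  have hdρ := h.extDerivTwo_ricciForm hy i j k
  rw [extDerivTwo] at hdT hdρ
  rw [hprod, hprod, hprod] at hdT
  simp only [wedgeOneTwoAt, Pi.zero_apply]
  linear_combination hdT - torRatio G J y * hdρ

theorem wedgeOneThree_pderiv_torRatio (h : IsAHOneOn U G J)
    (hρ : ∀ z ∈ U, ricciDensity G J z ≠ 0) (hy : y ∈ U) :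
    wedgeOneThree (fun i => pderiv i (torRatio G J) y) (torThreeForm G J y) = 0 := by
  refine h.wedgeOneThree_torThreeForm hy (fun hzero => hρ y hy ?_)
    (h.wedgeOneTwoAt_pderiv_torRatio hρ hy)
  simp [ricciDensity, wedgeTwoTwo, hzero]

theorem extDerivThree_torThreeForm_eq_torRatio (h : IsAHOneOn U G J) (hy : y ∈ U)
    (hρ : ricciDensity G J y ≠ 0) : extDerivThree (torThreeForm G J) y =
      -(1 / 2 : ℝ) * (torRatio G J y * ricciDensity G J y) := by
  rw [h.extDerivThree_torThreeForm hy, torRatio, div_mul_cancel₀ _ hρ]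

end IsAHOneOn

/-! ### Closed Lee forms -/

section LinearLeeForm

variable {g j n : Mat} {x a b : Fin 4 → ℝ}

theorem wedgeOneTwoAt_stdI_eq_stdJ_iff : wedgeOneTwoAt x stdIᵀ = wedgeOneTwoAt b stdJᵀ ↔
    x = ![b 3, b 2, -b 1, -b 0] := by
  refine ⟨fun h => ?_, fun h => ?_⟩
  · have h012 := congrFun (congrFun (congrFun h 0) 1) 2
    have h013 := congrFun (congrFun (congrFun h 0) 1) 3
    have h023 := congrFun (congrFun (congrFun h 0) 2) 3
    have h123 := congrFun (congrFun (congrFun h 1) 2) 3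
    simp [wedgeOneTwoAt, stdI, stdJ] at h012 h013 h023 h123
    ext i
    fin_cases i <;> simp [h012, h013, h023, h123]
  · subst h
    funext p q r
    fin_cases p <;> fin_cases q <;> fin_cases r <;> simp [wedgeOneTwoAt, stdI, stdJ]

theorem wedgeOneTwoAt_stdJ_eq_stdI_iff : wedgeOneTwoAt x stdJᵀ = wedgeOneTwoAt b stdIᵀ ↔
    x = ![-b 3, -b 2, b 1, b 0] := by
  rw [eq_comm, wedgeOneTwoAt_stdI_eq_stdJ_iff]
  constructor <;> rintro rfl <;> ext i <;> fin_cases i <;> simp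

theorem wedgeOneThree_stdI_stdJ (b : Fin 4 → ℝ) :
    wedgeOneThree ![b 3, b 2, -b 1, -b 0] (wedgeOneTwoAt b (stdI * stdJ)ᵀ) = b ⬝ᵥ b := by
  simp [wedgeOneThree, wedgeOneTwoAt, stdI, stdJ, Fin.sum_univ_four, dotProduct]
  ring

namespace IsQuaternionic

theorem eq_zero_of_smul_add_smul_eq_zero (hn : IsQuaternionic g j n) (h : IsHermitianPair g j)
    {c d : ℝ} (hcd : c • n + d • (j * n) = 0) : c = 0 ∧ d = 0 := by
  have hsq := hn.add_smul_mul_add_smul h c d c d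
  rw [hcd, Matrix.zero_mul] at hsq
  have h00 := congrArg Matrix.trace hsq
  rw [h.trace_smul_one_add_smul, Matrix.trace_zero] at h00
  constructor <;> nlinarith [sq_nonneg c, sq_nonneg d]

theorem exists_frame_forms (hn : IsQuaternionic g j n) (h : IsHermitianPair g j) :
    ∃ E F : Mat, E * F = 1 ∧ Eᵀ * (jᵀ * g) * E = stdIᵀ ∧ Eᵀ * (nᵀ * g) * E = stdJᵀ ∧
      Eᵀ * ((j * n)ᵀ * g) * E = (stdI * stdJ)ᵀ := by
  obtain ⟨E, hE, hj, hnE⟩ := hn.exists_frame h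
  refine ⟨E, Eᵀ * g, mul_eq_one_comm.1 hE, frame_pullback_form hE hj,
    frame_pullback_form hE hnE, frame_pullback_form hE ?_⟩
  rw [Matrix.mul_assoc, hnE, ← Matrix.mul_assoc, hj, Matrix.mul_assoc]

theorem wedgeOneTwoAt_rotate (hn : IsQuaternionic g j n) (h : IsHermitianPair g j)
    (hx : wedgeOneTwoAt x (jᵀ * g) = wedgeOneTwoAt b (nᵀ * g)) :
    wedgeOneTwoAt x (nᵀ * g) = wedgeOneTwoAt (-b) (jᵀ * g) := by
  obtain ⟨E, F, hEF, hj, hnE, -⟩ := hn.exists_frame_forms h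
  rw [← wedgeOneTwoAt_pullback_inj hEF, hj, hnE] at hx ⊢
  rw [wedgeOneTwoAt_stdI_eq_stdJ_iff] at hx
  rw [wedgeOneTwoAt_stdJ_eq_stdI_iff, hx]
  simp [Matrix.mulVec_neg]

theorem eq_zero_of_wedgeOneThree_eq_zero (hn : IsQuaternionic g j n) (h : IsHermitianPair g j)
    (hx : wedgeOneTwoAt x (jᵀ * g) = wedgeOneTwoAt b (nᵀ * g))
    (hwedge : wedgeOneThree x (wedgeOneTwoAt b ((j * n)ᵀ * g)) = 0) : b = 0 := by
  obtain ⟨E, F, hEF, hj, hnE, hjn⟩ := hn.exists_frame_forms h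
  rw [← wedgeOneTwoAt_pullback_inj hEF, hj, hnE, wedgeOneTwoAt_stdI_eq_stdJ_iff] at hx
  have hskew := transpose_mul_skew_of_isSkewAdjoint h.symm (hn.mul_left h).skew
  have hpull := wedgeOneThree_pullback E x (isAltThree_wedgeOneTwoAt b hskew)
  rw [hwedge, mul_zero, ← wedgeOneTwoAt_pullback, hjn, hx, wedgeOneThree_stdI_stdJ,
    dotProduct_self_eq_zero] at hpull
  have hFE : Fᵀ *ᵥ Eᵀ *ᵥ b = b := by
    rw [Matrix.mulVec_mulVec, ← Matrix.transpose_mul, hEF, Matrix.transpose_one,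
      Matrix.one_mulVec]
  rw [← hFE, hpull, Matrix.mulVec_zero]

end IsQuaternionic

end LinearLeeForm

section DecomposableTorsion

variable {U V : Set E4} {G J N : E4 → Mat} {β θ : E4 → Fin 4 → ℝ} {y : E4}

theorem extDerivThree_congr (hU : IsOpen U) {ψ φ : E4 → Fin 4 → Fin 4 → Fin 4 → ℝ}
    (h : ∀ z ∈ U, ψ z = φ z) (hy : y ∈ U) : extDerivThree ψ y = extDerivThree φ y := by
  have hpderiv (l i j k : Fin 4) :
      pderiv l (fun z => ψ z i j k) y = pderiv l (fun z => φ z i j k) y :=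
    pderiv_congr_of_isOpen hU (fun z hz => by rw [h z hz]) hy l
  simp only [extDerivThree, hpderiv]

theorem extDerivThree_wedgeOneTwoAt (hU : IsOpen U) {x : E4 → Fin 4 → ℝ} {η : E4 → Mat}
    (hx : ∀ i, DifferentiableAt ℝ (fun w => x w i) y) (hη : SmoothMat U η)
    (hskew : ∀ z ∈ U, (η z)ᵀ = -η z) (hy : y ∈ U) :
    extDerivThree (fun z => wedgeOneTwoAt (x z) (η z)) y =
      wedgeTwoTwo (Matrix.of fun i j => extDerivOne x i j y) (η y) -
        wedgeOneThree (x y) (fun i j k => extDerivTwo η i j k y) := by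
  have hprod (i j k : Fin 4) : DifferentiableAt ℝ (fun z => x z i * η z j k) y :=
    (hx i).fun_mul (hη.differentiableAt hy j k)
  have hleibniz (l i j k : Fin 4) : pderiv l (fun z => x z i * η z j k) y =
      pderiv l (fun z => x z i) y * η y j k + x y i * pderiv l (fun z => η z j k) y :=
    pderiv_mul (hx i) (hη.differentiableAt hy j k) l
  have hwedge (l i j k : Fin 4) : pderiv l (fun z => wedgeOneTwoAt (x z) (η z) i j k) y =
      pderiv l (fun z => x z i * η z j k) y + pderiv l (fun z => x z j * η z k i) y +
        pderiv l (fun z => x z k * η z i j) y := by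
    simp only [wedgeOneTwoAt]
    rw [pderiv_add ((hprod i j k).fun_add (hprod j k i)) (hprod k i j),
      pderiv_add (hprod i j k) (hprod j k i)]
  have hderiv (l i j : Fin 4) : pderiv l (fun z => η z i j) y = -pderiv l (fun z => η z j i) y := by
    rw [← pderiv_neg]
    exact pderiv_congr_of_isOpen hU (fun z hz => apply_eq_neg_of_skew (hskew z hz) i j) hy l
  have happly := apply_eq_neg_of_skew (hskew y hy)
  simp only [extDerivThree, hwedge, hleibniz, wedgeTwoTwo, wedgeOneThree, extDerivTwo,
    extDerivOne, Matrix.of_apply]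
  rw [happly 2 0, happly 3 0, happly 3 1]
  simp only [hderiv _ 2 0, hderiv _ 3 0, hderiv _ 3 1]
  ring

/-- `θ` is the Lee form of `(G, J)` on `U`, that is `dω = θ ∧ ω`, and it is closed. -/
structure IsClosedLeeFormOn (U : Set E4) (G J : E4 → Mat) (θ : E4 → Fin 4 → ℝ) : Prop where
  smooth : ∀ i, ∀ z ∈ U, ContDiffAt ℝ ∞ (fun w => θ w i) z
  closed : ∀ z ∈ U, ∀ i j, extDerivOne θ i j z = 0
  lee : ∀ z ∈ U, (fun i j k => extDerivTwo (fundForm G J) i j k z) =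
    wedgeOneTwoAt (θ z) (fundForm G J z)

theorem IsClosedLeeFormOn.mono (h : IsClosedLeeFormOn U G J θ) (hVU : V ⊆ U) :
    IsClosedLeeFormOn V G J θ where
  smooth i z hz := h.smooth i z (hVU hz)
  closed z hz := h.closed z (hVU hz)
  lee z hz := h.lee z (hVU hz)

theorem IsAHOneOn.mono (h : IsAHOneOn U G J) (hV : IsOpen V) (hVU : V ⊆ U) :
    IsAHOneOn V G J where
  isOpen := hV
  smooth_metric := h.smooth_metric.mono hVU
  smooth_acs := h.smooth_acs.mono hVU
  herm y hy := h.herm y (hVU hy)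
  comm y hy := h.comm y (hVU hy)

/-- `∇J = β ⊗ N` for a 1-form `β` and a field `N` of unit imaginary quaternions anticommuting with
`J`: the shape of `∇J` near a point where `∇J ≠ 0` but `torForm` vanishes. -/
structure IsDecomposableOn (U : Set E4) (G J N : E4 → Mat) (β : E4 → Fin 4 → ℝ) : Prop
    extends IsAHOneOn U G J where
  smooth_unit : SmoothMat U N
  smooth_coeff : ∀ i, ∀ z ∈ U, ContDiffAt ℝ ∞ (fun w => β w i) z
  quaternionic : ∀ z ∈ U, IsQuaternionic (G z) (J z) (N z)
  covD_acs : ∀ z ∈ U, ∀ i, covD (leviCivita G) i J z = β z i • N z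

/-- The 1-form `α` in `∇N = -β ⊗ J + α ⊗ JN`. -/
def rotForm (G J N : E4 → Mat) (y : E4) (i : Fin 4) : ℝ :=
  -(1 / 4 : ℝ) * (covD (leviCivita G) i N y * (J y * N y)).trace

namespace IsDecomposableOn

theorem smooth_unitForm (h : IsDecomposableOn U G J N β) : SmoothMat U fun z => (N z)ᵀ * G z :=
  h.smooth_unit.transpose.mul h.smooth_metric

theorem unitForm_skew (h : IsDecomposableOn U G J N β) (hy : y ∈ U) :
    ((N y)ᵀ * G y)ᵀ = -((N y)ᵀ * G y) :=
  transpose_mul_skew_of_isSkewAdjoint (h.herm y hy).symm (h.quaternionic y hy).skew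

theorem isSkewAntilinear_covD_add (h : IsDecomposableOn U G J N β) (hy : y ∈ U) (i : Fin 4) :
    IsSkewAntilinear (G y) (J y) (covD (leviCivita G) i N y + β y i • J y) where
  skew := by
    have hN := h.isMetricOn.isSkewAdjoint_covD h.smooth_unit
      (fun z hz => (h.quaternionic z hz).skew) hy i
    have hJ := (h.herm y hy).skew
    rw [isSkewAdjoint_iff] at hN hJ ⊢
    simp only [Matrix.transpose_add, Matrix.transpose_smul, Matrix.add_mul, Matrix.mul_add,
      Matrix.smul_mul, Matrix.mul_smul, hN, hJ, smul_neg, neg_add]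
  anti := by
    have hanti : covD (leviCivita G) i (fun z => N z * J z) y =
        covD (leviCivita G) i (fun z => -(J z * N z)) y :=
      covD_congr h.isOpen (fun z hz => (h.quaternionic z hz).anti) hy i
    rw [covD_neg, covD_mul h.smooth_unit h.smooth_acs hy, covD_mul h.smooth_acs h.smooth_unit hy,
      h.covD_acs y hy, Matrix.mul_smul, Matrix.smul_mul, (h.quaternionic y hy).sq] at hanti
    rw [Matrix.add_mul, Matrix.mul_add, Matrix.smul_mul, Matrix.mul_smul, (h.herm y hy).sq,
      hanti]
    abel

theorem trace_covD_unit_mul_self (h : IsDecomposableOn U G J N β) (hy : y ∈ U) (i : Fin 4) :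
    (covD (leviCivita G) i N y * N y).trace = 0 := by
  have hconst : pderiv i (fun z => (N z * N z).trace) y = pderiv i (fun _ => (-1 : Mat).trace) y :=
    pderiv_congr_of_isOpen h.isOpen (fun z hz => by rw [(h.quaternionic z hz).sq]) hy i
  rw [pderiv_const, pderiv_trace_eq_trace_covD (h.smooth_unit.mul h.smooth_unit) hy,
    covD_mul h.smooth_unit h.smooth_unit hy, Matrix.trace_add,
    Matrix.trace_mul_comm (N y)] at hconst
  linarith

theorem covD_unit (h : IsDecomposableOn U G J N β) (hy : y ∈ U) (i : Fin 4) :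
    covD (leviCivita G) i N y = -(β y i • J y) + rotForm G J N y i • (J y * N y) := by
  have hN := h.quaternionic y hy
  have hfirst : ((covD (leviCivita G) i N y + β y i • J y) * N y).trace = 0 := by
    rw [Matrix.add_mul, Matrix.trace_add, h.trace_covD_unit_mul_self hy, Matrix.smul_mul,
      Matrix.trace_smul, (h.herm y hy).trace_eq_zero_of_anticommute (hN.mul_left _).anti,
      smul_zero, add_zero]
    exact h.herm y hy
  have hsecond : ((covD (leviCivita G) i N y + β y i • J y) * (J y * N y)).trace =
      (covD (leviCivita G) i N y * (J y * N y)).trace := by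
    rw [Matrix.add_mul, Matrix.trace_add, Matrix.smul_mul, ← Matrix.mul_assoc (J y),
      (h.herm y hy).sq, neg_one_mul, Matrix.trace_smul, Matrix.trace_neg,
      (h.herm y hy).trace_eq_zero_of_anticommute hN.anti, neg_zero, smul_zero, add_zero]
  have hdecomp := hN.eq_trace_smul (h.herm y hy) (h.isSkewAntilinear_covD_add hy i)
  rw [hfirst, hsecond, mul_zero, zero_smul, zero_add] at hdecomp
  rw [rotForm, ← hdecomp]
  abel

theorem covD_covD_acs (h : IsDecomposableOn U G J N β) (hy : y ∈ U) (i j : Fin 4) :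
    covD (leviCivita G) i (covD (leviCivita G) j J) y = pderiv i (fun z => β z j) y • N y +
      β y j • (-(β y i • J y) + rotForm G J N y i • (J y * N y)) := by
  rw [covD_congr h.isOpen (fun z hz => h.covD_acs z hz j) hy i,
    covD_smul ((h.smooth_coeff j y hy).differentiableAt (by simp)) h.smooth_unit hy,
    h.covD_unit hy]

theorem extDerivOne_coeff_and_cross (h : IsDecomposableOn U G J N β) (hy : y ∈ U) (i j : Fin 4) :
    extDerivOne β i j y = 0 ∧ β y j * rotForm G J N y i - β y i * rotForm G J N y j = 0 := by
  have hsymm := h.covD_covD_symm hy i j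
  rw [h.covD_covD_acs hy, h.covD_covD_acs hy, ← sub_eq_zero] at hsymm
  refine (h.quaternionic y hy).eq_zero_of_smul_add_smul_eq_zero (h.herm y hy) ?_
  rw [← hsymm, extDerivOne]
  module

theorem rotForm_eq_smul (h : IsDecomposableOn U G J N β) (hβ : β y ≠ 0) (hy : y ∈ U) :
    ∃ t : ℝ, rotForm G J N y = t • β y := by
  obtain ⟨k, hk⟩ := Function.ne_iff.1 hβ
  have hk' : β y k ≠ 0 := hk
  refine ⟨rotForm G J N y k / β y k, funext fun i => ?_⟩
  rw [Pi.smul_apply, smul_eq_mul]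
  field_simp
  linarith [(h.extDerivOne_coeff_and_cross hy i k).2]

theorem wedgeOneTwoAt_lee (h : IsDecomposableOn U G J N β) (hθ : IsClosedLeeFormOn U G J θ)
    (hy : y ∈ U) :
    wedgeOneTwoAt (θ y) (fundForm G J y) = wedgeOneTwoAt (β y) ((N y)ᵀ * G y) := by
  rw [← hθ.lee y hy]
  funext i j k
  refine (h.isMetricOn.extDerivTwo_transpose_mul h.smooth_acs hy (h.herm y hy).skew i j k).trans ?_
  simp only [h.covD_acs y hy, Matrix.transpose_smul, Matrix.smul_mul, Matrix.smul_apply,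
    smul_eq_mul, wedgeOneTwoAt]

theorem extDerivTwo_unitForm (h : IsDecomposableOn U G J N β) (hy : y ∈ U) (i j k : Fin 4) :
    extDerivTwo (fun z => (N z)ᵀ * G z) i j k y =
      -wedgeOneTwoAt (β y) (fundForm G J y) i j k +
        wedgeOneTwoAt (rotForm G J N y) ((J y * N y)ᵀ * G y) i j k := by
  rw [h.isMetricOn.extDerivTwo_transpose_mul h.smooth_unit hy (h.quaternionic y hy).skew]
  simp only [h.covD_unit hy, Matrix.transpose_add, Matrix.transpose_neg, Matrix.transpose_smul,
    Matrix.add_mul, Matrix.neg_mul, Matrix.smul_mul, Matrix.add_apply, Matrix.neg_apply,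
    Matrix.smul_apply, smul_eq_mul, wedgeOneTwoAt, fundForm]
  ring

/-- Differentiating `θ ∧ ω_N = -β ∧ ω`, where `dθ = dβ = 0` and `β ∧ dω = β ∧ β ∧ ω_N = 0`. -/
theorem wedgeOneThree_lee_extDerivTwo_unitForm (h : IsDecomposableOn U G J N β)
    (hθ : IsClosedLeeFormOn U G J θ) (hy : y ∈ U) :
    wedgeOneThree (θ y) (fun i j k => extDerivTwo (fun z => (N z)ᵀ * G z) i j k y) = 0 := by
  have hleft := extDerivThree_wedgeOneTwoAt h.isOpen
    (fun i => (hθ.smooth i y hy).differentiableAt (by simp)) h.smooth_unitForm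
    (fun z hz => h.unitForm_skew hz) hy
  have hright := extDerivThree_wedgeOneTwoAt h.isOpen (x := fun z => -β z)
    (fun i => ((h.smooth_coeff i y hy).differentiableAt (by simp)).neg) h.smooth_fundForm
    (fun z hz => h.fundForm_skew hz) hy
  have hrotate := extDerivThree_congr h.isOpen (fun z hz =>
    (h.quaternionic z hz).wedgeOneTwoAt_rotate (h.herm z hz) (h.wedgeOneTwoAt_lee hθ hz)) hy
  have hθ0 : (Matrix.of fun i j => extDerivOne θ i j y) = 0 :=
    Matrix.ext fun i j => hθ.closed y hy i j
  have hβ0 : (Matrix.of fun i j => extDerivOne (fun z => -β z) i j y) = 0 := by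
    ext i j
    have hclosed := (h.extDerivOne_coeff_and_cross hy i j).1
    simp only [extDerivOne] at hclosed
    simp only [extDerivOne, Matrix.of_apply, Pi.neg_apply, pderiv_neg, Matrix.zero_apply]
    linarith
  have hself : wedgeOneThree (-β y) (wedgeOneTwoAt (β y) ((N y)ᵀ * G y)) = 0 := by
    have hβ := wedgeOneThree_wedgeOneTwoAt_self (h.unitForm_skew hy) (β y)
    simp only [wedgeOneThree, Pi.neg_apply] at hβ ⊢
    linarith
  have hzero (η : Mat) : wedgeTwoTwo 0 η = 0 := by simp [wedgeTwoTwo]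
  rw [hθ0, hzero, zero_sub] at hleft
  rw [hβ0, hzero, hθ.lee y hy, h.wedgeOneTwoAt_lee hθ hy, hself, sub_zero] at hright
  exact neg_eq_zero.1 (hleft.symm.trans (hrotate.trans hright))

theorem wedgeOneThree_lee_rotForm (h : IsDecomposableOn U G J N β)
    (hθ : IsClosedLeeFormOn U G J θ) (hy : y ∈ U) :
    wedgeOneThree (θ y) (wedgeOneTwoAt (rotForm G J N y) ((J y * N y)ᵀ * G y)) = 0 := by
  have hderiv := h.wedgeOneThree_lee_extDerivTwo_unitForm hθ hy
  have hswap : wedgeOneThree (θ y) (wedgeOneTwoAt (β y) (fundForm G J y)) = 0 := by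
    rw [wedgeOneThree_wedgeOneTwoAt_swap (h.fundForm_skew hy), h.wedgeOneTwoAt_lee hθ hy,
      wedgeOneThree_wedgeOneTwoAt_self (h.unitForm_skew hy), neg_zero]
  simp only [h.extDerivTwo_unitForm hy, wedgeOneThree] at hderiv hswap ⊢
  linarith

theorem rotForm_eq_zero (h : IsDecomposableOn U G J N β) (hθ : IsClosedLeeFormOn U G J θ)
    (hβ : β y ≠ 0) (hy : y ∈ U) : rotForm G J N y = 0 := by
  obtain ⟨t, ht⟩ := h.rotForm_eq_smul hβ hy
  have hwedge : t * wedgeOneThree (θ y) (wedgeOneTwoAt (β y) ((J y * N y)ᵀ * G y)) = 0 := by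
    rw [← h.wedgeOneThree_lee_rotForm hθ hy, ht]
    simp only [wedgeOneThree, wedgeOneTwoAt, Pi.smul_apply, smul_eq_mul]
    ring
  rcases mul_eq_zero.1 hwedge with ht0 | hβ0
  · rw [ht, ht0, zero_smul]
  · exact absurd ((h.quaternionic y hy).eq_zero_of_wedgeOneThree_eq_zero (h.herm y hy)
      (h.wedgeOneTwoAt_lee hθ hy) hβ0) hβ

/-- Once `∇N = -β ⊗ J` with `dβ = 0`, the Ricci identity says that the curvature commutes with `N`,
which kills its Ricci form. -/
theorem ricciForm_eq_zero (h : IsDecomposableOn U G J N β) (hθ : IsClosedLeeFormOn U G J θ)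
    (hβ : ∀ z ∈ U, β z ≠ 0) (hy : y ∈ U) : ricciForm G J y = 0 := by
  ext i j
  have hN := h.quaternionic y hy
  have hcovD (i : Fin 4) (z : E4) (hz : z ∈ U) :
      covD (leviCivita G) i N z = -(β z i • J z) := by
    rw [h.covD_unit hz, h.rotForm_eq_zero hθ (hβ z hz) hz, Pi.zero_apply, zero_smul, add_zero]
  have hcovD₂ (i j : Fin 4) : covD (leviCivita G) i (covD (leviCivita G) j N) y =
      -(pderiv i (fun z => β z j) y • J y + β y j • (β y i • N y)) := by
    rw [covD_congr h.isOpen (hcovD j) hy i, covD_neg,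
      covD_smul ((h.smooth_coeff j y hy).differentiableAt (by simp)) h.smooth_acs hy,
      h.covD_acs y hy]
  have hcomm := ricci_identity h.isMetricOn.smooth_leviCivita h.smooth_unit hy i j
  rw [hcovD₂, hcovD₂, hN.commutator_eq (h.herm y hy) ((h.isKahlerCurvature hy).skew i j)
    (h.comm y hy i j)] at hcomm
  have hclosed := (h.extDerivOne_coeff_and_cross hy i j).1
  rw [extDerivOne, sub_eq_zero] at hclosed
  have hzero : (0 : ℝ) • N y +
      (-(1 / 2 : ℝ) * (J y * curvMat (leviCivita G) i j y).trace) • (J y * N y) = 0 := by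
    rw [← hcomm, hclosed]
    module
  have htrace := (hN.eq_zero_of_smul_add_smul_eq_zero (h.herm y hy) hzero).2
  change (J y * curvMat (leviCivita G) i j y).trace = 0
  linarith

end IsDecomposableOn

theorem exists_unit_of_isSkewAntilinear (hU : IsOpen U) {K : E4 → Mat} (hK : SmoothMat U K)
    (hherm : ∀ z ∈ U, IsHermitianPair (G z) (J z))
    (hskew : ∀ z ∈ U, IsSkewAntilinear (G z) (J z) (K z)) (hy : y ∈ U) (hne : K y ≠ 0) :
    ∃ V ⊆ U, IsOpen V ∧ y ∈ V ∧ ∃ r : E4 → ℝ,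
      SmoothMat V (fun z => r z • K z) ∧ ∀ z ∈ V, IsQuaternionic (G z) (J z) (r z • K z) := by
  set ν : E4 → ℝ := fun z => -(1 / 4 : ℝ) * (K z * K z).trace with hν
  have hνsmooth (z : E4) (hz : z ∈ U) : ContDiffAt ℝ ∞ ν z :=
    contDiffAt_const.mul ((hK.mul hK).trace hz)
  have hνy : 0 < ν y := by
    have hneg := lt_of_le_of_ne ((hskew y hy).trace_mul_self_nonpos (hherm y hy))
      fun h0 => hne ((hskew y hy).eq_zero_of_trace_mul_self_eq_zero (hherm y hy) h0)
    simp only [hν]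
    linarith
  refine ⟨U ∩ ν ⁻¹' Set.Ioi 0, Set.inter_subset_left, ContinuousOn.isOpen_inter_preimage
    (fun z hz => (hνsmooth z hz).continuousAt.continuousWithinAt) hU isOpen_Ioi, ⟨hy, hνy⟩,
    fun z => (√(ν z))⁻¹, ?_, fun z hz => ?_⟩
  · exact SmoothMat.smul (fun z hz => ((hνsmooth z hz.1).sqrt (ne_of_gt hz.2)).inv
      (Real.sqrt_pos.2 hz.2).ne') (hK.mono Set.inter_subset_left)
  · refine ⟨(hskew z hz.1).smul _, ?_⟩
    have hsqrt : (√(ν z))⁻¹ * (√(ν z))⁻¹ * ν z = 1 := by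
      rw [← mul_inv, Real.mul_self_sqrt (le_of_lt hz.2), inv_mul_cancel₀ (ne_of_gt hz.2)]
    have hsq : K z * K z = (-ν z) • (1 : Mat) := by
      rw [(hskew z hz.1).mul_self_eq (hherm z hz.1)]
      simp only [hν, neg_mul, neg_neg]
    change ((√(ν z))⁻¹ • K z) * ((√(ν z))⁻¹ • K z) = -1
    rw [Matrix.smul_mul, Matrix.mul_smul, hsq, smul_smul, smul_smul,
      show (√(ν z))⁻¹ * (√(ν z))⁻¹ * -ν z = -1 by linear_combination -hsqrt, neg_one_smul]

theorem IsAHOneOn.covD_eq_smul_of_torForm_eq_zero (h : IsAHOneOn U G J)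
    (htor : torForm G J y = 0) (hy : y ∈ U) {m : Fin 4} {r : ℝ}
    (hN : IsQuaternionic (G y) (J y) (r • covD (leviCivita G) m J y)) (i : Fin 4) :
    covD (leviCivita G) i J y = (-(1 / 4 : ℝ) * (covD (leviCivita G) i J y *
      r • covD (leviCivita G) m J y).trace) • r • covD (leviCivita G) m J y := by
  have hdecomp := hN.eq_trace_smul (h.herm y hy) (h.isSkewAntilinear_covD hy i)
  have htrace : (covD (leviCivita G) i J y *
      (J y * r • covD (leviCivita G) m J y)).trace = 0 := by
    have hentry : (J y * covD (leviCivita G) i J y * covD (leviCivita G) m J y).trace = 0 :=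
      congrFun (congrFun htor i) m
    rw [← Matrix.mul_assoc, (h.isSkewAntilinear_covD hy i).anti, Matrix.neg_mul,
      Matrix.trace_neg, Matrix.mul_smul, Matrix.trace_smul, hentry, smul_zero, neg_zero]
  rwa [htrace, mul_zero, zero_smul, add_zero] at hdecomp

theorem IsAHOneOn.covD_acs_eq_zero (h : IsAHOneOn U G J)
    (hρ : ∀ z ∈ U, ricciDensity G J z ≠ 0) (htor : ∀ z ∈ U, torForm G J z = 0)
    (hθ : IsClosedLeeFormOn U G J θ) (hy : y ∈ U) (m : Fin 4) :
    covD (leviCivita G) m J y = 0 := by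
  by_contra hne
  obtain ⟨V, hVU, hV, hyV, r, hN, hquat⟩ := exists_unit_of_isSkewAntilinear h.isOpen
    (h.smooth_covD m) h.herm (fun z hz => h.isSkewAntilinear_covD hz m) hy hne
  have hdecomp : IsDecomposableOn V G J (fun z => r z • covD (leviCivita G) m J z)
      fun z i => -(1 / 4 : ℝ) * (covD (leviCivita G) i J z *
        r z • covD (leviCivita G) m J z).trace :=
    { h.mono hV hVU with
      smooth_unit := hN
      smooth_coeff := fun i z hz =>
        contDiffAt_const.mul ((((h.smooth_covD i).mono hVU).mul hN).trace hz)
      quaternionic := hquat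
      covD_acs := fun z hz i =>
        h.covD_eq_smul_of_torForm_eq_zero (htor z (hVU hz)) (hVU hz) (hquat z hz) i }
  have hβ (z : E4) (hz : z ∈ V) : (fun i => -(1 / 4 : ℝ) * (covD (leviCivita G) i J z *
      r z • covD (leviCivita G) m J z).trace) ≠ 0 := by
    intro h0
    have hsmul := hdecomp.covD_acs z hz m
    rw [congrFun h0 m, Pi.zero_apply, zero_smul] at hsmul
    have hsq := (hquat z hz).sq
    rw [hsmul, smul_zero, Matrix.zero_mul] at hsq
    simpa using congrFun (congrFun hsq 0) 0
  refine hρ y hy ?_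
  rw [ricciDensity, hdecomp.ricciForm_eq_zero (hθ.mono hVU) hβ hyV]
  simp [wedgeTwoTwo]

end DecomposableTorsion

/-! ### Changes of coordinates -/

/-- A smooth map `φ` from `V` to `U` pulling back the almost Hermitian structure `(G, J)` of class
`AH₁` to `(G', J')`. -/
structure IsCoordChange (U V : Set E4) (φ : E4 → E4) (G J G' J' : E4 → Mat) : Prop where
  src : IsAHOneOn U G J
  tgt : IsAHOneOn V G' J'
  maps : Set.MapsTo φ V U
  smooth : ∀ z ∈ V, ContDiffAt ℝ ∞ φ z
  metric : ∀ z ∈ V, G' z = (jacMat φ z)ᵀ * G (φ z) * jacMat φ z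
  acs : ∀ z ∈ V, jacMat φ z * J' z = J (φ z) * jacMat φ z

theorem trace_eq_of_mul_eq_mul {P A B : Mat} (hP : P.det ≠ 0) (h : P * A = B * P) :
    A.trace = B.trace := by
  have hA : A = P⁻¹ * (B * P) := by
    rw [← h, ← Matrix.mul_assoc, Matrix.nonsing_inv_mul _ hP.isUnit, Matrix.one_mul]
  rw [hA, Matrix.trace_mul_comm, Matrix.mul_assoc, Matrix.mul_nonsing_inv _ hP.isUnit,
    Matrix.mul_one]

theorem transpose_mul_mul_apply (P η : Mat) (i j : Fin 4) :
    (Pᵀ * η * P) i j = ∑ a, ∑ b, P a i * P b j * η a b := by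
  simp only [Matrix.mul_apply, Matrix.transpose_apply, Finset.sum_mul]
  rw [Finset.sum_comm]
  exact Finset.sum_congr rfl fun _ _ => Finset.sum_congr rfl fun _ _ => by ring

namespace IsCoordChange

variable {U V : Set E4} {φ : E4 → E4} {G J G' J' : E4 → Mat} {z : E4}

theorem det_ne (h : IsCoordChange U V φ G J G' J') (hz : z ∈ V) : (jacMat φ z).det ≠ 0 := by
  intro hdet
  refine h.tgt.isMetricOn.det_ne z hz ?_
  rw [h.metric z hz, Matrix.det_mul, hdet, mul_zero]

theorem leviCivita_gauge (h : IsCoordChange U V φ G J G' J') (hz : z ∈ V) (i : Fin 4) :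
    jacMat φ z * leviCivita G' i z = pderivMat i (jacMat φ) z +
      pullbackConnection φ (leviCivita G) i z * jacMat φ z :=
  h.src.isMetricOn.leviCivita_gauge h.tgt.isMetricOn h.smooth h.maps h.metric hz i

theorem covD_acs_eq (h : IsCoordChange U V φ G J G' J') (hz : z ∈ V) (i : Fin 4) :
    jacMat φ z * covD (leviCivita G') i J' z =
      (∑ a, jacMat φ z a i • covD (leviCivita G) a J (φ z)) * jacMat φ z := by
  rw [covD_gauge h.tgt.isOpen (smoothMat_jacMat h.smooth) (fun w hw => h.leviCivita_gauge hw)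
    (h.src.smooth_acs.comp h.smooth h.maps) h.tgt.smooth_acs h.acs hz,
    covD_pullbackConnection h.src.smooth_acs ((h.smooth z hz).differentiableAt (by simp))
      (h.maps hz)]

theorem curvMat_eq (h : IsCoordChange U V φ G J G' J') (hz : z ∈ V) (i j : Fin 4) :
    jacMat φ z * curvMat (leviCivita G') i j z = pullArgs (jacMat φ z)
      (fun a b => curvMat (leviCivita G) a b (φ z)) i j * jacMat φ z := by
  rw [curvMat_gauge h.tgt.isOpen (smoothMat_jacMat h.smooth)
    (SmoothMat.pullbackConnection h.src.isMetricOn.smooth_leviCivita h.smooth h.maps)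
    h.tgt.isMetricOn.smooth_leviCivita (fun w hw => h.leviCivita_gauge hw) hz,
    curvMat_pullbackConnection h.src.isMetricOn.smooth_leviCivita h.smooth h.maps hz]
  rfl

theorem torForm_eq (h : IsCoordChange U V φ G J G' J') (hz : z ∈ V) :
    torForm G' J' z = (jacMat φ z)ᵀ * torForm G J (φ z) * jacMat φ z := by
  ext i j
  have hconj : jacMat φ z * (J' z * covD (leviCivita G') i J' z * covD (leviCivita G') j J' z) =
      J (φ z) * (∑ a, jacMat φ z a i • covD (leviCivita G) a J (φ z)) *
        (∑ b, jacMat φ z b j • covD (leviCivita G) b J (φ z)) * jacMat φ z := by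
    rw [← Matrix.mul_assoc, ← Matrix.mul_assoc, h.acs z hz, Matrix.mul_assoc (J (φ z)),
      h.covD_acs_eq hz, ← Matrix.mul_assoc, Matrix.mul_assoc _ (jacMat φ z), h.covD_acs_eq hz,
      ← Matrix.mul_assoc]
  rw [transpose_mul_mul_apply, torForm, Matrix.of_apply,
    trace_eq_of_mul_eq_mul (h.det_ne hz) hconj]
  simp only [torForm, Matrix.of_apply, Finset.mul_sum, Finset.sum_mul, Matrix.trace_sum,
    Matrix.mul_smul, Matrix.smul_mul, Matrix.trace_smul, smul_eq_mul]
  rw [Finset.sum_comm]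
  exact Finset.sum_congr rfl fun _ _ => Finset.sum_congr rfl fun _ _ => by ring

theorem ricciForm_eq (h : IsCoordChange U V φ G J G' J') (hz : z ∈ V) :
    ricciForm G' J' z = (jacMat φ z)ᵀ * ricciForm G J (φ z) * jacMat φ z := by
  rw [ricciForm, ricciForm, ← ricciTwoForm_pullArgs]
  ext i j
  refine trace_eq_of_mul_eq_mul (h.det_ne hz) ?_
  rw [← Matrix.mul_assoc, h.acs z hz, Matrix.mul_assoc, h.curvMat_eq hz, Matrix.mul_assoc]

theorem fundForm_eq (h : IsCoordChange U V φ G J G' J') (hz : z ∈ V) :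
    fundForm G' J' z = (jacMat φ z)ᵀ * fundForm G J (φ z) * jacMat φ z := by
  rw [fundForm, h.metric z hz, ← Matrix.mul_assoc, ← Matrix.mul_assoc, ← Matrix.transpose_mul,
    h.acs z hz, Matrix.transpose_mul, fundForm, Matrix.mul_assoc _ (J (φ z))ᵀ]

theorem twistForm_eq (h : IsCoordChange U V φ G J G' J') (hz : z ∈ V) (i : Fin 4) :
    twistForm G' J' i z = ∑ a, jacMat φ z a i •
      ((jacMat φ z)ᵀ * twistForm G J a (φ z) * jacMat φ z) := by
  have hconj : jacMat φ z * (J' z * covD (leviCivita G') i J' z) =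
      ∑ a, jacMat φ z a i • (J (φ z) * covD (leviCivita G) a J (φ z) * jacMat φ z) := by
    rw [← Matrix.mul_assoc, h.acs z hz, Matrix.mul_assoc, h.covD_acs_eq hz]
    simp only [Finset.mul_sum, Finset.sum_mul, Matrix.mul_smul, Matrix.smul_mul, Matrix.mul_assoc]
  rw [twistForm, h.metric z hz, ← Matrix.mul_assoc, ← Matrix.mul_assoc, ← Matrix.transpose_mul,
    hconj]
  simp only [Matrix.transpose_sum, Finset.sum_mul, Matrix.transpose_smul, Matrix.smul_mul,
    twistForm, Matrix.transpose_mul, Matrix.mul_assoc]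

theorem torThreeForm_eq (h : IsCoordChange U V φ G J G' J') (hz : z ∈ V) :
    torThreeForm G' J' z = pullThree (jacMat φ z) (torThreeForm G J (φ z)) := by
  have htwist (i j k : Fin 4) : twistForm G' J' i z j k = ∑ a, ∑ b, ∑ c,
      jacMat φ z a i * jacMat φ z b j * jacMat φ z c k * twistForm G J a (φ z) b c := by
    rw [h.twistForm_eq hz]
    simp only [Matrix.sum_apply, Matrix.smul_apply, transpose_mul_mul_apply, smul_eq_mul,
      Finset.mul_sum]
    simp only [mul_assoc]
  funext i j k
  simp only [torThreeForm, pullThree, htwist, mul_add, Finset.sum_add_distrib]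
  congr 1
  · congr 1
    rw [Finset.sum_comm_cycle]
    exact Finset.sum_congr rfl fun _ _ => Finset.sum_congr rfl fun _ _ =>
      Finset.sum_congr rfl fun _ _ => by ring
  · rw [← Finset.sum_comm_cycle]
    exact Finset.sum_congr rfl fun _ _ => Finset.sum_congr rfl fun _ _ =>
      Finset.sum_congr rfl fun _ _ => by ring

theorem ricciDensity_eq (h : IsCoordChange U V φ G J G' J') (hz : z ∈ V) :
    ricciDensity G' J' z = (jacMat φ z).det * ricciDensity G J (φ z) := by
  rw [ricciDensity, h.ricciForm_eq hz, h.fundForm_eq hz,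
    wedgeTwoTwo_pullback _ (ricciForm_skew G J _) (h.src.fundForm_skew (h.maps hz)), ricciDensity]

theorem torRatio_eq (h : IsCoordChange U V φ G J G' J') (hz : z ∈ V) :
    torRatio G' J' z = torRatio G J (φ z) := by
  rw [torRatio, h.ricciDensity_eq hz, h.torForm_eq hz, h.fundForm_eq hz,
    wedgeTwoTwo_pullback _ (h.src.torForm_skew (h.maps hz)) (h.src.fundForm_skew (h.maps hz)),
    mul_div_mul_left _ _ (h.det_ne hz), torRatio]

theorem wedgeOneThree_pderiv_comp (h : IsCoordChange U V φ G J G' J') (hz : z ∈ V)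
    {f : E4 → ℝ} (hf : DifferentiableAt ℝ f (φ z)) :
    wedgeOneThree (fun i => pderiv i (fun w => f (φ w)) z) (torThreeForm G' J' z) =
      (jacMat φ z).det *
        wedgeOneThree (fun i => pderiv i f (φ z)) (torThreeForm G J (φ z)) := by
  rw [h.torThreeForm_eq hz,
    ← wedgeOneThree_pullback _ _ (h.src.isAltThree_torThreeForm (h.maps hz))]
  congr 1
  funext i
  exact pderiv_comp hf ((h.smooth z hz).differentiableAt (by simp)) i

end IsCoordChange

/-! ### The structure of a chart -/

theorem fderiv_toLp_eq_jacMat_mulVec {φ : E4 → E4} {z : E4} (hφ : DifferentiableAt ℝ φ z)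
    (c : Fin 4 → ℝ) : fderiv ℝ φ z (WithLp.toLp 2 c) = WithLp.toLp 2 (jacMat φ z *ᵥ c) := by
  ext a
  have hcoord : fderiv ℝ (fun w => φ w a) z (WithLp.toLp 2 c) =
      fderiv ℝ φ z (WithLp.toLp 2 c) a :=
    DFunLike.congr_fun ((EuclideanSpace.proj a : E4 →L[ℝ] ℝ).hasFDerivAt.comp z
      hφ.hasFDerivAt).fderiv (WithLp.toLp 2 c)
  rw [← hcoord, fderiv_eq_sum_pderiv]
  simp [jacMat, Matrix.mulVec, dotProduct, mul_comm]

theorem IsHermitianPair.commute_of_transpose_mul_eq {g j r : Mat} (h : IsHermitianPair g j)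
    (hr : rᵀ * g = jᵀ * (rᵀ * g) * j) : r * j = j * r := by
  have hskew := isSkewAdjoint_iff.1 h.skew
  have hform : rᵀ * jᵀ * g = jᵀ * rᵀ * g := by
    linear_combination (norm := noncomm_ring) rᵀ * hskew - hr * j - jᵀ * rᵀ * g * h.sq
  have hcancel : rᵀ * jᵀ = jᵀ * rᵀ := by
    simpa only [Matrix.mul_assoc, Matrix.mul_nonsing_inv _ h.det_ne.isUnit, Matrix.mul_one]
      using congrArg (· * g⁻¹) hform
  simpa only [Matrix.transpose_mul, Matrix.transpose_transpose] using
    congrArg Matrix.transpose hcancel.symm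

section ChartFields

variable {M : Type*} [TopologicalSpace M] [ChartedSpace E4 M]

/-- The tangent vector with prescribed components in the chart `e`, at the point with
coordinates `y`. -/
def ofCoord (e : OpenPartialHomeomorph M E4) (y : E4) :
    (Fin 4 → ℝ) →L[ℝ] TangentSpace 𝓘(ℝ, E4) (e.symm y) :=
  (mfderiv 𝓘(ℝ, E4) 𝓘(ℝ, E4) e.symm y : E4 →L[ℝ] TangentSpace 𝓘(ℝ, E4) (e.symm y)).comp
    ((EuclideanSpace.equiv (Fin 4) ℝ).symm : (Fin 4 → ℝ) →L[ℝ] E4)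

theorem ofCoord_single (e : OpenPartialHomeomorph M E4) (y : E4) (i : Fin 4) :
    ofCoord e y (Pi.single i 1) = coordVec e i y := rfl

theorem ofCoord_eq_sum (e : OpenPartialHomeomorph M E4) (y : E4) (c : Fin 4 → ℝ) :
    ofCoord e y c = ∑ i, c i • coordVec e i y := by
  conv_lhs => rw [pi_eq_sum_univ' c]
  simp only [map_sum, map_smul, ofCoord_single]

variable [IsManifold 𝓘(ℝ, E4) ∞ M] {e e' : OpenPartialHomeomorph M E4} {y : E4}

theorem contMDiffAt_atlas_symm (he : e ∈ atlas E4 M) (hy : y ∈ e.target) :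
    ContMDiffAt 𝓘(ℝ, E4) 𝓘(ℝ, E4) ∞ e.symm y :=
  contMDiffAt_symm_of_mem_maximalAtlas (IsManifold.subset_maximalAtlas he) hy

theorem contMDiffAt_coordVec (he : e ∈ atlas E4 M) (i : Fin 4) (hy : y ∈ e.target) :
    ContMDiffAt 𝓘(ℝ, E4) (𝓘(ℝ, E4).prod 𝓘(ℝ, E4)) ∞
      (fun z => Bundle.TotalSpace.mk' E4 (E := fun x : M => TangentSpace 𝓘(ℝ, E4) x)
        (e.symm z) (coordVec e i z)) y := by
  have : IsManifold 𝓘(ℝ, E4) 1 M := IsManifold.of_le (n := ∞) (by simp)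
  have hderiv := ContMDiffAt.mfderiv_const (m := ∞) (contMDiffAt_atlas_symm he hy) (by simp)
  have hbasis : ContMDiffAt 𝓘(ℝ, E4) (𝓘(ℝ, E4).prod 𝓘(ℝ, E4)) ∞
      (fun z : E4 => Bundle.TotalSpace.mk' E4 (E := fun x : E4 => TangentSpace 𝓘(ℝ, E4) x)
        z (EuclideanSpace.single i (1 : ℝ) : E4)) y := by
    rw [Bundle.contMDiffAt_totalSpace]
    exact ⟨contMDiffAt_id, by simpa using contMDiffAt_const⟩
  exact ContMDiffAt.clm_apply_of_inCoordinates (b₁ := id) (b₂ := e.symm) hderiv hbasis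
    (contMDiffAt_atlas_symm he hy)

theorem ofCoord_vecCoord (he : e ∈ atlas E4 M) (hy : y ∈ e.target)
    (v : TangentSpace 𝓘(ℝ, E4) (e.symm y)) :
    ofCoord e y (fun a => vecCoord e a (e.symm y) v) = v := by
  have : IsManifold 𝓘(ℝ, E4) 1 M := IsManifold.of_le (n := ∞) (by simp)
  have hinv := (mdifferentiable_of_mem_atlas (I := 𝓘(ℝ, E4)) he).symm_comp_deriv
    (e.map_target hy)
  rw [e.right_inv hy] at hinv
  exact DFunLike.congr_fun hinv v

theorem vecCoord_ofCoord (he : e ∈ atlas E4 M) (hy : y ∈ e.target) (a : Fin 4)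
    (c : Fin 4 → ℝ) : vecCoord e a (e.symm y) (ofCoord e y c) = c a := by
  have : IsManifold 𝓘(ℝ, E4) 1 M := IsManifold.of_le (n := ∞) (by simp)
  exact congrArg (fun v : E4 => v a) (DFunLike.congr_fun
    ((mdifferentiable_of_mem_atlas (I := 𝓘(ℝ, E4)) he).comp_symm_deriv hy) (WithLp.toLp 2 c : E4))

theorem ofCoord_injective (he : e ∈ atlas E4 M) (hy : y ∈ e.target) :
    Function.Injective (ofCoord e y) := by
  intro c d h
  funext a
  rw [← vecCoord_ofCoord he hy a c, h, vecCoord_ofCoord he hy]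

namespace AlmostHermitianStructure

variable (S : AlmostHermitianStructure M)

theorem contDiffAt_inner (he : e ∈ atlas E4 M) (hy : y ∈ e.target)
    {v w : ∀ z : E4, TangentSpace 𝓘(ℝ, E4) (e.symm z)}
    (hv : ContMDiffAt 𝓘(ℝ, E4) (𝓘(ℝ, E4).prod 𝓘(ℝ, E4)) ∞
      (fun z => Bundle.TotalSpace.mk' E4 (E := fun x : M => TangentSpace 𝓘(ℝ, E4) x)
        (e.symm z) (v z)) y)
    (hw : ContMDiffAt 𝓘(ℝ, E4) (𝓘(ℝ, E4).prod 𝓘(ℝ, E4)) ∞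
      (fun z => Bundle.TotalSpace.mk' E4 (E := fun x : M => TangentSpace 𝓘(ℝ, E4) x)
        (e.symm z) (w z)) y) :
    ContDiffAt ℝ ∞ (fun z => S.g.inner (e.symm z) (v z) (w z)) y := by
  have h : ContMDiffAt 𝓘(ℝ, E4) (𝓘(ℝ, E4).prod 𝓘(ℝ)) ∞
      (fun z => Bundle.TotalSpace.mk' ℝ (E := Bundle.Trivial M ℝ) (e.symm z)
        (S.g.inner (e.symm z) (v z) (w z))) y := by
    apply ContMDiffAt.clm_bundle_apply₂ (F₁ := E4) (F₂ := E4)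
    · exact ContMDiffAt.comp y S.g.contMDiff.contMDiffAt (contMDiffAt_atlas_symm he hy)
    · exact hv
    · exact hw
  rw [Bundle.contMDiffAt_totalSpace] at h
  exact h.2.contDiffAt

theorem contMDiffAt_acs_coordVec (he : e ∈ atlas E4 M) (i : Fin 4) (hy : y ∈ e.target) :
    ContMDiffAt 𝓘(ℝ, E4) (𝓘(ℝ, E4).prod 𝓘(ℝ, E4)) ∞
      (fun z => Bundle.TotalSpace.mk' E4 (E := fun x : M => TangentSpace 𝓘(ℝ, E4) x)
        (e.symm z) (S.J (e.symm z) (coordVec e i z))) y := by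
  apply ContMDiffAt.clm_bundle_apply (F₁ := E4)
  · exact ContMDiffAt.comp y S.smooth_J.contMDiffAt (contMDiffAt_atlas_symm he hy)
  · exact contMDiffAt_coordVec he i hy

theorem smoothMat_metricCoef (he : e ∈ atlas E4 M) : SmoothMat e.target (S.metricCoef e) :=
  fun i j _ hy => S.contDiffAt_inner he hy (contMDiffAt_coordVec he i hy)
    (contMDiffAt_coordVec he j hy)

theorem smoothMat_omegaCoef (he : e ∈ atlas E4 M) : SmoothMat e.target (S.omegaCoef e) :=
  fun i j _ hy => S.contDiffAt_inner he hy (S.contMDiffAt_acs_coordVec he i hy)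
    (contMDiffAt_coordVec he j hy)

theorem acs_ofCoord (he : e ∈ atlas E4 M) (hy : y ∈ e.target) (c : Fin 4 → ℝ) :
    S.J (e.symm y) (ofCoord e y c) = ofCoord e y (S.acsCoef e y *ᵥ c) := by
  have hlin : ((S.J (e.symm y)).comp (ofCoord e y)).toLinearMap =
      (ofCoord e y).toLinearMap ∘ₗ (S.acsCoef e y).mulVecLin := by
    refine LinearMap.pi_ext' fun i => LinearMap.ext_ring ?_
    simp only [LinearMap.coe_comp, Function.comp_apply, LinearMap.coe_single,
      ContinuousLinearMap.coe_coe, ContinuousLinearMap.comp_apply, Matrix.mulVecLin_apply,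
      Matrix.mulVec_single_one, ofCoord_single]
    exact (ofCoord_vecCoord he hy _).symm
  exact LinearMap.congr_fun hlin c

theorem inner_ofCoord (e : OpenPartialHomeomorph M E4) (y : E4) (c d : Fin 4 → ℝ) :
    S.g.inner (e.symm y) (ofCoord e y c) (ofCoord e y d) = c ⬝ᵥ S.metricCoef e y *ᵥ d := by
  simp only [ofCoord_eq_sum, map_sum, map_smul, sum_apply, smul_apply, smul_eq_mul, dotProduct,
    Matrix.mulVec, metricCoef, Matrix.of_apply, Finset.mul_sum]
  rw [Finset.sum_comm]
  exact Finset.sum_congr rfl fun i _ => Finset.sum_congr rfl fun j _ => by ring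

theorem isHermitianPair (he : e ∈ atlas E4 M) (hy : y ∈ e.target) :
    IsHermitianPair (S.metricCoef e y) (S.acsCoef e y) where
  posDef := by
    refine Matrix.PosDef.of_dotProduct_mulVec_pos ?_ fun v hv => ?_
    · ext i j
      exact S.g.symm _ _ _
    · rw [star_trivial, ← S.inner_ofCoord]
      exact S.g.pos _ _ fun h => hv (ofCoord_injective he hy (h.trans (map_zero _).symm))
  sq := by
    refine Matrix.mulVec_injective (funext fun c => ofCoord_injective he hy ?_)
    rw [← Matrix.mulVec_mulVec, ← S.acs_ofCoord he hy, ← S.acs_ofCoord he hy, S.J_sq,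
      Matrix.neg_mulVec, Matrix.one_mulVec, map_neg]
  orth := by
    ext i j
    have h := S.J_orthogonal (e.symm y) (ofCoord e y (Pi.single i 1)) (ofCoord e y (Pi.single j 1))
    rw [S.acs_ofCoord he hy, S.acs_ofCoord he hy, S.inner_ofCoord, S.inner_ofCoord] at h
    rw [Matrix.mul_assoc, Matrix.mul_apply]
    simpa [dotProduct, Matrix.mulVec, Matrix.mul_apply, Pi.single_apply] using h

theorem omegaCoef_eq_fundForm (he : e ∈ atlas E4 M) (hy : y ∈ e.target) :
    S.omegaCoef e y = fundForm (S.metricCoef e) (S.acsCoef e) y := by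
  ext i j
  have h : S.omegaCoef e y i j = S.g.inner (e.symm y)
    (S.J (e.symm y) (ofCoord e y (Pi.single i 1))) (ofCoord e y (Pi.single j 1)) := rfl
  rw [h, S.acs_ofCoord he hy, S.inner_ofCoord, fundForm, Matrix.mul_apply]
  simp [dotProduct]

theorem smoothMat_acsCoef (he : e ∈ atlas E4 M) : SmoothMat e.target (S.acsCoef e) := by
  have hdet (y : E4) (hy : y ∈ e.target) : (S.metricCoef e y).det ≠ 0 :=
    (S.isHermitianPair he hy).det_ne
  refine (((S.smoothMat_metricCoef he).inv hdet).mul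
    (S.smoothMat_omegaCoef he).transpose).congr e.open_target fun y hy => ?_
  rw [S.omegaCoef_eq_fundForm he hy, fundForm, Matrix.transpose_mul, Matrix.transpose_transpose,
    (S.isHermitianPair he hy).symm, ← Matrix.mul_assoc,
    Matrix.nonsing_inv_mul _ (hdet y hy).isUnit, Matrix.one_mul]

theorem isAHOneOn (hS : S.IsAH1) (he : e ∈ atlas E4 M) :
    IsAHOneOn e.target (S.metricCoef e) (S.acsCoef e) where
  isOpen := e.open_target
  smooth_metric := S.smoothMat_metricCoef he
  smooth_acs := S.smoothMat_acsCoef he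
  herm y hy := S.isHermitianPair he hy
  comm y hy i j := by
    have hriemann (k l : Fin 4) : riemann (S.metricCoef e) i j k l y =
        ((curvMat (leviCivita (S.metricCoef e)) i j y)ᵀ * S.metricCoef e y) k l := by
      simp only [riemann, curvature_eq_curvMat, Matrix.mul_apply, Matrix.transpose_apply]
    refine (S.isHermitianPair he hy).commute_of_transpose_mul_eq (Matrix.ext fun k l => ?_)
    rw [← hriemann, hS e he y hy i j k l, transpose_mul_mul_apply]
    simp only [hriemann]

theorem inner_congr {x x' : M} (h : x = x') {u v : TangentSpace 𝓘(ℝ, E4) x}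
    {u' v' : TangentSpace 𝓘(ℝ, E4) x'} (hu : @Eq E4 u u') (hv : @Eq E4 v v') :
    S.g.inner x u v = S.g.inner x' u' v' := by
  subst h
  obtain rfl : u = u' := hu
  obtain rfl : v = v' := hv
  rfl

theorem acs_congr {x x' : M} (h : x = x') {u : TangentSpace 𝓘(ℝ, E4) x}
    {u' : TangentSpace 𝓘(ℝ, E4) x'} (hu : @Eq E4 u u') : @Eq E4 (S.J x u) (S.J x' u') := by
  subst h
  obtain rfl : u = u' := hu
  rfl

end AlmostHermitianStructure

theorem contDiffAt_transition {z : E4} (he : e ∈ atlas E4 M) (he' : e' ∈ atlas E4 M)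
    (hz : z ∈ (e'.symm ≫ₕ e).source) : ContDiffAt ℝ ∞ (e'.symm ≫ₕ e) z :=
  ((contMDiffAt_of_mem_maximalAtlas (IsManifold.subset_maximalAtlas he) hz.2).comp z
    (contMDiffAt_atlas_symm he' hz.1)).contDiffAt

theorem ofCoord_transition {z : E4} (he : e ∈ atlas E4 M) (he' : e' ∈ atlas E4 M)
    (hz : z ∈ (e'.symm ≫ₕ e).source) (c : Fin 4 → ℝ) :
    @Eq E4 (ofCoord e' z c)
      (ofCoord e ((e'.symm ≫ₕ e) z) (jacMat (e'.symm ≫ₕ e) z *ᵥ c)) := by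
  have : IsManifold 𝓘(ℝ, E4) 1 M := IsManifold.of_le (n := ∞) (by simp)
  have hdiff := (contDiffAt_transition he he' hz).differentiableAt (by simp)
  have hsymm : e'.symm =ᶠ[nhds z] e.symm ∘ (e'.symm ≫ₕ e) := by
    filter_upwards [(e'.symm ≫ₕ e).open_source.mem_nhds hz] with w hw
    exact (e.left_inv hw.2).symm
  have hchain := mfderiv_comp_apply (I := 𝓘(ℝ, E4)) (I' := 𝓘(ℝ, E4)) (I'' := 𝓘(ℝ, E4)) z
    (mdifferentiableAt_atlas_symm (I := 𝓘(ℝ, E4)) he (e.map_source hz.2))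
    hdiff.mdifferentiableAt (WithLp.toLp 2 c : E4)
  have hjac : @Eq E4 (mfderiv 𝓘(ℝ, E4) 𝓘(ℝ, E4) (e'.symm ≫ₕ e) z (WithLp.toLp 2 c : E4))
      (WithLp.toLp 2 (jacMat (e'.symm ≫ₕ e) z *ᵥ c)) := by
    rw [mfderiv_eq_fderiv]
    exact fderiv_toLp_eq_jacMat_mulVec hdiff c
  have hcongr : @Eq E4 (mfderiv 𝓘(ℝ, E4) 𝓘(ℝ, E4) e'.symm z (WithLp.toLp 2 c : E4))
      (mfderiv 𝓘(ℝ, E4) 𝓘(ℝ, E4) (e.symm ∘ (e'.symm ≫ₕ e)) z (WithLp.toLp 2 c : E4)) := by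
    rw [hsymm.mfderiv_eq]
    rfl
  exact hcongr.trans (hchain.trans
    (congrArg (mfderiv 𝓘(ℝ, E4) 𝓘(ℝ, E4) e.symm ((e'.symm ≫ₕ e) z)) hjac))

theorem AlmostHermitianStructure.isCoordChange (S : AlmostHermitianStructure M) (hS : S.IsAH1)
    (he : e ∈ atlas E4 M) (he' : e' ∈ atlas E4 M) :
    IsCoordChange e.target (e'.symm ≫ₕ e).source (e'.symm ≫ₕ e) (S.metricCoef e) (S.acsCoef e)
      (S.metricCoef e') (S.acsCoef e') where
  src := S.isAHOneOn hS he
  tgt := (S.isAHOneOn hS he').mono (e'.symm ≫ₕ e).open_source fun _ hz => hz.1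
  maps _ hz := e.map_source hz.2
  smooth _ hz := contDiffAt_transition he he' hz
  metric z hz := by
    have hpoint : e'.symm z = e.symm ((e'.symm ≫ₕ e) z) := (e.left_inv hz.2).symm
    ext i j
    have h := S.inner_congr hpoint
      (ofCoord_transition he he' hz (Pi.single i 1)) (ofCoord_transition he he' hz (Pi.single j 1))
    rw [S.inner_ofCoord, S.inner_ofCoord] at h
    rw [Matrix.mul_assoc, Matrix.mul_apply]
    simpa [dotProduct, Matrix.mulVec, Matrix.mul_apply, Pi.single_apply] using h
  acs z hz := by
    have hpoint : e'.symm z = e.symm ((e'.symm ≫ₕ e) z) := (e.left_inv hz.2).symm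
    have htarget : (e'.symm ≫ₕ e) z ∈ e.target := e.map_source hz.2
    refine Matrix.mulVec_injective (funext fun c => ofCoord_injective he htarget ?_)
    have h := S.acs_congr hpoint (ofCoord_transition he he' hz c)
    rw [S.acs_ofCoord he' hz.1, S.acs_ofCoord he htarget] at h
    rw [← Matrix.mulVec_mulVec, ← Matrix.mulVec_mulVec]
    exact (ofCoord_transition he he' hz _).symm.trans h

end ChartFields

/-! ### Integration by parts for the torsion 3-form -/

open MeasureTheory

section OpenSets

variable {U K : Set E4} {f : E4 → ℝ}

theorem integrableOn_of_eq_zero_off_compact (hU : IsOpen U) (hK : IsCompact K) (hKU : K ⊆ U)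
    (hf : ContinuousOn f U) (hzero : ∀ y ∈ U, y ∉ K → f y = 0) : IntegrableOn f U :=
  ((hf.mono hKU).integrableOn_compact hK).of_forall_sdiff_eq_zero hU.measurableSet
    fun y hy => hzero y hy.1 hy.2

theorem pderiv_eq_zero_of_notMem (hU : IsOpen U) (hK : IsClosed K)
    (hzero : ∀ y ∈ U, y ∉ K → f y = 0) {y : E4} (hy : y ∈ U) (hyK : y ∉ K) (i : Fin 4) :
    pderiv i f y = 0 := by
  rw [pderiv_congr_of_isOpen (g := fun _ => (0 : ℝ)) (hU.sdiff hK)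
    (fun z hz => hzero z hz.1 hz.2) ⟨hy, hyK⟩, pderiv_const]

theorem contDiff_indicator_of_eq_zero_off_closed {E F : Type*} [NormedAddCommGroup E]
    [NormedSpace ℝ E] [NormedAddCommGroup F] [NormedSpace ℝ F] {n : ℕ∞ω} {U K : Set E} {f : E → F}
    (hU : IsOpen U) (hK : IsClosed K) (hKU : K ⊆ U) (hf : ∀ y ∈ U, ContDiffAt ℝ n f y)
    (hzero : ∀ y ∈ U, y ∉ K → f y = 0) : ContDiff ℝ n (U.indicator f) := by
  refine contDiff_iff_contDiffAt.2 fun y => ?_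
  by_cases hy : y ∈ U
  · exact (hf y hy).congr_of_eventuallyEq
      (Set.eqOn_indicator.eventuallyEq_of_mem (hU.mem_nhds hy))
  · refine contDiffAt_const (c := (0 : F)) |>.congr_of_eventuallyEq ?_
    filter_upwards [hK.isOpen_compl.mem_nhds fun hyK => hy (hKU hyK)] with z hz
    by_cases hzU : z ∈ U
    · rw [Set.indicator_of_mem hzU, hzero z hzU hz]
    · exact Set.indicator_of_notMem hzU f

theorem integral_pderiv_eq_zero {F : E4 → ℝ} (hF : ContDiff ℝ 1 F) (hc : HasCompactSupport F)
    (i : Fin 4) : ∫ y, pderiv i F y = 0 := by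
  have hint : Integrable fun y => fderiv ℝ F y (EuclideanSpace.single i 1) :=
    ((hF.continuous_fderiv (by simp)).clm_apply continuous_const).integrable_of_hasCompactSupport
      (hc.fderiv_apply (𝕜 := ℝ) _)
  have hparts := integral_mul_fderiv_eq_neg_fderiv_mul_of_integrable (μ := volume) (𝕜 := ℝ)
    (f := fun _ : E4 => (1 : ℝ)) (g := F) (v := EuclideanSpace.single i 1) (by simp)
    (by simpa only [one_mul] using hint)
    (by simpa using hF.continuous.integrable_of_hasCompactSupport hc)
    (by simp) (fun y _ => hF.differentiable (by simp) y)
  simpa [pderiv] using hparts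

theorem setIntegral_pderiv_eq_zero (hU : IsOpen U) (hK : IsCompact K) (hKU : K ⊆ U)
    (hf : ∀ y ∈ U, ContDiffAt ℝ 1 f y) (hzero : ∀ y ∈ U, y ∉ K → f y = 0) (i : Fin 4) :
    ∫ y in U, pderiv i f y = 0 := by
  have hsmooth := contDiff_indicator_of_eq_zero_off_closed hU hK.isClosed hKU hf hzero
  have hoff : ∀ y ∈ Set.univ, y ∉ K → U.indicator f y = 0 := fun y _ hyK => by
    by_cases hy : y ∈ U
    · rw [Set.indicator_of_mem hy, hzero y hy hyK]
    · exact Set.indicator_of_notMem hy f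
  rw [← integral_pderiv_eq_zero hsmooth (HasCompactSupport.intro hK fun y => hoff y trivial) i,
    ← setIntegral_eq_integral_of_forall_compl_eq_zero fun y hy => pderiv_eq_zero_of_notMem
      isOpen_univ hK.isClosed hoff trivial (fun hyK => hy (hKU hyK)) i]
  exact setIntegral_congr_fun hU.measurableSet fun y hy =>
    (pderiv_congr_of_isOpen hU Set.eqOn_indicator hy i).symm

theorem extDerivThree_mul {ψ : E4 → Fin 4 → Fin 4 → Fin 4 → ℝ} {y : E4}
    (hf : DifferentiableAt ℝ f y) (hψ : ∀ i j k, DifferentiableAt ℝ (fun z => ψ z i j k) y) :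
    extDerivThree (fun z i j k => f z * ψ z i j k) y =
      wedgeOneThree (fun l => pderiv l f y) (ψ y) + f y * extDerivThree ψ y := by
  simp only [extDerivThree, wedgeOneThree, pderiv_mul hf (hψ _ _ _)]
  ring

theorem setIntegral_extDerivThree_eq_zero {ψ : E4 → Fin 4 → Fin 4 → Fin 4 → ℝ} (hU : IsOpen U)
    (hK : IsCompact K) (hKU : K ⊆ U) (hψ : ∀ i j k, ∀ y ∈ U, ContDiffAt ℝ ∞ (fun z => ψ z i j k) y)
    (hzero : ∀ i j k, ∀ y ∈ U, y ∉ K → ψ y i j k = 0) : ∫ y in U, extDerivThree ψ y = 0 := by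
  have hint : ∀ l i j k, IntegrableOn (pderiv l fun z => ψ z i j k) U := fun l i j k =>
    integrableOn_of_eq_zero_off_compact hU hK hKU
      (fun y hy => (contDiffAt_pderiv (hψ i j k y hy) l).continuousAt.continuousWithinAt)
      fun y hy hyK => pderiv_eq_zero_of_notMem hU hK.isClosed (hzero i j k) hy hyK l
  have hzero_int := fun l i j k => setIntegral_pderiv_eq_zero hU hK hKU
    (fun y hy => (hψ i j k y hy).of_le (by simp)) (hzero i j k) l
  have hsub := (hint 0 1 2 3).sub (hint 1 0 2 3)
  refine (integral_sub (hsub.add (hint 2 0 1 3)) (hint 3 0 1 2)).trans ?_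
  rw [hzero_int, sub_zero]
  refine (integral_add hsub (hint 2 0 1 3)).trans ?_
  rw [hzero_int, add_zero]
  refine (integral_sub (hint 0 1 2 3) (hint 1 0 2 3)).trans ?_
  rw [hzero_int, hzero_int, sub_zero]

theorem det_fderiv_eq_det_jacMat {φ : E4 → E4} {z : E4} (hφ : DifferentiableAt ℝ φ z) :
    (fderiv ℝ φ z).det = (jacMat φ z).det := by
  rw [ContinuousLinearMap.det,
    ← LinearMap.det_toMatrix (EuclideanSpace.basisFun (Fin 4) ℝ).toBasis]
  congr 1
  ext a i
  have hentry := congrArg (fun v : E4 => v a) (fderiv_toLp_eq_jacMat_mulVec hφ (Pi.single i 1))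
  simp only [Matrix.mulVec_single_one, Matrix.col_apply] at hentry
  simpa [LinearMap.toMatrix_apply] using hentry

theorem setIntegral_image_eq_abs_det_jacMat {φ : E4 → E4} (hU : MeasurableSet U)
    (hφ : ∀ z ∈ U, DifferentiableAt ℝ φ z) (hinj : Set.InjOn φ U) (g : E4 → ℝ) :
    ∫ y in φ '' U, g y = ∫ z in U, |(jacMat φ z).det| * g (φ z) := by
  rw [integral_image_eq_integral_abs_det_fderiv_smul _ hU
    (fun z hz => (hφ z hz).hasFDerivAt.hasFDerivWithinAt) hinj]
  refine setIntegral_congr_fun hU fun z hz => ?_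
  simp only [det_fderiv_eq_det_jacMat (hφ z hz), smul_eq_mul]

end OpenSets

/-- The sign of the Ricci density, which records whether the coordinates are positive for the
orientation given by `ρ ∧ ω`. -/
def ricciSign (G J : E4 → Mat) (y : E4) : ℝ := SignType.sign (ricciDensity G J y)

/-- The density of `q dc ∧ ψ` for the orientation given by `ρ ∧ ω`, where `q` is `torRatio` and
`ψ` is `torThreeForm`. -/
def flux (G J : E4 → Mat) (c : E4 → ℝ) (y : E4) : ℝ :=
  ricciSign G J y * torRatio G J y * wedgeOneThree (fun i => pderiv i c y) (torThreeForm G J y)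

/-- The density of `q² ρ ∧ ω` for the orientation given by `ρ ∧ ω`, where `q` is `torRatio`. -/
def torEnergy (G J : E4 → Mat) (y : E4) : ℝ := torRatio G J y ^ 2 * |ricciDensity G J y|

theorem torEnergy_nonneg (G J : E4 → Mat) (y : E4) : 0 ≤ torEnergy G J y :=
  mul_nonneg (sq_nonneg _) (abs_nonneg _)

section Flux

variable {G J : E4 → Mat} {c d : E4 → ℝ} {y : E4}

theorem flux_congr (h : c =ᶠ[nhds y] d) : flux G J c y = flux G J d y := by
  simp only [flux, pderiv_congr h]

theorem flux_const (G J : E4 → Mat) (r : ℝ) (y : E4) : flux G J (fun _ => r) y = 0 := by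
  simp [flux, pderiv_const, wedgeOneThree]

theorem flux_sum {ι : Type*} (s : Finset ι) {c : ι → E4 → ℝ}
    (hc : ∀ i ∈ s, DifferentiableAt ℝ (c i) y) :
    flux G J (fun z => ∑ i ∈ s, c i z) y = ∑ i ∈ s, flux G J (c i) y := by
  simp only [flux, pderiv_sum hc, wedgeOneThree, Finset.sum_mul, ← Finset.sum_sub_distrib,
    ← Finset.sum_add_distrib, Finset.mul_sum]

end Flux

namespace IsAHOneOn

variable {U K : Set E4} {G J : E4 → Mat} {c : E4 → ℝ} {y : E4}

theorem ricciSign_eventuallyEq (h : IsAHOneOn U G J) (hy : y ∈ U) (hρ : ricciDensity G J y ≠ 0) :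
    ricciSign G J =ᶠ[nhds y] fun _ => ricciSign G J y := by
  have hsign := (continuousAt_sign_of_ne_zero hρ).comp (h.smooth_ricciDensity hy).continuousAt
  filter_upwards [hsign.eventually (isOpen_discrete {SignType.sign (ricciDensity G J y)}
    |>.mem_nhds rfl)] with z hz
  exact congrArg (fun s : SignType => (s : ℝ)) hz

theorem smooth_ricciSign_mul_torRatio (h : IsAHOneOn U G J) (hy : y ∈ U)
    (hρ : ricciDensity G J y ≠ 0) :
    ContDiffAt ℝ ∞ (fun z => ricciSign G J z * torRatio G J z) y :=
  (contDiffAt_const.congr_of_eventuallyEq (h.ricciSign_eventuallyEq hy hρ)).mul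
    (h.smooth_torRatio hy hρ)

theorem smooth_flux (h : IsAHOneOn U G J) (hy : y ∈ U) (hρ : ricciDensity G J y ≠ 0)
    (hc : ContDiffAt ℝ ∞ c y) : ContDiffAt ℝ ∞ (flux G J c) y := by
  have hdc := contDiffAt_pderiv hc
  have hψ := h.smooth_torThreeForm hy
  exact (h.smooth_ricciSign_mul_torRatio hy hρ).mul
    (((((hdc 0).mul (hψ 1 2 3)).sub ((hdc 1).mul (hψ 0 2 3))).add ((hdc 2).mul (hψ 0 1 3))).sub
      ((hdc 3).mul (hψ 0 1 2)))

theorem continuousOn_torEnergy (h : IsAHOneOn U G J) (hρ : ∀ z ∈ U, ricciDensity G J z ≠ 0) :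
    ContinuousOn (torEnergy G J) U := fun _ hy =>
  (((h.smooth_torRatio hy (hρ _ hy)).continuousAt.pow 2).mul
    (h.smooth_ricciDensity hy).continuousAt.abs).continuousWithinAt

theorem pderiv_ricciSign_mul_torRatio (h : IsAHOneOn U G J) (hy : y ∈ U)
    (hρ : ricciDensity G J y ≠ 0) (l : Fin 4) :
    pderiv l (fun z => ricciSign G J z * torRatio G J z) y =
      ricciSign G J y * pderiv l (torRatio G J) y := by
  have hconst : (fun z => ricciSign G J z * torRatio G J z) =ᶠ[nhds y]
      fun z => ricciSign G J y * torRatio G J z :=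
    (h.ricciSign_eventuallyEq hy hρ).mul .rfl
  rw [pderiv_congr hconst,
    pderiv_mul (by fun_prop) ((h.smooth_torRatio hy hρ).differentiableAt (by simp)), pderiv_const,
    zero_mul, zero_add]

theorem extDerivThree_mul_torThreeForm (h : IsAHOneOn U G J)
    (hρ : ∀ z ∈ U, ricciDensity G J z ≠ 0) (hy : y ∈ U) (hc : ContDiffAt ℝ ∞ c y) :
    extDerivThree
        (fun z i j k => c z * (ricciSign G J z * torRatio G J z) * torThreeForm G J z i j k) y =
      flux G J c y - (1 / 2 : ℝ) * (c y * torEnergy G J y) := by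
  have hq := (h.smooth_ricciSign_mul_torRatio hy (hρ y hy)).differentiableAt (by simp)
  have hc' := hc.differentiableAt (by simp)
  have hcq : DifferentiableAt ℝ (fun z => c z * (ricciSign G J z * torRatio G J z)) y := hc'.mul hq
  have hdq := h.wedgeOneThree_pderiv_torRatio hρ hy
  have hsign : ricciSign G J y * ricciDensity G J y = |ricciDensity G J y| := sign_mul_self _
  rw [extDerivThree_mul hcq
      fun i j k => (h.smooth_torThreeForm hy i j k).differentiableAt (by simp),
    h.extDerivThree_torThreeForm_eq_torRatio hy (hρ y hy), flux, torEnergy, ← hsign]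
  simp only [pderiv_mul hc' hq, h.pderiv_ricciSign_mul_torRatio hy (hρ y hy)]
  rw [wedgeOneThree] at hdq ⊢
  rw [wedgeOneThree]
  linear_combination c y * ricciSign G J y * hdq

theorem setIntegral_flux (h : IsAHOneOn U G J) (hρ : ∀ z ∈ U, ricciDensity G J z ≠ 0)
    (hK : IsCompact K) (hKU : K ⊆ U) (hc : ∀ y ∈ U, ContDiffAt ℝ ∞ c y)
    (hzero : ∀ y ∈ U, y ∉ K → c y = 0) :
    ∫ y in U, flux G J c y = (1 / 2 : ℝ) * ∫ y in U, c y * torEnergy G J y := by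
  have hstokes := setIntegral_extDerivThree_eq_zero h.isOpen hK hKU
    (ψ := fun z i j k => c z * (ricciSign G J z * torRatio G J z) * torThreeForm G J z i j k)
    (fun i j k y hy => ((hc y hy).mul (h.smooth_ricciSign_mul_torRatio hy (hρ y hy))).mul
      (h.smooth_torThreeForm hy i j k))
    (fun i j k y hy hyK => by rw [hzero y hy hyK, zero_mul, zero_mul])
  have hflux : IntegrableOn (flux G J c) U := integrableOn_of_eq_zero_off_compact h.isOpen hK hKU
    (fun y hy => (h.smooth_flux hy (hρ y hy) (hc y hy)).continuousAt.continuousWithinAt)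
    fun y hy hyK => by
      simp [flux, wedgeOneThree, pderiv_eq_zero_of_notMem h.isOpen hK.isClosed hzero hy hyK]
  have henergy : IntegrableOn (fun y => c y * torEnergy G J y) U :=
    integrableOn_of_eq_zero_off_compact h.isOpen hK hKU
      (ContinuousOn.mul (fun y hy => (hc y hy).continuousAt.continuousWithinAt)
        (h.continuousOn_torEnergy hρ))
      fun y hy hyK => by rw [hzero y hy hyK, zero_mul]
  rw [setIntegral_congr_fun h.isOpen.measurableSet fun y hy =>
      h.extDerivThree_mul_torThreeForm hρ hy (hc y hy),
    integral_sub hflux (henergy.const_mul _), integral_const_mul] at hstokes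
  exact sub_eq_zero.1 hstokes

end IsAHOneOn

theorem IsCoordChange.flux_eq {U V : Set E4} {φ : E4 → E4} {G J G' J' : E4 → Mat}
    (h : IsCoordChange U V φ G J G' J') {z : E4} (hz : z ∈ V) {f : E4 → ℝ}
    (hf : DifferentiableAt ℝ f (φ z)) :
    flux G' J' (fun w => f (φ w)) z = |(jacMat φ z).det| * flux G J f (φ z) := by
  have hdet : (SignType.sign (jacMat φ z).det : ℝ) * (jacMat φ z).det = |(jacMat φ z).det| :=
    sign_mul_self _
  rw [flux, flux, h.wedgeOneThree_pderiv_comp hz hf, h.torRatio_eq hz, ricciSign,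
    h.ricciDensity_eq hz, sign_mul, SignType.coe_mul, ← hdet, ricciSign]
  ring

/-! ### Globalization by a partition of unity -/

section Global

variable {M : Type*} [TopologicalSpace M] [ChartedSpace E4 M] [IsManifold 𝓘(ℝ, E4) ∞ M]
  {e e' : OpenPartialHomeomorph M E4} {f k : M → ℝ} {y : E4}

theorem exists_finite_chart_partition [T2Space M] [CompactSpace M] :
    ∃ (t : Finset M) (χ : SmoothPartitionOfUnity t 𝓘(ℝ, E4) M),
      χ.IsSubordinate fun i => (chartAt E4 (i : M)).source := by
  obtain ⟨t, ht⟩ := CompactSpace.elim_nhds_subcover (fun x : M => (chartAt E4 x).source)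
    fun x => (chartAt E4 x).open_source.mem_nhds (mem_chart_source E4 x)
  refine ⟨t, SmoothPartitionOfUnity.exists_isSubordinate 𝓘(ℝ, E4) isClosed_univ _
    (fun i => (chartAt E4 (i : M)).open_source) ?_⟩
  simp only [Set.iUnion_subtype]
  exact ht.ge

theorem contDiffAt_comp_symm (he : e ∈ atlas E4 M) (hf : ContMDiff 𝓘(ℝ, E4) 𝓘(ℝ, ℝ) ∞ f)
    (hy : y ∈ e.target) : ContDiffAt ℝ ∞ (fun z => f (e.symm z)) y :=
  (hf.contMDiffAt.comp y (contMDiffAt_atlas_symm he hy)).contDiffAt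

namespace AlmostHermitianStructure

variable (S : AlmostHermitianStructure M)

theorem ricciDensity_ne_zero (hS : S.IsAH1) (hs : S.ScalarCurvatureNowhereZero)
    (he : e ∈ atlas E4 M) (hy : y ∈ e.target) :
    ricciDensity (S.metricCoef e) (S.acsCoef e) y ≠ 0 :=
  (S.isAHOneOn hS he).ricciDensity_ne_zero hy (hs e he y hy)

/-- The flux density of a function on `M`, read in the chart `e`. -/
def chartFlux (e : OpenPartialHomeomorph M E4) (f : M → ℝ) : E4 → ℝ :=
  flux (S.metricCoef e) (S.acsCoef e) fun z => f (e.symm z)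

theorem mul_chartFlux_eq_zero (hy : y ∈ e.target) (h : e.symm y ∉ tsupport f ∩ tsupport k) :
    k (e.symm y) * S.chartFlux e f y = 0 := by
  by_cases hk : e.symm y ∈ tsupport k
  · have hf : (fun z => f (e.symm z)) =ᶠ[nhds y] fun _ => 0 := by
      filter_upwards [(e.continuousAt_symm hy).eventually
        ((isClosed_tsupport f).isOpen_compl.mem_nhds fun hf => h ⟨hf, hk⟩)] with z hz
      exact image_eq_zero_of_notMem_tsupport hz
    rw [chartFlux, flux_congr hf, flux_const, mul_zero]
  · rw [image_eq_zero_of_notMem_tsupport hk, zero_mul]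

theorem chartFlux_transition (hS : S.IsAH1) (he : e ∈ atlas E4 M) (he' : e' ∈ atlas E4 M)
    (hf : ContMDiff 𝓘(ℝ, E4) 𝓘(ℝ, ℝ) ∞ f) (hy : y ∈ (e'.symm ≫ₕ e).source) :
    S.chartFlux e' f y =
      |(jacMat (e'.symm ≫ₕ e) y).det| * S.chartFlux e f ((e'.symm ≫ₕ e) y) := by
  have hcomp : (fun w => f (e'.symm w)) =ᶠ[nhds y] fun w => f (e.symm ((e'.symm ≫ₕ e) w)) := by
    filter_upwards [(e'.symm ≫ₕ e).open_source.mem_nhds hy] with w hw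
    exact congrArg f (e.left_inv hw.2).symm
  rw [chartFlux, flux_congr hcomp]
  exact (S.isCoordChange hS he he').flux_eq hy
    ((contDiffAt_comp_symm he hf (e.map_source hy.2)).differentiableAt (by simp))

theorem setIntegral_mul_chartFlux_eq (hS : S.IsAH1) (he : e ∈ atlas E4 M) (he' : e' ∈ atlas E4 M)
    (hf : ContMDiff 𝓘(ℝ, E4) 𝓘(ℝ, ℝ) ∞ f)
    (hsupp : tsupport f ∩ tsupport k ⊆ e.source ∩ e'.source) :
    ∫ y in e.target, k (e.symm y) * S.chartFlux e f y =
      ∫ z in e'.target, k (e'.symm z) * S.chartFlux e' f z := by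
  have hrestrict : ∫ y in e.target, k (e.symm y) * S.chartFlux e f y =
      ∫ y in (e'.symm ≫ₕ e).target, k (e.symm y) * S.chartFlux e f y :=
    setIntegral_eq_of_subset_of_forall_sdiff_eq_zero e.open_target.measurableSet
      (fun y hy => hy.1)
      fun y hy => S.mul_chartFlux_eq_zero hy.1 fun hmem => hy.2 ⟨hy.1, (hsupp hmem).2⟩
  have hrestrict' : ∫ z in e'.target, k (e'.symm z) * S.chartFlux e' f z =
      ∫ z in (e'.symm ≫ₕ e).source, k (e'.symm z) * S.chartFlux e' f z :=
    setIntegral_eq_of_subset_of_forall_sdiff_eq_zero e'.open_target.measurableSet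
      (fun y hy => hy.1)
      fun y hy => S.mul_chartFlux_eq_zero hy.1 fun hmem => hy.2 ⟨hy.1, (hsupp hmem).1⟩
  have hmeas := (e'.symm ≫ₕ e).open_source.measurableSet
  rw [hrestrict, hrestrict', ← (e'.symm ≫ₕ e).image_source_eq_target,
    setIntegral_image_eq_abs_det_jacMat hmeas
      (fun z hz => (contDiffAt_transition he he' hz).differentiableAt (by simp))
      (e'.symm ≫ₕ e).injOn]
  refine setIntegral_congr_fun hmeas fun z hz => ?_
  have hpoint : e.symm ((e'.symm ≫ₕ e) z) = e'.symm z := e.left_inv hz.2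
  simp only [hpoint, S.chartFlux_transition hS he he' hf hz]
  ring

theorem integrableOn_mul_chartFlux [CompactSpace M] (hS : S.IsAH1)
    (hs : S.ScalarCurvatureNowhereZero) (he : e ∈ atlas E4 M)
    (hf : ContMDiff 𝓘(ℝ, E4) 𝓘(ℝ, ℝ) ∞ f) (hk : ContMDiff 𝓘(ℝ, E4) 𝓘(ℝ, ℝ) ∞ k)
    (hsupp : tsupport f ∩ tsupport k ⊆ e.source) :
    IntegrableOn (fun y => k (e.symm y) * S.chartFlux e f y) e.target := by
  have hcompact : IsCompact (e '' (tsupport f ∩ tsupport k)) :=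
    ((isClosed_tsupport f).inter (isClosed_tsupport k)).isCompact.image_of_continuousOn
      (e.continuousOn.mono hsupp)
  refine integrableOn_of_eq_zero_off_compact e.open_target hcompact
    ((Set.image_mono hsupp).trans e.image_source_eq_target.subset) (fun y hy => ?_)
    fun y hy hyK => S.mul_chartFlux_eq_zero hy fun hmem => hyK ⟨_, hmem, e.right_inv hy⟩
  exact ((contDiffAt_comp_symm he hk hy).continuousAt.mul ((S.isAHOneOn hS he).smooth_flux hy
    (S.ricciDensity_ne_zero hS hs he hy)
    (contDiffAt_comp_symm he hf hy)).continuousAt).continuousWithinAt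

theorem setIntegral_chartFlux (hS : S.IsAH1) (hs : S.ScalarCurvatureNowhereZero)
    (he : e ∈ atlas E4 M) (hf : ContMDiff 𝓘(ℝ, E4) 𝓘(ℝ, ℝ) ∞ f) (hcompact : HasCompactSupport f)
    (hsupp : tsupport f ⊆ e.source) :
    ∫ y in e.target, S.chartFlux e f y = (1 / 2 : ℝ) *
      ∫ y in e.target, f (e.symm y) * torEnergy (S.metricCoef e) (S.acsCoef e) y :=
  (S.isAHOneOn hS he).setIntegral_flux (fun _ hz => S.ricciDensity_ne_zero hS hs he hz)
    (hcompact.image_of_continuousOn (e.continuousOn.mono hsupp))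
    ((Set.image_mono hsupp).trans e.image_source_eq_target.subset)
    (fun _ hy => contDiffAt_comp_symm he hf hy)
    fun _ hy hyK => image_eq_zero_of_notMem_tsupport fun hmem => hyK ⟨_, hmem, e.right_inv hy⟩

theorem mul_torEnergy_eq_zero (hS : S.IsAH1) (hs : S.ScalarCurvatureNowhereZero)
    (he : e ∈ atlas E4 M) (hf : ContMDiff 𝓘(ℝ, E4) 𝓘(ℝ, ℝ) ∞ f) (hnonneg : ∀ x, 0 ≤ f x)
    (hcompact : HasCompactSupport f) (hsupp : tsupport f ⊆ e.source)
    (hint : ∫ y in e.target, f (e.symm y) * torEnergy (S.metricCoef e) (S.acsCoef e) y = 0)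
    (hy : y ∈ e.target) :
    f (e.symm y) * torEnergy (S.metricCoef e) (S.acsCoef e) y = 0 := by
  have hcont : ContinuousOn
      (fun y => f (e.symm y) * torEnergy (S.metricCoef e) (S.acsCoef e) y) e.target :=
    ContinuousOn.mul
      (fun y hy => (contDiffAt_comp_symm he hf hy).continuousAt.continuousWithinAt)
      ((S.isAHOneOn hS he).continuousOn_torEnergy
        fun _ hz => S.ricciDensity_ne_zero hS hs he hz)
  have hintegrable := integrableOn_of_eq_zero_off_compact e.open_target
    (hcompact.image_of_continuousOn (e.continuousOn.mono hsupp))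
    ((Set.image_mono hsupp).trans e.image_source_eq_target.subset) hcont fun y hy hyK => by
      rw [image_eq_zero_of_notMem_tsupport fun hmem => hyK ⟨_, hmem, e.right_inv hy⟩, zero_mul]
  have hae := (integral_eq_zero_iff_of_nonneg
    (fun y => mul_nonneg (hnonneg _) (torEnergy_nonneg _ _ y)) hintegrable).1 hint
  exact Measure.eqOn_open_of_ae_eq hae e.open_target hcont continuousOn_const hy

section Partition

variable {ι : Type*} {e : ι → OpenPartialHomeomorph M E4}
  {χ : SmoothPartitionOfUnity ι 𝓘(ℝ, E4) M}

theorem sum_integral_chartFlux [Fintype ι] [CompactSpace M] (hS : S.IsAH1)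
    (hs : S.ScalarCurvatureNowhereZero) (he : ∀ i, e i ∈ atlas E4 M)
    (hχ : χ.IsSubordinate fun i => (e i).source) :
    ∑ i, ∫ y in (e i).target, S.chartFlux (e i) (χ i) y = 0 := by
  have hone : ∀ x, ∑ i, χ i x = 1 := fun x =>
    (finsum_eq_sum_of_fintype _).symm.trans (χ.sum_eq_one (Set.mem_univ x))
  have hsupp : ∀ i j, tsupport (χ i) ∩ tsupport (χ j) ⊆ (e i).source ∩ (e j).source :=
    fun i j => Set.inter_subset_inter (hχ i) (hχ j)
  have hsplit : ∀ i, ∫ y in (e i).target, S.chartFlux (e i) (χ i) y =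
      ∑ j, ∫ y in (e j).target, χ j ((e j).symm y) * S.chartFlux (e j) (χ i) y := by
    intro i
    simp only [← fun j => S.setIntegral_mul_chartFlux_eq hS (he i) (he j) (χ i).contMDiff
      (hsupp i j)]
    rw [← integral_finsetSum _ fun j _ => S.integrableOn_mul_chartFlux hS hs (he i)
      (χ i).contMDiff (χ j).contMDiff ((hsupp i j).trans Set.inter_subset_left)]
    simp only [← Finset.sum_mul, hone, one_mul]
  simp only [hsplit]
  rw [Finset.sum_comm]
  refine Finset.sum_eq_zero fun j _ => ?_
  rw [← integral_finsetSum _ fun i _ => S.integrableOn_mul_chartFlux hS hs (he j)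
    (χ i).contMDiff (χ j).contMDiff ((hsupp i j).trans Set.inter_subset_right)]
  refine setIntegral_eq_zero_of_forall_eq_zero fun y hy => ?_
  rw [← Finset.mul_sum]
  simp only [chartFlux]
  rw [← flux_sum _ fun i _ =>
    (contDiffAt_comp_symm (he j) (χ i).contMDiff hy).differentiableAt (by simp)]
  simp only [hone, flux_const, mul_zero]

theorem setIntegral_partition_mul_torEnergy [Finite ι] [CompactSpace M] (hS : S.IsAH1)
    (hs : S.ScalarCurvatureNowhereZero) (he : ∀ i, e i ∈ atlas E4 M)
    (hχ : χ.IsSubordinate fun i => (e i).source) (i : ι) :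
    ∫ y in (e i).target, χ i ((e i).symm y) *
      torEnergy (S.metricCoef (e i)) (S.acsCoef (e i)) y = 0 := by
  cases nonempty_fintype ι
  have hsum := S.sum_integral_chartFlux hS hs he hχ
  simp only [fun i => S.setIntegral_chartFlux hS hs (he i) (χ i).contMDiff
    (HasCompactSupport.of_compactSpace _) (hχ i), ← Finset.mul_sum] at hsum
  exact (Finset.sum_eq_zero_iff_of_nonneg fun j _ => integral_nonneg fun y =>
    mul_nonneg (χ.nonneg j _) (torEnergy_nonneg _ _ y)).1
    ((mul_eq_zero.1 hsum).resolve_left (by norm_num)) i (Finset.mem_univ i)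

end Partition

theorem torRatio_eq_zero [T2Space M] [CompactSpace M] (hS : S.IsAH1)
    (hs : S.ScalarCurvatureNowhereZero) (he : e ∈ atlas E4 M) (hy : y ∈ e.target) :
    torRatio (S.metricCoef e) (S.acsCoef e) y = 0 := by
  obtain ⟨t, χ, hχ⟩ := exists_finite_chart_partition (M := M)
  obtain ⟨i, hi⟩ := χ.exists_pos_of_mem (Set.mem_univ (e.symm y))
  have hatlas : chartAt E4 (i : M) ∈ atlas E4 M := chart_mem_atlas E4 _
  have hsource : e.symm y ∈ (chartAt E4 (i : M)).source := hχ i (subset_tsupport _ hi.ne')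
  have htarget := (chartAt E4 (i : M)).map_source hsource
  have hzero := S.mul_torEnergy_eq_zero hS hs hatlas (χ i).contMDiff (χ.nonneg i)
    (HasCompactSupport.of_compactSpace _) (hχ i)
    (S.setIntegral_partition_mul_torEnergy hS hs
      (e := fun j : t => chartAt E4 (j : M)) (fun j => chart_mem_atlas E4 (j : M)) hχ i)
    htarget
  rw [(chartAt E4 (i : M)).left_inv hsource] at hzero
  rw [(S.isCoordChange hS hatlas he).torRatio_eq ⟨hy, hsource⟩]
  exact pow_eq_zero_iff two_ne_zero |>.1 <| (mul_eq_zero.1 <|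
    (mul_eq_zero.1 hzero).resolve_left hi.ne').resolve_right
      (abs_ne_zero.2 (S.ricciDensity_ne_zero hS hs hatlas htarget))

theorem torForm_eq_zero [T2Space M] [CompactSpace M] (hS : S.IsAH1)
    (hs : S.ScalarCurvatureNowhereZero) (he : e ∈ atlas E4 M) (hy : y ∈ e.target) :
    torForm (S.metricCoef e) (S.acsCoef e) y = 0 := by
  ext i j
  rw [(S.isAHOneOn hS he).torForm_eq_torRatio_mul hy (S.ricciDensity_ne_zero hS hs he hy),
    S.torRatio_eq_zero hS hs he hy, zero_mul, Matrix.zero_apply]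

end AlmostHermitianStructure

end Global

/-! ### Parallel almost complex structures are Kähler -/

theorem nijenhuis_eq_covD {Γ : Fin 4 → E4 → Mat} {J : E4 → Mat} {y : E4}
    (hΓ : ∀ i j k, Γ i y k j = Γ j y k i) (k i j : Fin 4) :
    nijenhuis J k i j y =
      ∑ l, (J y l i * covD Γ l J y k j - J y l j * covD Γ l J y k i)
        + (J y * covD Γ j J y) k i - (J y * covD Γ i J y) k j := by
  have hleft : ∑ l, J y l i * (Γ l y * J y) k j = ∑ l, J y l j * (Γ l y * J y) k i := by
    simp only [Matrix.mul_apply, Finset.mul_sum]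
    rw [Finset.sum_comm]
    exact Finset.sum_congr rfl fun l _ => Finset.sum_congr rfl fun m _ => by rw [hΓ m l]; ring
  have hmiddle (i j : Fin 4) : ∑ l, J y l i * (J y * Γ l y) k j = (J y * Γ j y * J y) k i := by
    rw [Matrix.mul_apply]
    refine Finset.sum_congr rfl fun l _ => ?_
    rw [mul_comm, Matrix.mul_apply, Matrix.mul_apply]
    exact congrArg (· * _) (Finset.sum_congr rfl fun m _ => by rw [hΓ])
  have hright : (J y * (J y * Γ j y)) k i = (J y * (J y * Γ i y)) k j := by
    rw [← Matrix.mul_assoc, ← Matrix.mul_assoc, Matrix.mul_apply, Matrix.mul_apply]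
    exact Finset.sum_congr rfl fun l _ => by rw [hΓ]
  have hnijenhuis : nijenhuis J k i j y =
      ∑ l, (J y l i * pderivMat l J y k j - J y l j * pderivMat l J y k i)
        + (J y * pderivMat j J y) k i - (J y * pderivMat i J y) k j := rfl
  rw [hnijenhuis]
  simp only [covD, Matrix.sub_apply, Matrix.add_apply, mul_sub, mul_add, Finset.sum_sub_distrib,
    Finset.sum_add_distrib, ← Matrix.mul_assoc (J y) (Γ _ y)]
  linear_combination hmiddle i j - hmiddle j i - hleft + hright

theorem IsAHOneOn.extDerivTwo_fundForm_eq_zero {U : Set E4} {G J : E4 → Mat} {y : E4}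
    (h : IsAHOneOn U G J) (hy : y ∈ U) (hparallel : ∀ m, covD (leviCivita G) m J y = 0)
    (i j k : Fin 4) : extDerivTwo (fundForm G J) i j k y = 0 := by
  refine (h.isMetricOn.extDerivTwo_transpose_mul h.smooth_acs hy (h.herm y hy).skew i j k).trans ?_
  simp [hparallel]

namespace AlmostHermitianStructure

variable {M : Type*} [TopologicalSpace M] [ChartedSpace E4 M] [IsManifold 𝓘(ℝ, E4) ∞ M]
  (S : AlmostHermitianStructure M) {e : OpenPartialHomeomorph M E4} {y : E4}

theorem extDerivTwo_omegaCoef (he : e ∈ atlas E4 M) (hy : y ∈ e.target) (i j k : Fin 4) :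
    extDerivTwo (S.omegaCoef e) i j k y =
      extDerivTwo (fundForm (S.metricCoef e) (S.acsCoef e)) i j k y := by
  have hpartial (i j k : Fin 4) : pderiv i (fun z => S.omegaCoef e z j k) y =
      pderiv i (fun z => fundForm (S.metricCoef e) (S.acsCoef e) z j k) y :=
    pderiv_congr_of_isOpen e.open_target (fun w hw => by rw [S.omegaCoef_eq_fundForm he hw]) hy i
  simp only [extDerivTwo, hpartial]

theorem exists_isClosedLeeFormOn (hθ : S.IsLocallyConformallyAlmostKahler) (he : e ∈ atlas E4 M) :
    ∃ θ, IsClosedLeeFormOn e.target (S.metricCoef e) (S.acsCoef e) θ := by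
  obtain ⟨θ, ⟨hsmooth, hlee⟩, hclosed⟩ := hθ
  refine ⟨formCoef θ e, fun i z hz => (hsmooth e he i).contDiffAt (e.open_target.mem_nhds hz),
    hclosed e he, fun z hz => ?_⟩
  ext i j k
  rw [← S.extDerivTwo_omegaCoef he hz, hlee e he z hz i j k, wedgeOneTwo,
    S.omegaCoef_eq_fundForm he hz, wedgeOneTwoAt]

theorem covD_acsCoef_eq_zero [T2Space M] [CompactSpace M] (hS : S.IsAH1)
    (hθ : S.IsLocallyConformallyAlmostKahler) (hs : S.ScalarCurvatureNowhereZero)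
    (he : e ∈ atlas E4 M) (hy : y ∈ e.target) (m : Fin 4) :
    covD (leviCivita (S.metricCoef e)) m (S.acsCoef e) y = 0 := by
  obtain ⟨θ, hLee⟩ := S.exists_isClosedLeeFormOn hθ he
  exact (S.isAHOneOn hS he).covD_acs_eq_zero (fun _ hz => S.ricciDensity_ne_zero hS hs he hz)
    (fun _ hz => S.torForm_eq_zero hS hs he hz) hLee hy m

end AlmostHermitianStructure

end AlmostHermitian

end

theorem mainTheorem7 {M : Type*} [TopologicalSpace M] [T2Space M] [CompactSpace M]
    [ChartedSpace AlmostHermitian.E4 M] [IsManifold 𝓘(ℝ, AlmostHermitian.E4) ∞ M]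
    (S : AlmostHermitian.AlmostHermitianStructure M)
    (hAH1 : S.IsAH1)
    (hθ : S.IsLocallyConformallyAlmostKahler)
    (hs : S.ScalarCurvatureNowhereZero) :
    S.IsKahler := by
  have hparallel {e : OpenPartialHomeomorph M AlmostHermitian.E4}
      (he : e ∈ atlas AlmostHermitian.E4 M) {y : AlmostHermitian.E4} (hy : y ∈ e.target) :=
    S.covD_acsCoef_eq_zero hAH1 hθ hs he hy
  constructor
  · intro e he y hy k i j
    rw [AlmostHermitian.nijenhuis_eq_covD ((S.isAHOneOn hAH1 he).isMetricOn.leviCivita_symm hy)]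
    simp [hparallel he hy]
  · intro e he y hy i j k
    rw [S.extDerivTwo_omegaCoef he hy]
    exact (S.isAHOneOn hAH1 he).extDerivTwo_fundForm_eq_zero hy (hparallel he hy) i j k
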